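/- Let $(\mathbf{M},\otimes,I)$ be a complete and cocomplete closed symmetric monoidal category. Coloured operads. For a set $\mathfrak{C}$, a $\mathfrak{C}$-coloured operad $\mathcal{O}$ in $\mathbf{M}$ consists of objects $\mathcal{O}\binom{t}{\underline{c}}$ for all $n\ge 0$, $\underline{c}=(c_1,\dots,c_n)\in\mathfrak{C}^n$, $t\in\mathfrak{C}$, with permutation actions $\mathcal{O}(\sigma):\mathcal{O}\binom{t}{\underline{c}}\to\mathcal{O}\binom{t}{\underline{c}\sigma}$, compositions $\gamma$ and units $\mathbb{1}:I\to\mathcal{O}\binom{c}{c}$ satisfying the usual permutation, associativity, unit and equivariance axioms. Together with their morphisms (which preserve all this structure) they form a category $\mathbf{Op}_{\mathfrak{C}}(\mathbf{M})$. Let $U:\mathbf{Op}_{\mathfrak{C}}(\mathbf{M})\to\mathbf{Seq}_{\mathfrak{C}}(\mathbf{M})$ be the forgetful functor to the category of families $X\binom{t}{\underline{c}}$ of objects of $\mathbf{M}$ and families of morphisms. An $\mathcal{O}$-algebra is a family $(A_c)_{c\in\mathfrak{C}}$ of objects with an action $\alpha:\mathcal{O}\binom{t}{\underline{c}}\otimes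 A_{c_1}\otimes\cdots\otimes A_{c_n}\to A_t$ that is associative, unital and equivariant. A morphism of algebras is a family of morphisms $A_c\to B_c$ compatible with the actions. These form the category $\mathbf{Alg}_{\mathcal{O}}$. Data. Let $\overline{\mathbf{C}}=(\mathbf{C},\perp)$ be an orthogonal category: a small category $\mathbf{C}$, with set of objects $\mathbf{C}_0$, and a set $\perp$ of pairs of morphisms with common target such that $f_1\perp f_2$ implies $f_2\perp f_1$ and $g f_1 h_1\perp g f_2 h_2$ for all composable $g,h_1,h_2$. Let $\mathcal{P}^{(r_1,r_2)}$ be a bipointed single-coloured operad: an operad $\mathcal{P}$ in $\mathbf{M}$ with one colour and two morphisms $r_1,r_2: I[2]\to U(\mathcal{P})$, where $I[2](2)=I$ and $I[2](n)=\emptyset$ (the initial object) for $n\ne 2$. Thus each $r_i$ is a morphism $I\to\mathcal{P}(2)$. Field theories. $\mathbf{FT}(\overline{\mathbf{C}},\mathcal{P}^{(r_1,r_2)})$ is the full subcategory of $\mathbf{Alg}_{\mathcal{P}}^{\mathbf{C}}$ of all functors $\mathfrak{A}:\mathbf{C}\to\mathbf{Alg}_{\mathcal{P}}$ such that, for all $(f_1:c_1\to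 c)\perp(f_2:c_2\to c)$, $$\alpha_c\circ\big(r_1\otimes\mathfrak{A}(f_1)\otimes\mathfrak{A}(f_2)\big)=\alpha_c\circ\big(r_2\otimes\mathfrak{A}(f_1)\otimes\mathfrak{A}(f_2)\big): I\otimes\mathfrak{A}(c_1)\otimes\mathfrak{A}(c_2)\to\mathfrak{A}(c),$$ where $\alpha_c$ is the $\mathcal{P}$-action on $\mathfrak{A}(c)$. The operad of field theories. The auxiliary operad $\mathcal{P}_{\mathbf{C}}\in\mathbf{Op}_{\mathbf{C}_0}(\mathbf{M})$ has $\mathcal{P}_{\mathbf{C}}\binom{t}{\underline{c}}=\coprod_{\underline{f}\in\prod_i\mathbf{C}(c_i,t)}\mathcal{P}(n)$. Write $\iota_{\underline{f}}$ for the inclusion of the summand of $\underline{f}=(f_1,\dots,f_n)$. The structure maps are given on summands by those of $\mathcal{P}$: the permutation action of $\sigma$ goes from the summand of $\underline{f}$ to that of $(f_{\sigma(1)},\dots,f_{\sigma(n)})$, the composition goes from the summands of $\underline{f},\underline{g}_1,\dots,\underline{g}_n$ to that of $(f_1g_{11},\dots,f_ng_{nk_n})$, and the unit at $c$ is $\iota_{\mathrm{id}_c}\mathbb{1}$.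 Let $R_\perp\in\mathbf{Seq}_{\mathbf{C}_0}(\mathbf{M})$ be $R_\perp\binom{t}{(c_1,c_2)}=\coprod_{f_1\perp f_2}I$, over all $f_i:c_i\to t$ with $f_1\perp f_2$, and $\emptyset$ in arities $n\ne 2$. Let $r_{i,\mathbf{C}}:R_\perp\to U(\mathcal{P}_{\mathbf{C}})$ be given on the summand of $(f_1,f_2)$ by $\iota_{(f_1,f_2)}\,r_i$. The operad of field theories $\mathcal{P}^{(r_1,r_2)}_{\overline{\mathbf{C}}}$ is the quotient of $\mathcal{P}_{\mathbf{C}}$ by these relations in $\mathbf{Op}_{\mathbf{C}_0}(\mathbf{M})$: it comes with a morphism $\pi:\mathcal{P}_{\mathbf{C}}\to\mathcal{P}^{(r_1,r_2)}_{\overline{\mathbf{C}}}$ that is universal among the operad morphisms $\varphi$ out of $\mathcal{P}_{\mathbf{C}}$ with $U(\varphi)\,r_{1,\mathbf{C}}=U(\varphi)\,r_{2,\mathbf{C}}$. Equivalently, $\pi$ is the coequalizer of the corresponding pair $F(R_\perp)\rightrightarrows\mathcal{P}_{\mathbf{C}}$, where $F$ is the free operad functor, left adjoint to $U$. Theorem.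 The operad $\mathcal{P}^{(r_1,r_2)}_{\overline{\mathbf{C}}}$ exists, and there is a canonical isomorphism of categories $$\mathbf{Alg}_{\mathcal{P}^{(r_1,r_2)}_{\overline{\mathbf{C}}}}\;\cong\;\mathbf{FT}\big(\overline{\mathbf{C}},\mathcal{P}^{(r_1,r_2)}\big).$$ Explicitly, it sends an algebra $(A,\alpha)$ to the functor $\mathfrak{A}$ where $\mathfrak{A}(c)$ has underlying object $A_c$, the $\mathcal{P}$-action on $\mathfrak{A}(t)$ is $\alpha\circ(\pi\,\iota_{(\mathrm{id}_t,\dots,\mathrm{id}_t)}\otimes\mathrm{id})$, and $\mathfrak{A}(f):A_c\cong I\otimes A_c\to A_t$ is $\alpha\circ(\pi\,\iota_f\,\mathbb{1}\otimes\mathrm{id})$ for $f:c\to t$. It sends a morphism of algebras to the natural transformation with the same components. -/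

import Mathlib

open CategoryTheory CategoryTheory.Limits CategoryTheory.MonoidalCategory

universe w v u

namespace FieldTheoryOperads

section Tensors

variable {M : Type u} [Category.{v} M] [MonoidalCategory M]

/-- The tensor product `X i₁ ⊗ (X i₂ ⊗ (⋯ ⊗ 𝟙_ M))` of a family of objects along a list of
indices `[i₁, i₂, …]`; the empty tensor product is the monoidal unit. -/
@[reducible] def tens {ι : Type*} (X : ι → M) : List ι → M
  | [] => 𝟙_ M
  | i :: l => X i ⊗ tens X l

/-- Functoriality of `tens` in the family of objects. -/
def tensMap {ι : Type*} {X Y : ι → M} (f : ∀ i, X i ⟶ Y i) :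
    ∀ l : List ι, tens X l ⟶ tens Y l
  | [] => 𝟙 _
  | i :: l => f i ⊗ₘ tensMap f l

/-- The tensor product `X 0 ⊗ (X 1 ⊗ (⋯ ⊗ 𝟙_ M))` of a family indexed by `Fin n`. -/
abbrev tensor {n : ℕ} (X : Fin n → M) : M := tens X (List.finRange n)

/-- Functoriality of `tensor`. -/
abbrev tensorMap {n : ℕ} {X Y : Fin n → M} (f : ∀ i, X i ⟶ Y i) : tensor X ⟶ tensor Y :=
  tensMap f (List.finRange n)

/-- Coherence: a tensor product of monoidal units is the monoidal unit. -/
def tensUnit {ι : Type*} : ∀ l : List ι, tens (fun _ : ι => 𝟙_ M) l ⟶ 𝟙_ M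
  | [] => 𝟙 _
  | _ :: l => (λ_ _).hom ≫ tensUnit l

/-- Coherence: concatenation of lists of factors (associators and unitors only). -/
def tensAppend {ι : Type*} (X : ι → M) :
    ∀ l l' : List ι, tens X l ⊗ tens X l' ⟶ tens X (l ++ l')
  | [], l' => (λ_ (tens X l')).hom
  | i :: l, l' => (α_ (X i) (tens X l) (tens X l')).hom ≫ X i ◁ tensAppend X l l'

/-- Renaming indices (an identity morphism in each factor). -/
def tensRename {ι κ : Type*} (g : ι → κ) (X : κ → M) :
    ∀ l : List ι, tens (fun i => X (g i)) l ⟶ tens X (l.map g)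
  | [] => 𝟙 _
  | i :: l => X (g i) ◁ tensRename g X l

/-- Coherence: an iterated tensor product is a tensor product over pairs of indices
in lexicographic order (associators and unitors only). -/
def tensSigma {ι : Type*} {κ : ι → Type*} (X : ∀ i, κ i → M) (K : ∀ i, List (κ i)) :
    ∀ l : List ι, tens (fun i => tens (X i) (K i)) l ⟶
      tens (fun s : Σ i, κ i => X s.1 s.2) (l.sigma K)
  | [] => 𝟙 _
  | i :: l =>
      (tensRename (Sigma.mk i) (fun s : Σ i, κ i => X s.1 s.2) (K i) ⊗ₘ tensSigma X K l) ≫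
        tensAppend (fun s : Σ i, κ i => X s.1 s.2) ((K i).map (Sigma.mk i)) (l.sigma K)

variable [SymmetricCategory M]

/-- Coherence: the symmetric braiding applied factorwise,
`⨂ᵢ (Xᵢ ⊗ Yᵢ) ⟶ (⨂ᵢ Xᵢ) ⊗ (⨂ᵢ Yᵢ)`. -/
def tensShuffle {ι : Type*} (X Y : ι → M) :
    ∀ l : List ι, tens (fun i => X i ⊗ Y i) l ⟶ tens X l ⊗ tens Y l
  | [] => (λ_ (𝟙_ M)).inv
  | i :: l => (X i ⊗ Y i) ◁ tensShuffle X Y l ≫ tensorμ (X i) (Y i) (tens X l) (tens Y l)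

/-- Coherence: move the first factor `Y j` past the factors that stand before the position of `j`
in `l`, by means of the symmetric braiding. -/
def tensInsert {κ : Type*} [DecidableEq κ] (Y : κ → M) (j : κ) :
    ∀ l : List κ, j ∈ l → (Y j ⊗ tens Y (l.erase j) ⟶ tens Y l)
  | [], h => absurd h List.not_mem_nil
  | k :: l, h =>
      if e : k = j then
        eqToHom (by subst e; rw [List.erase_cons_head])
      else
        eqToHom (by rw [List.erase_cons_tail (by simpa using e)]) ≫
          (α_ (Y j) (Y k) (tens Y (l.erase j))).inv ≫
          (β_ (Y j) (Y k)).hom ▷ tens Y (l.erase j) ≫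
          (α_ (Y k) (Y j) (tens Y (l.erase j))).hom ≫
          Y k ◁ tensInsert Y j l ((List.mem_cons.mp h).resolve_left (Ne.symm e))

/-- Coherence: reordering the factors of a tensor product. The factor at `i` goes to the factor at
`e i`; the lists are enumerations (without repetition in all uses) that correspond under `e`. -/
def tensReorder {ι κ : Type*} [DecidableEq κ] (e : ι → κ) (X : ι → M) (Y : κ → M)
    (h : ∀ i, X i = Y (e i)) :
    ∀ (l : List ι) (l' : List κ), (l.map e).Perm l' → (tens X l ⟶ tens Y l')
  | [], l', hl => eqToHom (by rw [List.map_nil, List.nil_perm] at hl; rw [hl])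
  | i :: l, l', hl =>
      (eqToHom (h i) ⊗ₘ tensReorder e X Y h l (l'.erase (e i))
        (List.cons_perm_iff_perm_erase.mp hl).2) ≫
      tensInsert Y (e i) l' (List.cons_perm_iff_perm_erase.mp hl).1

/-- The permutation of factors `⨂ᵢ X i ⟶ ⨂ᵢ X (σ i)`. -/
def permute {n : ℕ} (σ : Equiv.Perm (Fin n)) (X : Fin n → M) :
    tensor X ⟶ tensor (fun i => X (σ i)) :=
  tensReorder (σ.symm : Fin n → Fin n) X (fun i => X (σ i)) (fun i => by simp) _ _
    (Equiv.Perm.map_finRange_perm σ.symm)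

/-- Concatenation `(b₁, …, bₙ)` of tuples `bᵢ` of length `k i`. -/
abbrev concat {α : Type*} {n : ℕ} {k : Fin n → ℕ} (b : ∀ i, Fin (k i) → α) :
    Fin (∑ i, k i) → α :=
  fun p => b (finSigmaFinEquiv.symm p).1 (finSigmaFinEquiv.symm p).2

theorem map_finSigmaFinEquiv_perm {n : ℕ} (k : Fin n → ℕ) :
    (((List.finRange n).sigma fun i => List.finRange (k i)).map
      (finSigmaFinEquiv : (Σ i : Fin n, Fin (k i)) → Fin (∑ i, k i))).Perm
      (List.finRange (∑ i, k i)) := by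
  rw [List.perm_ext_iff_of_nodup]
  · intro p
    simp only [List.mem_map, List.mem_finRange, iff_true]
    refine ⟨finSigmaFinEquiv.symm p, ?_, by simp⟩
    rcases finSigmaFinEquiv.symm p with ⟨i, j⟩
    exact List.mem_sigma.mpr ⟨List.mem_finRange i, List.mem_finRange j⟩
  · exact (List.Nodup.sigma (List.nodup_finRange n) fun i => List.nodup_finRange (k i)).map
      finSigmaFinEquiv.injective
  · exact List.nodup_finRange _

/-- Coherence: `⨂ᵢ ⨂ⱼ X i j ⟶ ⨂ₚ X p`, where the index `p` on the right runs through the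
concatenation of the tuples `X i`. -/
def flatten {n : ℕ} {k : Fin n → ℕ} (X : ∀ i, Fin (k i) → M) :
    tensor (fun i => tensor (X i)) ⟶ tensor (concat X) :=
  tensSigma X (fun i => List.finRange (k i)) (List.finRange n) ≫
    tensReorder (finSigmaFinEquiv : (Σ i : Fin n, Fin (k i)) → Fin (∑ i, k i))
      (fun s : Σ i : Fin n, Fin (k i) => X s.1 s.2) (concat X)
      (fun s => congrArg (fun s' : Σ i : Fin n, Fin (k i) => X s'.1 s'.2)
        (Equiv.symm_apply_apply finSigmaFinEquiv s).symm) _ _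
      (map_finSigmaFinEquiv_perm k)

/-- Coherence: a tensor product with one factor. -/
def tensorOne (X : Fin 1 → M) : tensor X ≅ X 0 := ρ_ (X 0)

/-- Coherence: a tensor product with two factors. -/
def tensorTwo (X : Fin 2 → M) : X 0 ⊗ X 1 ⟶ tensor X := X 0 ◁ (ρ_ (X 1)).inv

end Tensors

section Naturality

variable {M : Type u} [Category.{v} M] [MonoidalCategory M]

theorem tensMap_id {ι : Type*} (X : ι → M) : ∀ l : List ι, tensMap (fun i => 𝟙 (X i)) l = 𝟙 _
  | [] => rfl
  | i :: l => by simp only [tensMap, tensMap_id X l, id_tensorHom_id]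

theorem tensMap_comp {ι : Type*} {X Y Z : ι → M} (f : ∀ i, X i ⟶ Y i) (g : ∀ i, Y i ⟶ Z i) :
    ∀ l : List ι, tensMap f l ≫ tensMap g l = tensMap (fun i => f i ≫ g i) l
  | [] => Category.comp_id _
  | i :: l => by simp only [tensMap, tensorHom_comp_tensorHom, tensMap_comp f g l]

theorem tensAppend_natural {ι : Type*} {X Y : ι → M} (f : ∀ i, X i ⟶ Y i) :
    ∀ l l' : List ι, (tensMap f l ⊗ₘ tensMap f l') ≫ tensAppend Y l l' =
      tensAppend X l l' ≫ tensMap f (l ++ l')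
  | [], l' => by simp [tensMap, tensAppend]
  | i :: l, l' => by
      have := tensAppend_natural f l l'
      simp only [tensMap, tensAppend, List.cons_append, associator_naturality_assoc, Category.assoc]
      rw [← id_tensorHom, ← id_tensorHom, tensorHom_comp_tensorHom, tensorHom_comp_tensorHom, this]
      simp

theorem tensRename_natural {ι κ : Type*} (g : ι → κ) {X Y : κ → M} (f : ∀ i, X i ⟶ Y i) :
    ∀ l : List ι, tensMap (fun i => f (g i)) l ≫ tensRename g Y l =
      tensRename g X l ≫ tensMap f (l.map g)
  | [] => rfl
  | i :: l => by
      have := tensRename_natural g f l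
      change (f (g i) ⊗ₘ tensMap (fun i => f (g i)) l) ≫ Y (g i) ◁ tensRename g Y l =
        X (g i) ◁ tensRename g X l ≫ (f (g i) ⊗ₘ tensMap f (l.map g))
      rw [← id_tensorHom, ← id_tensorHom, tensorHom_comp_tensorHom, tensorHom_comp_tensorHom, this]
      simp

theorem tensSigma_natural {ι : Type*} {κ : ι → Type*} {X Y : ∀ i, κ i → M}
    (f : ∀ i j, X i j ⟶ Y i j) (K : ∀ i, List (κ i)) :
    ∀ l : List ι, tensMap (fun i => tensMap (f i) (K i)) l ≫ tensSigma Y K l =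
      tensSigma X K l ≫ tensMap (fun s : Σ i, κ i => f s.1 s.2) (l.sigma K)
  | [] => by simp [tensMap, tensSigma]
  | i :: l => by
      have h := tensSigma_natural f K l
      have h1 := tensRename_natural (Sigma.mk i) (X := fun s : Σ i, κ i => X s.1 s.2)
        (Y := fun s : Σ i, κ i => Y s.1 s.2) (fun s => f s.1 s.2) (K i)
      have h2 := tensAppend_natural (X := fun s : Σ i, κ i => X s.1 s.2)
        (Y := fun s : Σ i, κ i => Y s.1 s.2) (fun s => f s.1 s.2)
        ((K i).map (Sigma.mk i)) (l.sigma K)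
      change (tensMap (f i) (K i) ⊗ₘ tensMap (fun i => tensMap (f i) (K i)) l) ≫
        (tensRename (Sigma.mk i) (fun s : Σ i, κ i => Y s.1 s.2) (K i) ⊗ₘ tensSigma Y K l) ≫
          tensAppend (fun s : Σ i, κ i => Y s.1 s.2) ((K i).map (Sigma.mk i)) (l.sigma K) =
        ((tensRename (Sigma.mk i) (fun s : Σ i, κ i => X s.1 s.2) (K i) ⊗ₘ tensSigma X K l) ≫
          tensAppend (fun s : Σ i, κ i => X s.1 s.2) ((K i).map (Sigma.mk i)) (l.sigma K)) ≫
        tensMap (fun s : Σ i, κ i => f s.1 s.2) ((K i).map (Sigma.mk i) ++ l.sigma K)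
      rw [Category.assoc, ← h2, tensorHom_comp_tensorHom_assoc, tensorHom_comp_tensorHom_assoc, h,
        ← h1]

variable [SymmetricCategory M]

theorem tensShuffle_natural {ι : Type*} {X Y X' Y' : ι → M} (f : ∀ i, X i ⟶ X' i)
    (g : ∀ i, Y i ⟶ Y' i) :
    ∀ l : List ι, tensMap (fun i => f i ⊗ₘ g i) l ≫ tensShuffle X' Y' l =
      tensShuffle X Y l ≫ (tensMap f l ⊗ₘ tensMap g l)
  | [] => by simp [tensMap, tensShuffle]
  | i :: l => by
      have := tensShuffle_natural f g l
      simp only [tensMap, tensShuffle, Category.assoc]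
      rw [← tensorμ_natural, ← id_tensorHom, ← id_tensorHom, tensorHom_comp_tensorHom_assoc,
        tensorHom_comp_tensorHom_assoc, this]
      simp

theorem tensInsert_natural {κ : Type*} [DecidableEq κ] {X Y : κ → M} (f : ∀ i, X i ⟶ Y i)
    (j : κ) : ∀ (l : List κ) (h : j ∈ l),
      (f j ⊗ₘ tensMap f (l.erase j)) ≫ tensInsert Y j l h = tensInsert X j l h ≫ tensMap f l
  | [], h => absurd h List.not_mem_nil
  | k :: l, h => by
      have key : ∀ {l₁ l₂ : List κ} (e : l₁ = l₂) (p : (Y j ⊗ tens Y l₁) = Y j ⊗ tens Y l₂)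
          (q : (X j ⊗ tens X l₁) = X j ⊗ tens X l₂),
          (f j ⊗ₘ tensMap f l₁) ≫ eqToHom p = eqToHom q ≫ (f j ⊗ₘ tensMap f l₂) := by
        intro l₁ l₂ e p q
        subst e
        simp
      by_cases e : k = j
      · subst e
        simp only [tensInsert, dif_pos]
        exact key (List.erase_cons_head k l) _ _
      · have ih := tensInsert_natural f j l ((List.mem_cons.mp h).resolve_left (Ne.symm e))
        simp only [tensInsert, dif_neg e, Category.assoc]
        have k2 := key (List.erase_cons_tail (a := j) (b := k) (l := l) (by simpa using e))
          (by rw [List.erase_cons_tail (by simpa using e)]) (by rw [List.erase_cons_tail (by simpa using e)])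
        erw [reassoc_of% k2]
        congr 1
        simp only [tensMap]
        rw [associator_inv_naturality_assoc, ← tensorHom_id, tensorHom_comp_tensorHom_assoc,
          BraidedCategory.braiding_naturality, Category.comp_id, ← Category.id_comp (tensMap f (l.erase j)),
          ← tensorHom_comp_tensorHom_assoc, associator_naturality_assoc, ← id_tensorHom,
          tensorHom_comp_tensorHom, ih, ← id_tensorHom, tensorHom_comp_tensorHom,
          Category.id_comp, Category.comp_id, tensorHom_id]

theorem tensReorder_natural {ι κ : Type*} [DecidableEq κ] (e : ι → κ) {X X' : ι → M}
    {Y Y' : κ → M} (h : ∀ i, X i = Y (e i)) (h' : ∀ i, X' i = Y' (e i))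
    (f : ∀ i, X i ⟶ X' i) (g : ∀ j, Y j ⟶ Y' j)
    (hfg : ∀ i, f i ≫ eqToHom (h' i) = eqToHom (h i) ≫ g (e i)) :
    ∀ (l : List ι) (l' : List κ) (hl : (l.map e).Perm l'),
      tensMap f l ≫ tensReorder e X' Y' h' l l' hl =
        tensReorder e X Y h l l' hl ≫ tensMap g l'
  | [], l', hl => by
      obtain rfl : l' = [] := by simpa using hl
      simp [tensMap, tensReorder]
  | i :: l, l', hl => by
      have ih := tensReorder_natural e h h' f g hfg l (l'.erase (e i))
        (List.cons_perm_iff_perm_erase.mp hl).2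
      simp only [tensMap, tensReorder, Category.assoc]
      rw [← tensInsert_natural, tensorHom_comp_tensorHom_assoc, tensorHom_comp_tensorHom_assoc,
        hfg, ih]

theorem permute_natural {n : ℕ} (σ : Equiv.Perm (Fin n)) {X Y : Fin n → M}
    (f : ∀ i, X i ⟶ Y i) :
    tensorMap f ≫ permute σ Y = permute σ X ≫ tensorMap (fun i => f (σ i)) := by
  apply tensReorder_natural
  intro i
  have key : ∀ {a b : Fin n} (e : a = b) (p : X a = X b) (q : Y a = Y b),
      f a ≫ eqToHom q = eqToHom p ≫ f b := by
    intro a b e p q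
    subst e
    simp
  exact key (by simp) _ _

theorem flatten_natural {n : ℕ} {k : Fin n → ℕ} {X Y : ∀ i, Fin (k i) → M}
    (f : ∀ i j, X i j ⟶ Y i j) :
    tensorMap (fun i => tensorMap (f i)) ≫ flatten Y =
      flatten X ≫ tensorMap (fun p : Fin (∑ i, k i) =>
        f (finSigmaFinEquiv.symm p).1 (finSigmaFinEquiv.symm p).2) := by
  have h := tensReorder_natural (finSigmaFinEquiv : (Σ i : Fin n, Fin (k i)) → Fin (∑ i, k i))
    (X := fun s : Σ i : Fin n, Fin (k i) => X s.1 s.2)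
    (X' := fun s : Σ i : Fin n, Fin (k i) => Y s.1 s.2) (Y := concat X) (Y' := concat Y)
    (fun s => congrArg (fun s' : Σ i : Fin n, Fin (k i) => X s'.1 s'.2)
      (Equiv.symm_apply_apply finSigmaFinEquiv s).symm)
    (fun s => congrArg (fun s' : Σ i : Fin n, Fin (k i) => Y s'.1 s'.2)
      (Equiv.symm_apply_apply finSigmaFinEquiv s).symm)
    (fun s => f s.1 s.2)
    (fun p => f (finSigmaFinEquiv.symm p).1 (finSigmaFinEquiv.symm p).2) ?_ _ _
    (map_finSigmaFinEquiv_perm k)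
  · unfold flatten
    rw [Category.assoc, ← h, ← Category.assoc, ← Category.assoc, tensSigma_natural]
  · intro s
    have key : ∀ {a b : Σ i : Fin n, Fin (k i)} (e : a = b) (p : X a.1 a.2 = X b.1 b.2)
        (q : Y a.1 a.2 = Y b.1 b.2), f a.1 a.2 ≫ eqToHom q = eqToHom p ≫ f b.1 b.2 := by
      intro a b e p q
      subst e
      simp
    exact key (by simp) _ _

end Naturality

section Operads

variable (C : Type w) (M : Type u) [Category.{v} M] [MonoidalCategory M]

/-- `C`-coloured (non-symmetric) sequences in `M`: families of objects `X (c₁, …, cₙ; t)`.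
They form a category with componentwise morphisms. -/
abbrev ColoredSeq : Type max w u := ∀ n : ℕ, (Fin n → C) → C → M

/-- The data of a `C`-coloured operad. (For `n = 0` the composition is a map `obj a t ⊗ 𝟙_ M ⟶ obj _ t`,
which the unit axiom `comp_one` below forces to be the right unitor, so that including this case
adds nothing to the usual data with `n > 0`.) -/
structure OperadData where
  /-- the object of operations from `c = (c₁, …, cₙ)` to `t` -/
  obj : ∀ {n : ℕ}, (Fin n → C) → C → M
  /-- the permutation action, where `c σ = (c_{σ(1)}, …, c_{σ(n)})` -/
  perm : ∀ {n : ℕ} (σ : Equiv.Perm (Fin n)) (c : Fin n → C) (t : C), obj c t ⟶ obj (c ∘ σ) t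
  /-- the operadic composition -/
  comp : ∀ {n : ℕ} {k : Fin n → ℕ} (t : C) (a : Fin n → C) (b : ∀ i, Fin (k i) → C),
    obj a t ⊗ tensor (fun i => obj (b i) (a i)) ⟶ obj (concat b) t
  /-- the operadic unit -/
  one : ∀ c : C, 𝟙_ M ⟶ obj (fun _ : Fin 1 => c) c

variable {C M}

/-- The permutation action, written for a bijection `e : Fin m ≃ Fin n` (so `m = n`) and a tuple
`c'` that is equal to `c ∘ e`. -/
def OperadData.reindex (O : OperadData C M) {m n : ℕ} (e : Fin m ≃ Fin n) {c : Fin n → C}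
    {c' : Fin m → C} (h : ∀ i, c' i = c (e i)) (t : C) : O.obj c t ⟶ O.obj c' t := by
  have hm : m = n := by simpa using Fintype.card_congr e
  subst hm
  have hc : c' = c ∘ e := funext h
  subst hc
  exact O.perm e c t

/-- The permutation of blocks of lengths `k (σ 0), k (σ 1), …`. -/
def blockPerm {n : ℕ} (σ : Equiv.Perm (Fin n)) (k : Fin n → ℕ) :
    Fin (∑ i, k (σ i)) ≃ Fin (∑ i, k i) :=
  (finSigmaFinEquiv.symm.trans (Equiv.sigmaCongrLeft (β := fun i => Fin (k i)) σ)).trans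
    finSigmaFinEquiv

/-- The block sum of the permutations `τ i`. -/
def blockSum {n : ℕ} {k : Fin n → ℕ} (τ : ∀ i, Equiv.Perm (Fin (k i))) :
    Equiv.Perm (Fin (∑ i, k i)) :=
  (finSigmaFinEquiv.symm.trans (Equiv.sigmaCongrRight τ)).trans finSigmaFinEquiv

/-- The order preserving identification of `Fin n` with `n` blocks of length one. -/
def singletonBlocks (n : ℕ) : Fin n ≃ Fin (∑ _i : Fin n, 1) :=
  Equiv.trans (β := Σ _i : Fin n, Fin 1)
    { toFun := fun i => ⟨i, 0⟩
      invFun := fun s => s.1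
      left_inv := fun _ => rfl
      right_inv := fun ⟨_, j⟩ => by rw [Subsingleton.elim j 0] }
    finSigmaFinEquiv

/-- The order preserving identification of `Fin k` with one block of length `k`. -/
def oneBlock (k : ℕ) : Fin k ≃ Fin (∑ _i : Fin 1, k) :=
  (Equiv.uniqueSigma (fun _ : Fin 1 => Fin k)).symm.trans finSigmaFinEquiv

/-- The order preserving identification of the two ways to number blocks of blocks. -/
def nestedBlocks {n : ℕ} {k : Fin n → ℕ} (l : ∀ i, Fin (k i) → ℕ) :
    Fin (∑ p, concat l p) ≃ Fin (∑ i, ∑ j, l i j) :=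
  finSigmaFinEquiv.symm.trans <|
    (Equiv.sigmaCongrLeft (β := fun s : Σ i : Fin n, Fin (k i) => Fin (l s.1 s.2))
      finSigmaFinEquiv.symm).trans <|
    (Equiv.sigmaAssoc (fun i j => Fin (l i j))).trans <|
    (Equiv.sigmaCongrRight fun _ => finSigmaFinEquiv).trans finSigmaFinEquiv

theorem concat_apply {α : Type*} {n : ℕ} {k : Fin n → ℕ} (b : ∀ i, Fin (k i) → α)
    (s : Σ i : Fin n, Fin (k i)) : concat b (finSigmaFinEquiv s) = b s.1 s.2 :=
  congrArg (fun s' : Σ i : Fin n, Fin (k i) => b s'.1 s'.2)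
    (Equiv.symm_apply_apply finSigmaFinEquiv s)

theorem concat_blockPerm {α : Type*} {n : ℕ} (σ : Equiv.Perm (Fin n)) {k : Fin n → ℕ}
    (b : ∀ i, Fin (k i) → α) (p : Fin (∑ i, k (σ i))) :
    concat (fun i => b (σ i)) p = concat b (blockPerm σ k p) := by
  exact (concat_apply b ⟨σ (finSigmaFinEquiv.symm p).1, (finSigmaFinEquiv.symm p).2⟩).symm

theorem concat_blockSum {α : Type*} {n : ℕ} {k : Fin n → ℕ} (τ : ∀ i, Equiv.Perm (Fin (k i)))
    (b : ∀ i, Fin (k i) → α) (p : Fin (∑ i, k i)) :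
    concat (fun i => b i ∘ τ i) p = concat b (blockSum τ p) := by
  exact (concat_apply b ⟨(finSigmaFinEquiv.symm p).1,
    τ (finSigmaFinEquiv.symm p).1 (finSigmaFinEquiv.symm p).2⟩).symm

theorem concat_singletonBlocks {α : Type*} {n : ℕ} (c : Fin n → α) (i : Fin n) :
    c i = concat (k := fun _ => 1) (fun i (_ : Fin 1) => c i) (singletonBlocks n i) := by
  exact (concat_apply (k := fun _ => 1) (fun i _ => c i) ⟨i, 0⟩).symm

theorem concat_oneBlock {α : Type*} {k : ℕ} (c : Fin k → α) (i : Fin k) :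
    c i = concat (k := fun _ : Fin 1 => k) (fun _ => c) (oneBlock k i) := by
  exact (concat_apply (k := fun _ => k) (fun _ => c) ⟨0, i⟩).symm

theorem concat_nestedBlocks {α : Type*} {n : ℕ} {k : Fin n → ℕ} {l : ∀ i, Fin (k i) → ℕ}
    (c : ∀ i j, Fin (l i j) → α) (p : Fin (∑ p, concat l p)) :
    concat (k := concat l)
        (fun p => c (finSigmaFinEquiv.symm p).1 (finSigmaFinEquiv.symm p).2) p =
      concat (fun i => concat (c i)) (nestedBlocks l p) := by
  refine Eq.symm ((concat_apply (fun i => concat (c i)) _).trans ?_)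
  exact concat_apply (c (finSigmaFinEquiv.symm (finSigmaFinEquiv.symm p).1).1)
    ⟨(finSigmaFinEquiv.symm (finSigmaFinEquiv.symm p).1).2, (finSigmaFinEquiv.symm p).2⟩

variable (C M) in
/-- A `C`-coloured (symmetric) operad with values in `M`. -/
structure Operad [SymmetricCategory M] extends OperadData C M where
  perm_one : ∀ {n : ℕ} (c : Fin n → C) (t : C), perm 1 c t = 𝟙 (obj c t)
  perm_mul : ∀ {n : ℕ} (σ τ : Equiv.Perm (Fin n)) (c : Fin n → C) (t : C),
    perm (σ * τ) c t = perm σ c t ≫ perm τ (c ∘ σ) t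
  assoc : ∀ {n : ℕ} {k : Fin n → ℕ} {l : ∀ i, Fin (k i) → ℕ} (t : C) (a : Fin n → C)
    (b : ∀ i, Fin (k i) → C) (c : ∀ i j, Fin (l i j) → C),
    obj a t ◁ tensorMap (fun i => comp (a i) (b i) (c i)) ≫
        comp t a (fun i => concat (c i)) ≫
        toOperadData.reindex (nestedBlocks l) (concat_nestedBlocks c) t =
      obj a t ◁ tensShuffle (fun i => obj (b i) (a i))
          (fun i => tensor fun j => obj (c i j) (b i j)) (List.finRange n) ≫
        (α_ _ _ _).inv ≫
        (comp t a b ⊗ₘ flatten fun i j => obj (c i j) (b i j)) ≫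
        comp t (concat b) (fun p => c (finSigmaFinEquiv.symm p).1 (finSigmaFinEquiv.symm p).2)
  one_comp : ∀ {k : ℕ} (c : Fin k → C) (t : C),
    one t ▷ tensor (fun _ : Fin 1 => obj c t) ≫ comp t (fun _ => t) (fun _ => c) ≫
        toOperadData.reindex (oneBlock k) (concat_oneBlock c) t =
      (λ_ _).hom ≫ (tensorOne fun _ => obj c t).hom
  comp_one : ∀ {n : ℕ} (c : Fin n → C) (t : C),
    obj c t ◁ tensorMap (fun i => one (c i)) ≫ comp t c (fun i _ => c i) ≫
        toOperadData.reindex (singletonBlocks n) (concat_singletonBlocks c) t =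
      obj c t ◁ tensUnit (List.finRange n) ≫ (ρ_ _).hom
  /-- equivariance with respect to permutations of the blocks -/
  perm_comp : ∀ {n : ℕ} {k : Fin n → ℕ} (σ : Equiv.Perm (Fin n)) (t : C) (a : Fin n → C)
    (b : ∀ i, Fin (k i) → C),
    (perm σ a t ⊗ₘ permute σ (fun i => obj (b i) (a i))) ≫
        comp t (a ∘ σ) (fun i => b (σ i)) =
      comp t a b ≫ toOperadData.reindex (blockPerm σ k) (concat_blockPerm σ b) t
  /-- equivariance with respect to permutations inside the blocks -/
  comp_perm : ∀ {n : ℕ} {k : Fin n → ℕ} (τ : ∀ i, Equiv.Perm (Fin (k i))) (t : C)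
    (a : Fin n → C) (b : ∀ i, Fin (k i) → C),
    obj a t ◁ tensorMap (fun i => perm (τ i) (b i) (a i)) ≫ comp t a (fun i => b i ∘ τ i) =
      comp t a b ≫ toOperadData.reindex (blockSum τ) (concat_blockSum τ b) t

variable [SymmetricCategory M]

/-- Morphisms of `C`-coloured operads. -/
@[ext]
structure Operad.Hom (O P : Operad C M) where
  app : ∀ {n : ℕ} (c : Fin n → C) (t : C), O.obj c t ⟶ P.obj c t
  perm : ∀ {n : ℕ} (σ : Equiv.Perm (Fin n)) (c : Fin n → C) (t : C),
    O.perm σ c t ≫ app (c ∘ σ) t = app c t ≫ P.perm σ c t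
  comp : ∀ {n : ℕ} {k : Fin n → ℕ} (t : C) (a : Fin n → C) (b : ∀ i, Fin (k i) → C),
    O.comp t a b ≫ app (concat b) t =
      (app a t ⊗ₘ tensorMap fun i => app (b i) (a i)) ≫ P.comp t a b
  one : ∀ c : C, O.one c ≫ app (fun _ => c) c = P.one c

instance : Category (Operad C M) where
  Hom := Operad.Hom
  id O :=
    { app := fun c t => 𝟙 _
      perm := by simp
      comp := by simp [tensMap_id]
      one := by simp }
  comp f g :=
    { app := fun c t => f.app c t ≫ g.app c t
      perm := fun σ c t => by rw [← Category.assoc, f.perm, Category.assoc, g.perm, Category.assoc]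
      comp := fun t a b => by
        rw [← Category.assoc, f.comp, Category.assoc, g.comp, tensorHom_comp_tensorHom_assoc,
          tensMap_comp]
      one := fun c => by rw [← Category.assoc, f.one, g.one] }
  id_comp f := by apply Operad.Hom.ext; funext n c t; exact Category.id_comp _
  comp_id f := by apply Operad.Hom.ext; funext n c t; exact Category.comp_id _
  assoc f g h := by apply Operad.Hom.ext; funext n c t; exact Category.assoc _ _ _

variable (C M) in
/-- The forgetful functor from coloured operads to coloured sequences. -/
def forgetToSeq : Operad C M ⥤ ColoredSeq C M where
  obj O := fun _ c t => O.obj c t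
  map φ := fun _ c t => Operad.Hom.app φ c t

/-- An algebra over a coloured operad. -/
structure OperadAlgebra (O : Operad C M) where
  carrier : C → M
  /-- the action of the operad -/
  act : ∀ {n : ℕ} (c : Fin n → C) (t : C),
    O.obj c t ⊗ tensor (fun i => carrier (c i)) ⟶ carrier t
  assoc : ∀ {n : ℕ} {k : Fin n → ℕ} (t : C) (a : Fin n → C) (b : ∀ i, Fin (k i) → C),
    O.obj a t ◁ tensorMap (fun i => act (b i) (a i)) ≫ act a t =
      O.obj a t ◁ tensShuffle (fun i => O.obj (b i) (a i))
          (fun i => tensor fun j => carrier (b i j)) (List.finRange n) ≫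
        (α_ _ _ _).inv ≫
        (O.comp t a b ⊗ₘ flatten fun i j => carrier (b i j)) ≫ act (concat b) t
  unit : ∀ c : C,
    O.one c ▷ tensor (fun _ : Fin 1 => carrier c) ≫ act (fun _ => c) c =
      (λ_ _).hom ≫ (tensorOne fun _ => carrier c).hom
  equivariant : ∀ {n : ℕ} (σ : Equiv.Perm (Fin n)) (c : Fin n → C) (t : C),
    (O.perm σ c t ⊗ₘ permute σ (fun i => carrier (c i))) ≫ act (c ∘ σ) t = act c t

/-- Morphisms of algebras over a coloured operad. -/
@[ext]
structure OperadAlgebra.Hom {O : Operad C M} (A B : OperadAlgebra O) where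
  app : ∀ c : C, A.carrier c ⟶ B.carrier c
  act : ∀ {n : ℕ} (c : Fin n → C) (t : C),
    A.act c t ≫ app t = (O.obj c t ◁ tensorMap fun i => app (c i)) ≫ B.act c t

instance (O : Operad C M) : Category (OperadAlgebra O) where
  Hom := OperadAlgebra.Hom
  id A :=
    { app := fun c => 𝟙 _
      act := by simp [tensMap_id] }
  comp f g :=
    { app := fun c => f.app c ≫ g.app c
      act := fun c t => by
        rw [← Category.assoc, f.act, Category.assoc, g.act, ← Category.assoc,
          ← whiskerLeft_comp, tensMap_comp] }
  id_comp f := by apply OperadAlgebra.Hom.ext; funext c; exact Category.id_comp _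
  comp_id f := by apply OperadAlgebra.Hom.ext; funext c; exact Category.comp_id _
  assoc f g h := by apply OperadAlgebra.Hom.ext; funext c; exact Category.assoc _ _ _

end Operads

section Coproducts

variable {M : Type u} [Category.{v} M]

/-- The morphisms `j s : A s ⟶ B` exhibit `B` as a coproduct of the objects `A s`. -/
def IsCoprod {S : Type*} {A : S → M} {B : M} (j : ∀ s, A s ⟶ B) : Prop :=
  ∀ ⦃V : M⦄ (φ : ∀ s, A s ⟶ V), ∃! ψ : B ⟶ V, ∀ s, j s ≫ ψ = φ s

namespace IsCoprod

theorem hom_ext {S : Type*} {A : S → M} {B V : M} {j : ∀ s, A s ⟶ B} (hj : IsCoprod j)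
    {f g : B ⟶ V} (h : ∀ s, j s ≫ f = j s ≫ g) : f = g :=
  (hj fun s => j s ≫ g).unique h fun _ => rfl

/-- The morphism out of a coproduct with given components. -/
noncomputable def desc {S : Type*} {A : S → M} {B V : M} {j : ∀ s, A s ⟶ B} (hj : IsCoprod j)
    (φ : ∀ s, A s ⟶ V) : B ⟶ V :=
  (hj φ).choose

@[simp]
theorem fac {S : Type*} {A : S → M} {B V : M} {j : ∀ s, A s ⟶ B} (hj : IsCoprod j)
    (φ : ∀ s, A s ⟶ V) (s : S) : j s ≫ hj.desc φ = φ s :=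
  (hj φ).choose_spec.1 s

theorem sigma {S : Type v} [HasCoproducts.{v} M] (A : S → M) :
    IsCoprod (fun s => Sigma.ι A s) := fun _ φ =>
  ⟨Sigma.desc φ, fun s => by simp, fun ψ hψ => Sigma.hom_ext _ _ fun s => by simp [hψ]⟩

theorem reindex {S S' : Type*} (e : S' ≃ S) {A : S → M} {A' : S' → M} {B : M}
    {j : ∀ s, A s ⟶ B} (hj : IsCoprod j) (j' : ∀ s, A' s ⟶ B)
    (h : ∀ s, ∃ i : A' s ≅ A (e s), i.hom ≫ j (e s) = j' s) : IsCoprod j' := by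
  choose i hi using h
  intro V φ
  have hφ : ∀ s s' (p : s = s') (q : A (e s) = A (e s')),
      (i s).inv ≫ φ s = eqToHom q ≫ (i s').inv ≫ φ s' := by
    rintro s _ rfl q
    simp
  refine ⟨hj.desc fun s => eqToHom (by simp) ≫ (i (e.symm s)).inv ≫ φ (e.symm s), ?_, ?_⟩
  · intro s
    rw [← hi, Category.assoc, fac, ← hφ s _ (by simp) (by simp)]
    simp
  · intro ψ hψ
    apply hj.hom_ext
    intro s
    obtain ⟨s, rfl⟩ := e.surjective s
    rw [fac, ← hφ s _ (by simp) (by simp), ← hψ, ← hi]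
    simp

variable [MonoidalCategory M] [MonoidalClosed M]

theorem whiskerLeft {S : Type*} {A : S → M} {B : M} {j : ∀ s, A s ⟶ B} (hj : IsCoprod j)
    (W : M) : IsCoprod (fun s => W ◁ j s) := by
  intro V φ
  refine ⟨MonoidalClosed.uncurry (hj.desc fun s => MonoidalClosed.curry (φ s)), ?_, ?_⟩
  · intro s
    dsimp only
    rw [← MonoidalClosed.uncurry_natural_left, fac, MonoidalClosed.uncurry_curry]
  · intro ψ hψ
    rw [← MonoidalClosed.curry_eq_iff]
    apply hj.hom_ext
    intro s
    rw [fac, ← hψ, MonoidalClosed.curry_natural_left]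

variable [SymmetricCategory M]

theorem whiskerRight {S : Type*} {A : S → M} {B : M} {j : ∀ s, A s ⟶ B} (hj : IsCoprod j)
    (W : M) : IsCoprod (fun s => j s ▷ W) := by
  intro V φ
  obtain ⟨d, hd, hd'⟩ := hj.whiskerLeft W fun s => (β_ W (A s)).hom ≫ φ s
  dsimp only at hd hd'
  refine ⟨(β_ B W).hom ≫ d, ?_, ?_⟩
  · intro s
    dsimp only
    rw [BraidedCategory.braiding_naturality_left_assoc, hd, SymmetricCategory.symmetry_assoc]
  · intro ψ hψ
    rw [← hd' ((β_ W B).hom ≫ ψ) fun s => by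
      rw [BraidedCategory.braiding_naturality_right_assoc, hψ], SymmetricCategory.symmetry_assoc]

theorem tensorHom {S S' : Type*} {A : S → M} {B : M} {j : ∀ s, A s ⟶ B} (hj : IsCoprod j)
    {A' : S' → M} {B' : M} {j' : ∀ s, A' s ⟶ B'} (hj' : IsCoprod j') :
    IsCoprod (fun s : S × S' => j s.1 ⊗ₘ j' s.2) := by
  intro V φ
  choose d hd hd' using fun s => hj'.whiskerLeft (A s) fun s' => φ (s, s')
  obtain ⟨f, hf, hf'⟩ := hj.whiskerRight B' d
  dsimp only at hd hd' hf hf'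
  refine ⟨f, ?_, ?_⟩
  · intro s
    dsimp only
    rw [tensorHom_def', Category.assoc, hf, hd]
  · intro ψ hψ
    refine hf' ψ fun s => hd' s _ fun s' => ?_
    rw [← hψ (s, s')]
    dsimp only
    rw [tensorHom_def', Category.assoc]

/-- The inclusion of a tensor product of summands, along a list. -/
theorem exists_tprod {ι : Type*} {S : ι → Type*} {A : ∀ i, S i → M} {B : ι → M}
    {j : ∀ i s, A i s ⟶ B i} (hj : ∀ i, IsCoprod (j i)) : ∀ l : List ι,
      ∃ (Z : List.TProd S l → M) (z : ∀ r, Z r ⟶ tens B l), IsCoprod z ∧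
        ∀ s : ∀ i, S i, ∃ i : tens (fun i => A i (s i)) l ≅ Z (List.TProd.mk l s),
          i.hom ≫ z (List.TProd.mk l s) = tensMap (fun i => j i (s i)) l
  | [] => ⟨fun _ => 𝟙_ M, fun _ => 𝟙 _, fun V φ => ⟨φ PUnit.unit, fun s => Category.id_comp _,
      fun ψ hψ => (Category.id_comp ψ).symm.trans (hψ PUnit.unit)⟩, fun s => ⟨Iso.refl _, Category.id_comp _⟩⟩
  | i :: l => by
      obtain ⟨Z, z, hz, h⟩ := exists_tprod hj l
      refine ⟨fun r => A i r.1 ⊗ Z r.2, fun r => j i r.1 ⊗ₘ z r.2, (hj i).tensorHom hz, ?_⟩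
      intro s
      obtain ⟨e, he⟩ := h s
      refine ⟨whiskerLeftIso (A i (s i)) e, ?_⟩
      change (A i (s i) ◁ e.hom) ≫ (j i (s i) ⊗ₘ z (List.TProd.mk l s)) =
        (j i (s i) ⊗ₘ tensMap (fun i => j i (s i)) l)
      rw [← he, ← id_tensorHom, tensorHom_comp_tensorHom, Category.id_comp]

theorem tensorMap {n : ℕ} {S : Fin n → Type*} {A : ∀ i, S i → M} {B : Fin n → M}
    {j : ∀ i s, A i s ⟶ B i} (hj : ∀ i, IsCoprod (j i)) :
    IsCoprod (fun s : ∀ i, S i => tensorMap fun i => j i (s i)) := by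
  obtain ⟨Z, z, hz, h⟩ := exists_tprod hj (List.finRange n)
  exact hz.reindex (List.TProd.piEquivTProd (List.nodup_finRange n) List.mem_finRange) _ h

end IsCoprod

end Coproducts

section FieldTheories

variable {M : Type u} [Category.{v} M] [MonoidalCategory M]

theorem tensorOne_natural {X Y : Fin 1 → M} (f : ∀ i, X i ⟶ Y i) :
    tensorMap f ≫ (tensorOne Y).hom = (tensorOne X).hom ≫ f 0 := by
  change (f 0 ⊗ₘ 𝟙 (𝟙_ M)) ≫ (ρ_ (Y 0)).hom = (ρ_ (X 0)).hom ≫ f 0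
  simp

variable {C : Type v} [SmallCategory C]

/-- The tuple `f (g₁, …, gₙ) = (f₁ g₁₁, …, fₙ gₙₖ)` of composite morphisms. -/
def compTuple {n : ℕ} {k : Fin n → ℕ} {t : C} {a : Fin n → C} {b : ∀ i, Fin (k i) → C}
    (f : ∀ i, a i ⟶ t) (g : ∀ i j, b i j ⟶ a i) (p : Fin (∑ i, k i)) : concat b p ⟶ t :=
  g (finSigmaFinEquiv.symm p).1 (finSigmaFinEquiv.symm p).2 ≫ f (finSigmaFinEquiv.symm p).1

section

variable [SymmetricCategory M]

/-- Compatibility of the inclusions of the summands with the structure maps. -/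
structure IsAux (P : Operad Unit M) (D : OperadData C M)
    (ι : ∀ {n : ℕ} (c : Fin n → C) (t : C) (_ : ∀ i, c i ⟶ t),
      P.obj (fun _ : Fin n => ()) () ⟶ D.obj c t) : Prop where
  isCoprod : ∀ {n : ℕ} (c : Fin n → C) (t : C), IsCoprod fun f => ι c t f
  perm : ∀ {n : ℕ} (σ : Equiv.Perm (Fin n)) (c : Fin n → C) (t : C) (f : ∀ i, c i ⟶ t),
    ι c t f ≫ D.perm σ c t = P.perm σ (fun _ => ()) () ≫ ι (c ∘ σ) t fun i => f (σ i)
  comp : ∀ {n : ℕ} {k : Fin n → ℕ} (t : C) (a : Fin n → C) (b : ∀ i, Fin (k i) → C)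
    (f : ∀ i, a i ⟶ t) (g : ∀ i j, b i j ⟶ a i),
    (ι a t f ⊗ₘ tensorMap fun i => ι (b i) (a i) (g i)) ≫ D.comp t a b =
      P.comp () (fun _ => ()) (fun _ _ => ()) ≫ ι (concat b) t (compTuple f g)
  one : ∀ c : C, D.one c = P.one () ≫ ι (fun _ => c) c fun _ => 𝟙 c

namespace IsAux

variable {P : Operad Unit M} {D : OperadData C M}
  {ι : ∀ {n : ℕ} (c : Fin n → C) (t : C) (_ : ∀ i, c i ⟶ t),
    P.obj (fun _ : Fin n => ()) () ⟶ D.obj c t}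

theorem reindex (h : IsAux P D ι) {m n : ℕ} (e : Fin m ≃ Fin n) {c : Fin n → C}
    {c' : Fin m → C} (hc : ∀ i, c' i = c (e i)) (t : C) (f : ∀ i, c i ⟶ t)
    (f' : ∀ i, c' i ⟶ t) (hf : ∀ i, f' i = eqToHom (hc i) ≫ f (e i)) :
    ι c t f ≫ D.reindex e hc t = P.reindex e (fun _ => rfl) () ≫ ι c' t f' := by
  obtain rfl : m = n := by simpa using Fintype.card_congr e
  obtain rfl : c' = c ∘ e := funext hc
  obtain rfl : f' = fun i => f (e i) := funext fun i => by simpa using hf i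
  exact h.perm e c t f

theorem compTuple_cast {n : ℕ} {k : Fin n → ℕ} {t : C} {a : Fin n → C}
    {b : ∀ i, Fin (k i) → C} (f : ∀ i, a i ⟶ t) (g : ∀ i j, b i j ⟶ a i)
    (s : Σ i : Fin n, Fin (k i)) (p : Fin (∑ i, k i)) (hp : p = finSigmaFinEquiv s)
    (hb : b s.1 s.2 = concat b p) :
    g s.1 s.2 ≫ f s.1 = eqToHom hb ≫ compTuple f g p := by
  subst hp
  have key : ∀ (s s' : Σ i : Fin n, Fin (k i)) (_ : s = s') (q : b s.1 s.2 = b s'.1 s'.2),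
      g s.1 s.2 ≫ f s.1 = eqToHom q ≫ g s'.1 s'.2 ≫ f s'.1 := by
    rintro s _ rfl q
    simp
  exact key s _ (by simp) hb

theorem perm_one (h : IsAux P D ι) {n : ℕ} (c : Fin n → C) (t : C) :
    D.perm 1 c t = 𝟙 (D.obj c t) := by
  apply (h.isCoprod c t).hom_ext
  intro f
  rw [h.perm, P.perm_one]
  exact (Category.id_comp _).trans (Category.comp_id _).symm

theorem perm_mul (h : IsAux P D ι) {n : ℕ} (σ τ : Equiv.Perm (Fin n)) (c : Fin n → C) (t : C) :
    D.perm (σ * τ) c t = D.perm σ c t ≫ D.perm τ (c ∘ σ) t := by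
  apply (h.isCoprod c t).hom_ext
  intro f
  refine (h.perm (σ * τ) c t f).trans ?_
  rw [P.perm_mul]
  have h1 := congrArg (fun x => x ≫ D.perm τ (c ∘ σ) t) (h.perm σ c t f)
  simp only [Category.assoc, h.perm τ (c ∘ σ) t] at h1
  exact (Category.assoc _ _ _).trans h1.symm

variable [MonoidalClosed M]

theorem source (h : IsAux P D ι) {n : ℕ} {k : Fin n → ℕ} (t : C)
    (a : Fin n → C) (b : ∀ i, Fin (k i) → C) :
    IsCoprod (fun s : (∀ i, a i ⟶ t) × (∀ i, ∀ j, b i j ⟶ a i) =>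
      ι a t s.1 ⊗ₘ tensorMap fun i => ι (b i) (a i) (s.2 i)) :=
  (h.isCoprod a t).tensorHom (IsCoprod.tensorMap fun i => h.isCoprod (b i) (a i))

theorem assoc (h : IsAux P D ι) {n : ℕ} {k : Fin n → ℕ} {l : ∀ i, Fin (k i) → ℕ} (t : C)
    (a : Fin n → C) (b : ∀ i, Fin (k i) → C) (c : ∀ i j, Fin (l i j) → C) :
    D.obj a t ◁ tensorMap (fun i => D.comp (a i) (b i) (c i)) ≫
        D.comp t a (fun i => concat (c i)) ≫
        D.reindex (nestedBlocks l) (concat_nestedBlocks c) t =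
      D.obj a t ◁ tensShuffle (fun i => D.obj (b i) (a i))
          (fun i => tensor fun j => D.obj (c i j) (b i j)) (List.finRange n) ≫
        (α_ _ _ _).inv ≫
        (D.comp t a b ⊗ₘ flatten fun i j => D.obj (c i j) (b i j)) ≫
        D.comp t (concat b)
          (fun p => c (finSigmaFinEquiv.symm p).1 (finSigmaFinEquiv.symm p).2) := by
  apply ((h.isCoprod a t).tensorHom (IsCoprod.tensorMap fun i => h.source (a i) (b i) (c i))).hom_ext
  rintro ⟨f, g⟩
  dsimp only
  have h1 := h.reindex (nestedBlocks l) (concat_nestedBlocks c) t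
    (compTuple f fun i => compTuple (g i).1 (g i).2)
    (compTuple (compTuple f fun i => (g i).1)
      fun p => (g (finSigmaFinEquiv.symm p).1).2 (finSigmaFinEquiv.symm p).2) (fun p => by
      have i1 := compTuple_cast (g (finSigmaFinEquiv.symm (finSigmaFinEquiv.symm p).1).1).1
        (g (finSigmaFinEquiv.symm (finSigmaFinEquiv.symm p).1).1).2
        ⟨(finSigmaFinEquiv.symm (finSigmaFinEquiv.symm p).1).2, (finSigmaFinEquiv.symm p).2⟩ _ rfl
        (concat_apply (c _) ⟨_, _⟩).symm
      have i2 := compTuple_cast f (fun i => compTuple (g i).1 (g i).2)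
        ⟨(finSigmaFinEquiv.symm (finSigmaFinEquiv.symm p).1).1,
          finSigmaFinEquiv ⟨(finSigmaFinEquiv.symm (finSigmaFinEquiv.symm p).1).2,
            (finSigmaFinEquiv.symm p).2⟩⟩ (nestedBlocks l p) rfl
        (concat_apply (fun i => concat (c i)) ⟨_, _⟩).symm
      refine (Category.assoc _ _ _).symm.trans ?_
      refine (congrArg (fun x => x ≫ f _) i1).trans ?_
      refine (Category.assoc _ _ _).trans ?_
      refine (congrArg (fun x => eqToHom _ ≫ x) i2).trans ?_
      exact eqToHom_trans_assoc _ _ _)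
  have hP := P.assoc () (fun _ => ()) (k := k) (l := l) (fun _ _ => ()) (fun _ _ _ => ())
  have e1 : (ι a t f ⊗ₘ tensorMap fun i => ι (b i) (a i) (g i).1 ⊗ₘ
      tensorMap fun j => ι (c i j) (b i j) ((g i).2 j)) ≫
      D.obj a t ◁ tensorMap (fun i => D.comp (a i) (b i) (c i)) =
      P.obj (fun _ : Fin n => ()) () ◁
        tensorMap (fun i => P.comp (k := l i) () (fun _ => ()) (fun _ _ => ())) ≫
      (ι a t f ⊗ₘ tensorMap fun i => ι (concat (c i)) (a i) (compTuple (g i).1 (g i).2)) := by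
    rw [← id_tensorHom, ← id_tensorHom, tensorHom_comp_tensorHom, tensorHom_comp_tensorHom,
      Category.id_comp, Category.comp_id, tensMap_comp, tensMap_comp]
    simp only [h.comp]
  have e2 : (ι a t f ⊗ₘ tensorMap fun i => ι (b i) (a i) (g i).1 ⊗ₘ
      tensorMap fun j => ι (c i j) (b i j) ((g i).2 j)) ≫
      D.obj a t ◁ tensShuffle (fun i => D.obj (b i) (a i))
          (fun i => tensor fun j => D.obj (c i j) (b i j)) (List.finRange n) =
      P.obj (fun _ : Fin n => ()) () ◁ tensShuffle (fun i => P.obj (fun _ : Fin (k i) => ()) ())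
        (fun i => tensor fun j => P.obj (fun _ : Fin (l i j) => ()) ()) (List.finRange n) ≫
      (ι a t f ⊗ₘ (tensorMap fun i => ι (b i) (a i) (g i).1) ⊗ₘ
        (tensorMap fun i => tensorMap fun j => ι (c i j) (b i j) ((g i).2 j))) := by
    rw [← id_tensorHom, ← id_tensorHom, tensorHom_comp_tensorHom, tensorHom_comp_tensorHom,
      Category.id_comp, Category.comp_id, tensShuffle_natural]
  have e3 : ((ι a t f ⊗ₘ tensorMap fun i => ι (b i) (a i) (g i).1) ⊗ₘ
        (tensorMap fun i => tensorMap fun j => ι (c i j) (b i j) ((g i).2 j))) ≫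
        (D.comp t a b ⊗ₘ flatten fun i j => D.obj (c i j) (b i j)) =
      (P.comp () (fun _ => ()) (fun _ _ => ()) ⊗ₘ
        flatten fun i j => P.obj (fun _ : Fin (l i j) => ()) ()) ≫
      (ι (concat b) t (compTuple f fun i => (g i).1) ⊗ₘ tensorMap fun p =>
        ι _ _ ((g (finSigmaFinEquiv.symm p).1).2 (finSigmaFinEquiv.symm p).2)) := by
    rw [tensorHom_comp_tensorHom, tensorHom_comp_tensorHom, h.comp, flatten_natural]
  rw [reassoc_of% e1, reassoc_of% h.comp, h1, reassoc_of% e2, associator_inv_naturality_assoc,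
    reassoc_of% e3, h.comp]
  have := congrArg (fun x => x ≫ ι _ t (compTuple (compTuple f fun i => (g i).1)
      fun p => (g (finSigmaFinEquiv.symm p).1).2 (finSigmaFinEquiv.symm p).2)) hP
  simp only [Category.assoc] at this
  exact this

theorem one_comp (h : IsAux P D ι) {k : ℕ} (c : Fin k → C) (t : C) :
    D.one t ▷ tensor (fun _ : Fin 1 => D.obj c t) ≫ D.comp t (fun _ => t) (fun _ => c) ≫
        D.reindex (oneBlock k) (concat_oneBlock c) t =
      (λ_ _).hom ≫ (tensorOne fun _ => D.obj c t).hom := by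
  apply (IsCoprod.whiskerLeft (IsCoprod.tensorMap fun _ : Fin 1 => h.isCoprod c t) (𝟙_ M)).hom_ext
  intro s
  have h1 := h.reindex (oneBlock k) (concat_oneBlock c) t
    (compTuple (fun _ => 𝟙 t) s) (s 0) (fun j => by
      have i1 := compTuple_cast (fun _ => 𝟙 t) s ⟨0, j⟩ (oneBlock k j) rfl
        (concat_apply (k := fun _ => k) (fun _ => c) ⟨0, j⟩).symm
      exact (Category.comp_id _).symm.trans i1)
  have e1 : 𝟙_ M ◁ tensorMap (fun i => ι c t (s i)) ≫ D.one t ▷ tensor (fun _ => D.obj c t) =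
      P.one () ▷ tensor (fun _ : Fin 1 => P.obj (fun _ : Fin k => ()) ()) ≫
        (ι (fun _ => t) t (fun _ => 𝟙 t) ⊗ₘ tensorMap fun i => ι c t (s i)) := by
    rw [h.one, ← id_tensorHom, ← tensorHom_id, ← tensorHom_id, tensorHom_comp_tensorHom,
      tensorHom_comp_tensorHom, Category.id_comp, Category.id_comp, Category.comp_id]
  have hP := P.one_comp (k := k) (fun _ => ()) ()
  have h2 := congrArg (fun x => x ≫ ι c t (s 0)) hP
  simp only [Category.assoc] at h2
  rw [reassoc_of% e1, reassoc_of% h.comp, h1, leftUnitor_naturality_assoc, tensorOne_natural]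
  exact h2

theorem comp_one (h : IsAux P D ι) {n : ℕ} (c : Fin n → C) (t : C) :
    D.obj c t ◁ tensorMap (fun i => D.one (c i)) ≫ D.comp t c (fun i _ => c i) ≫
        D.reindex (singletonBlocks n) (concat_singletonBlocks c) t =
      D.obj c t ◁ tensUnit (List.finRange n) ≫ (ρ_ _).hom := by
  apply ((h.isCoprod c t).whiskerRight (tensor fun _ : Fin n => 𝟙_ M)).hom_ext
  intro f
  have h1 := h.reindex (singletonBlocks n) (concat_singletonBlocks c) t
    (compTuple f fun i _ => 𝟙 (c i)) f (fun j => by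
      have i1 := compTuple_cast f (fun i (_ : Fin 1) => 𝟙 (c i)) ⟨j, 0⟩ (singletonBlocks n j) rfl
        (concat_apply (k := fun _ => 1) (fun i _ => c i) ⟨j, 0⟩).symm
      exact (Category.id_comp _).symm.trans i1)
  have e1 : ι c t f ▷ tensor (fun _ => 𝟙_ M) ≫ D.obj c t ◁ tensorMap (fun i => D.one (c i)) =
      P.obj (fun _ : Fin n => ()) () ◁ tensorMap (fun _ : Fin n => P.one ()) ≫
        (ι c t f ⊗ₘ tensorMap fun i => ι (fun _ : Fin 1 => c i) (c i) fun _ => 𝟙 (c i)) := by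
    rw [← id_tensorHom, ← id_tensorHom, ← tensorHom_id, tensorHom_comp_tensorHom,
      tensorHom_comp_tensorHom, Category.id_comp, Category.id_comp, Category.comp_id, tensMap_comp]
    simp only [h.one]
  have hP := P.comp_one (n := n) (fun _ => ()) ()
  have h2 := congrArg (fun x => x ≫ ι c t f) hP
  simp only [Category.assoc] at h2
  have hc := h.comp t c (fun i (_ : Fin 1) => c i) f (fun i _ => 𝟙 (c i))
  rw [reassoc_of% e1, reassoc_of% hc, h1, ← whisker_exchange_assoc, rightUnitor_naturality]
  exact h2

theorem perm_comp (h : IsAux P D ι) {n : ℕ} {k : Fin n → ℕ} (σ : Equiv.Perm (Fin n)) (t : C)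
    (a : Fin n → C) (b : ∀ i, Fin (k i) → C) :
    (D.perm σ a t ⊗ₘ permute σ (fun i => D.obj (b i) (a i))) ≫
        D.comp t (a ∘ σ) (fun i => b (σ i)) =
      D.comp t a b ≫ D.reindex (blockPerm σ k) (concat_blockPerm σ b) t := by
  apply (h.source t a b).hom_ext
  rintro ⟨f, g⟩
  dsimp only
  rw [reassoc_of% h.comp t a b f g,
    h.reindex (blockPerm σ k) (concat_blockPerm σ b) t (compTuple f g)
      (compTuple (fun i => f (σ i)) fun i => g (σ i)) (fun p => compTuple_cast f g
        ⟨σ (finSigmaFinEquiv.symm p).1, (finSigmaFinEquiv.symm p).2⟩ _ rfl _),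
    tensorHom_comp_tensorHom_assoc, permute_natural, h.perm, ← tensorHom_comp_tensorHom_assoc]
  have hc := h.comp t (a ∘ σ) (fun i => b (σ i)) (fun i => f (σ i)) (fun i => g (σ i))
  refine (congrArg _ hc).trans ?_
  have hP := P.perm_comp σ () (fun _ => ()) (k := k) (fun _ _ => ())
  have := congrArg (fun x => x ≫ ι _ t (compTuple (fun i => f (σ i)) fun i => g (σ i))) hP
  simp only [Category.assoc] at this
  exact this

theorem comp_perm (h : IsAux P D ι) {n : ℕ} {k : Fin n → ℕ} (τ : ∀ i, Equiv.Perm (Fin (k i)))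
    (t : C) (a : Fin n → C) (b : ∀ i, Fin (k i) → C) :
    D.obj a t ◁ tensorMap (fun i => D.perm (τ i) (b i) (a i)) ≫ D.comp t a (fun i => b i ∘ τ i) =
      D.comp t a b ≫ D.reindex (blockSum τ) (concat_blockSum τ b) t := by
  apply (h.source t a b).hom_ext
  rintro ⟨f, g⟩
  dsimp only
  have h1 := h.reindex (blockSum τ) (concat_blockSum τ b) t (compTuple f g)
    (compTuple (b := fun i => b i ∘ τ i) f fun i j => g i (τ i j)) (fun p => compTuple_cast f g
      ⟨(finSigmaFinEquiv.symm p).1, τ (finSigmaFinEquiv.symm p).1 (finSigmaFinEquiv.symm p).2⟩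
      _ rfl _)
  have e1 : (ι a t f ⊗ₘ tensorMap fun i => ι (b i) (a i) (g i)) ≫
      D.obj a t ◁ tensorMap (fun i => D.perm (τ i) (b i) (a i)) =
      P.obj (fun _ : Fin n => ()) () ◁ tensorMap (fun i => P.perm (τ i) (fun _ => ()) ()) ≫
        (ι a t f ⊗ₘ tensorMap fun i => ι (b i ∘ τ i) (a i) fun j => g i (τ i j)) := by
    rw [← id_tensorHom, ← id_tensorHom, tensorHom_comp_tensorHom, tensorHom_comp_tensorHom,
      Category.id_comp, Category.comp_id, tensMap_comp]
    simp only [h.perm]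
    exact congrArg _ (tensMap_comp _ _ _).symm
  have hP := P.comp_perm τ () (fun _ => ()) (fun _ _ => ())
  have h2 := congrArg (fun x => x ≫ ι _ t
    (compTuple (b := fun i => b i ∘ τ i) f fun i j => g i (τ i j))) hP
  simp only [Category.assoc] at h2
  have hc := h.comp t a (fun i => b i ∘ τ i) f (fun i j => g i (τ i j))
  rw [reassoc_of% h.comp t a b f g, h1, reassoc_of% e1, hc]
  exact h2

end IsAux

end

variable [HasColimits M]

variable (C) in
/-- The object `C(c, t) ⊗ P(n)`, that is, the coproduct of copies of `P(n)` indexed by the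
tuples of morphisms `fᵢ : cᵢ ⟶ t`. -/
noncomputable def auxObj (P : OperadData Unit M) {n : ℕ} (c : Fin n → C) (t : C) : M :=
  ∐ fun _ : (∀ i, c i ⟶ t) => P.obj (fun _ : Fin n => ()) ()

/-- The inclusion of the summand of `f`. -/
noncomputable def auxι (P : OperadData Unit M) {n : ℕ} {c : Fin n → C} {t : C}
    (f : ∀ i, c i ⟶ t) : P.obj (fun _ : Fin n => ()) () ⟶ auxObj C P c t :=
  Sigma.ι (fun _ : (∀ i, c i ⟶ t) => P.obj (fun _ : Fin n => ()) ()) f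

theorem auxι_isCoprod (P : OperadData Unit M) {n : ℕ} (c : Fin n → C) (t : C) :
    IsCoprod (fun f : (∀ i, c i ⟶ t) => auxι P f) :=
  IsCoprod.sigma _

variable [SymmetricCategory M] [MonoidalClosed M]

theorem auxSource_isCoprod (P : OperadData Unit M) {n : ℕ} {k : Fin n → ℕ} (t : C)
    (a : Fin n → C) (b : ∀ i, Fin (k i) → C) :
    IsCoprod (fun s : (∀ i, a i ⟶ t) × (∀ i, ∀ j, b i j ⟶ a i) =>
      auxι P s.1 ⊗ₘ tensorMap fun i => auxι P (c := b i) (t := a i) (s.2 i)) :=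
  (auxι_isCoprod P a t).tensorHom (IsCoprod.tensorMap fun i => auxι_isCoprod P (b i) (a i))

variable (C) in
/-- The data of the auxiliary operad. -/
noncomputable def auxData (P : OperadData Unit M) : OperadData C M where
  obj c t := auxObj C P c t
  -- on the summand of `f`: the action of `P`, followed by the inclusion of the summand of `f σ`
  perm σ c t := (auxι_isCoprod P c t).desc fun f =>
    P.perm σ (fun _ => ()) () ≫ auxι P (c := c ∘ σ) fun i => f (σ i)
  -- on the summand of `f, g₁, …, gₙ`: the composition of `P`, followed by the inclusion of the
  -- summand of `f (g₁, …, gₙ)`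
  comp t a b := (auxSource_isCoprod P t a b).desc fun s =>
    P.comp () (fun _ => ()) (fun _ _ => ()) ≫ auxι P (compTuple s.1 s.2)
  one c := P.one () ≫ auxι P fun _ => 𝟙 c

theorem auxData_isAux (P : Operad Unit M) :
    IsAux P (auxData C P.toOperadData) fun _ _ f => auxι P.toOperadData f where
  isCoprod c t := auxι_isCoprod P.toOperadData c t
  perm _ c t f := (auxι_isCoprod P.toOperadData c t).fac _ f
  comp t a b f g := (auxSource_isCoprod P.toOperadData t a b).fac _ (f, g)
  one _ := rfl

variable (C) in
/-- The auxiliary `C`-coloured operad `P_C`. -/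
noncomputable def auxOperad (P : Operad Unit M) : Operad C M where
  toOperadData := auxData C P.toOperadData
  perm_one := (auxData_isAux P).perm_one
  perm_mul := (auxData_isAux P).perm_mul
  assoc := (auxData_isAux P).assoc
  one_comp := (auxData_isAux P).one_comp
  comp_one := (auxData_isAux P).comp_one
  perm_comp := (auxData_isAux P).perm_comp
  comp_perm := (auxData_isAux P).comp_perm

end FieldTheories

section FieldTheoryCategory

variable (C : Type v) [SmallCategory C]

/-- An orthogonality relation on the category `C`: a set of pairs of morphisms with common target
that is symmetric and stable under pre- and postcomposition. -/
structure OrthogonalityRelation where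
  perp : ∀ {c₁ c₂ t : C}, (c₁ ⟶ t) → (c₂ ⟶ t) → Prop
  symm : ∀ {c₁ c₂ t : C} (f₁ : c₁ ⟶ t) (f₂ : c₂ ⟶ t), perp f₁ f₂ → perp f₂ f₁
  comp : ∀ {b₁ b₂ c₁ c₂ t s : C} (f₁ : c₁ ⟶ t) (f₂ : c₂ ⟶ t) (g : t ⟶ s) (h₁ : b₁ ⟶ c₁)
    (h₂ : b₂ ⟶ c₂), perp f₁ f₂ → perp (h₁ ≫ f₁ ≫ g) (h₂ ≫ f₂ ≫ g)

variable {C}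
variable (M : Type u) [Category.{v} M] [MonoidalCategory M] [SymmetricCategory M] [HasColimits M]

/-- The single-coloured sequence `I[2]`: the monoidal unit in arity two and the initial object in
all other arities. -/
noncomputable def unitSeqTwo : ColoredSeq Unit M
  | 2, _, _ => 𝟙_ M
  | _, _, _ => ⊥_ M

/-- A bipointed single-coloured operad: an operad `P` with two points `r₁, r₂ : I[2] ⟶ U(P)`. -/
structure BipointedOperad where
  operad : Operad Unit M
  r₁ : unitSeqTwo M ⟶ (forgetToSeq Unit M).obj operad
  r₂ : unitSeqTwo M ⟶ (forgetToSeq Unit M).obj operad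

/-- The coloured sequence `R_⊥`. -/
noncomputable def relSeq (perp : OrthogonalityRelation C) : ColoredSeq C M
  | 2, c, t => ∐ fun _ : {f : ∀ i : Fin 2, c i ⟶ t // perp.perp (f 0) (f 1)} => 𝟙_ M
  | _, _, _ => ⊥_ M

variable {M}

/-- The binary operation selected by a morphism `I[2] ⟶ U(P)`. -/
def point {P : Operad Unit M} (r : unitSeqTwo M ⟶ (forgetToSeq Unit M).obj P) :
    𝟙_ M ⟶ P.obj (fun _ : Fin 2 => ()) () :=
  r 2 (fun _ => ()) ()

/-- The condition on a functor `𝔄 : C ⥤ Alg_P` to be a field theory: for all `f₁ ⊥ f₂`, the two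
binary operations `r₁` and `r₂` agree after precomposition with `𝔄(f₁) ⊗ 𝔄(f₂)`. -/
def IsFieldTheory (perp : OrthogonalityRelation C) (P : BipointedOperad M) :
    ObjectProperty (C ⥤ OperadAlgebra P.operad) := fun A =>
  ∀ ⦃c₁ c₂ t : C⦄ (f₁ : c₁ ⟶ t) (f₂ : c₂ ⟶ t), perp.perp f₁ f₂ →
    (point P.r₁ ⊗ₘ ((A.map f₁).app () ⊗ₘ (A.map f₂).app ())) ≫
        _ ◁ tensorTwo (fun _ : Fin 2 => (A.obj t).carrier ()) ≫
        (A.obj t).act (fun _ => ()) () =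
      (point P.r₂ ⊗ₘ ((A.map f₁).app () ⊗ₘ (A.map f₂).app ())) ≫
        _ ◁ tensorTwo (fun _ : Fin 2 => (A.obj t).carrier ()) ≫
        (A.obj t).act (fun _ => ()) ()

/-- The category of field theories, a full subcategory of the functor category. -/
abbrev FT (perp : OrthogonalityRelation C) (P : BipointedOperad M) : Type max u v :=
  (IsFieldTheory perp P).FullSubcategory

variable [MonoidalClosed M]

/-- The morphism `r_C : R_⊥ ⟶ U(P_C)` induced by `r : I[2] ⟶ U(P)`. -/
noncomputable def relMap (perp : OrthogonalityRelation C) {P : Operad Unit M}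
    (r : unitSeqTwo M ⟶ (forgetToSeq Unit M).obj P) :
    relSeq M perp ⟶ (forgetToSeq C M).obj (auxOperad C P)
  | 2, _, _ => Sigma.desc fun f => point r ≫ auxι P.toOperadData f.1
  | 0, _, _ => initial.to _
  | 1, _, _ => initial.to _
  | _ + 3, _, _ => initial.to _

/-- The morphism `π : P_C ⟶ Q` exhibits `Q` as the operad of field theories, that is, as the
quotient of `P_C` by the relations `r_{1,C}, r_{2,C} : R_⊥ ⟶ U(P_C)`: it is universal among the
operad morphisms out of `P_C` that identify the two. By the next theorem this says that `π` is
the coequalizer of the associated pair of operad morphisms `F(R_⊥) ⟶ P_C`, where `F` is the free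
operad functor, left adjoint to `U`. -/
structure IsFieldTheoryOperad (perp : OrthogonalityRelation C) (P : BipointedOperad M)
    {Q : Operad C M} (π : auxOperad C P.operad ⟶ Q) : Prop where
  condition : relMap perp P.r₁ ≫ (forgetToSeq C M).map π =
    relMap perp P.r₂ ≫ (forgetToSeq C M).map π
  existsUnique_desc : ∀ {O : Operad C M} (φ : auxOperad C P.operad ⟶ O),
    relMap perp P.r₁ ≫ (forgetToSeq C M).map φ = relMap perp P.r₂ ≫ (forgetToSeq C M).map φ →
      ∃! ψ : Q ⟶ O, π ≫ ψ = φ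

theorem isFieldTheoryOperad_iff_isColimit (perp : OrthogonalityRelation C)
    (P : BipointedOperad M) {Q : Operad C M} (π : auxOperad C P.operad ⟶ Q)
    (F : ColoredSeq C M ⥤ Operad C M) (adj : F ⊣ forgetToSeq C M) :
    IsFieldTheoryOperad perp P π ↔
      ∃ w : (adj.homEquiv _ _).symm (relMap perp P.r₁) ≫ π =
          (adj.homEquiv _ _).symm (relMap perp P.r₂) ≫ π,
        Nonempty (IsColimit (Cofork.ofπ π w)) := by
  have key : ∀ {O : Operad C M} (φ : auxOperad C P.operad ⟶ O),
      relMap perp P.r₁ ≫ (forgetToSeq C M).map φ = relMap perp P.r₂ ≫ (forgetToSeq C M).map φ ↔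
        (adj.homEquiv _ _).symm (relMap perp P.r₁) ≫ φ =
          (adj.homEquiv _ _).symm (relMap perp P.r₂) ≫ φ := by
    intro O φ
    rw [← adj.homEquiv_naturality_right_symm, ← adj.homEquiv_naturality_right_symm]
    exact (Equiv.apply_eq_iff_eq _).symm
  constructor
  · rintro ⟨h, hd⟩
    refine ⟨(key π).mp h, ⟨Cofork.IsColimit.mk' _ fun s => ?_⟩⟩
    have hs := hd s.π ((key s.π).mpr s.condition)
    exact ⟨hs.choose, hs.choose_spec.1, fun {m} hm => hs.choose_spec.2 m hm⟩
  · rintro ⟨w, ⟨hc⟩⟩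
    refine ⟨(key π).mpr w, fun φ hφ => ?_⟩
    obtain ⟨l, hl⟩ := Cofork.IsColimit.desc' hc φ ((key φ).mp hφ)
    exact ⟨l, hl, fun y hy => Cofork.IsColimit.hom_ext hc (hy.trans hl.symm)⟩

/-- The functor `Φ` from `Q`-algebras to field theories is the canonical one. For a `Q`-algebra `A`,
the field theory `Φ A` has the same underlying objects `A_c`; `P(n)` acts on `A_t` through the
operations of `Q` coming from the summand of `(id_t, …, id_t)`; a morphism `f : c ⟶ t` acts through
the operation of `Q` coming from the operadic unit of `P` in the summand of `f`; and `Φ` does not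
change the components of morphisms. -/
def IsCanonical {perp : OrthogonalityRelation C} {P : BipointedOperad M}
    {Q : Operad C M} (π : auxOperad C P.operad ⟶ Q) (Φ : OperadAlgebra Q ⥤ FT perp P) : Prop :=
  ∃ h : ∀ (A : OperadAlgebra Q) (c : C), ((Φ.obj A).obj.obj c).carrier () = A.carrier c,
    (∀ (A : OperadAlgebra Q) (t : C) (n : ℕ),
      ((Φ.obj A).obj.obj t).act (fun _ : Fin n => ()) () ≫ eqToHom (h A t) =
        ((auxι P.operad.toOperadData (fun _ : Fin n => 𝟙 t) ≫
            Operad.Hom.app π (fun _ => t) t) ⊗ₘ tensorMap fun _ => eqToHom (h A t)) ≫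
          A.act (fun _ => t) t) ∧
    (∀ (A : OperadAlgebra Q) {c t : C} (f : c ⟶ t),
      ((Φ.obj A).obj.map f).app () ≫ eqToHom (h A t) =
        eqToHom (h A c) ≫ (λ_ (A.carrier c)).inv ≫
          ((P.operad.one () ≫ auxι P.operad.toOperadData (fun _ : Fin 1 => f) ≫
            Operad.Hom.app π (fun _ => c) t) ⊗ₘ (tensorOne fun _ => A.carrier c).inv) ≫
          A.act (fun _ => c) t) ∧
    ∀ {A B : OperadAlgebra Q} (κ : A ⟶ B) (c : C),
      ((Φ.map κ).hom.app c).app () ≫ eqToHom (h B c) = eqToHom (h A c) ≫ OperadAlgebra.Hom.app κ c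

end FieldTheoryCategory

end FieldTheoryOperads

open FieldTheoryOperads

/-!
An algebra over the auxiliary operad `P_C` is the same thing as a functor `C ⥤ Alg_P`. The
operations `ι_f p` in the summand of `f = (f₁, …, fₙ)` factor as an operation in the summand of
`(id, …, id)`, precomposed with the unary operations `ι_{fᵢ} 𝟙`. Hence an action of `P_C` is
determined by actions of `P` on the objects `A_t` (the summands of identities) and by morphisms
`A_c ⟶ A_t` (the unary operations), and the axioms of an algebra amount to functoriality and to
compatibility of these morphisms with the actions of `P`. The two passages are `IsAux.toFunctor`
and `IsAux.ofFunctor`; they are strictly inverse by `IsAux.ofFunctor_toFunctor` and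
`IsAux.toFunctor_ofFunctor`. Under this correspondence, `P_C`-algebras that satisfy the relations
`r_{1,C} = r_{2,C}` are the field theories (`respects_relation_iff`).

It remains to identify the algebras over the quotient operad with the `P_C`-algebras that satisfy
the relations. The quotient is described componentwise. The relations on an operad `O` that follow
from given ones are enumerated by formal words (`Word`): permutations and operadic composites of the
given relations and of trivial relations. Since `M` is closed symmetric monoidal, tensoring
preserves quotients by relations. A tensor product of quotients is again a quotient by relations, as
soon as the trivial relations are included (`IsJointCoequalizer.tensorHom`,
`IsJointCoequalizer.tensMap`). The structure maps of `O` therefore descend to the quotients of its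
components by all words, and the axioms descend because the projections are epimorphisms
(`exists_operad_quotient`). This operad has the universal property (`existsUnique_operad_desc`), so every operad of field theories is a
componentwise quotient (`IsFieldTheoryOperad.isComponentwiseQuotient`).

An algebra that satisfies the given relations satisfies all words in them
(`OperadAlgebra.respects_word`), so that its action factors through the componentwise quotient
(`OperadAlgebra.extend`). Restriction along `π` and this extension are strictly inverse, because an
action of the quotient is determined by its composite with the epimorphism `π ⊗ id`.
-/

namespace FieldTheoryOperads

/-! ### Relations and their quotients -/

section ParallelPairs

variable {M : Type u} [Category.{v} M]

/-- A pair of parallel morphisms into `A`, read as a relation on `A`. -/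
structure ParallelPair (A : M) where
  /-- the common source -/
  src : M
  fst : src ⟶ A
  snd : src ⟶ A

namespace ParallelPair

/-- The trivial relation, given by two identity morphisms. -/
def refl (A : M) : ParallelPair A := ⟨A, 𝟙 A, 𝟙 A⟩

/-- The image of a relation under a morphism. -/
def map {A B : M} (p : ParallelPair A) (f : A ⟶ B) : ParallelPair B :=
  ⟨p.src, p.fst ≫ f, p.snd ≫ f⟩

/-- The morphism `f` identifies the two morphisms of the pair. -/
def Coequalizes {A B : M} (p : ParallelPair A) (f : A ⟶ B) : Prop :=
  p.fst ≫ f = p.snd ≫ f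

theorem Coequalizes.comp {A B V : M} {p : ParallelPair A} {f : A ⟶ B} (h : p.Coequalizes f)
    (g : B ⟶ V) : p.Coequalizes (f ≫ g) := by
  unfold Coequalizes at *
  rw [reassoc_of% h]

theorem coequalizes_map {A B V : M} (p : ParallelPair A) (f : A ⟶ B) (g : B ⟶ V) :
    (p.map f).Coequalizes g ↔ p.Coequalizes (f ≫ g) := by
  simp [Coequalizes, map]

theorem refl_coequalizes {A B : M} (f : A ⟶ B) : (refl A).Coequalizes f :=
  show 𝟙 A ≫ f = 𝟙 A ≫ f from rfl

variable [MonoidalCategory M]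

/-- The tensor product of two relations. -/
def tensor {A B : M} (p : ParallelPair A) (q : ParallelPair B) : ParallelPair (A ⊗ B) :=
  ⟨p.src ⊗ q.src, p.fst ⊗ₘ q.fst, p.snd ⊗ₘ q.snd⟩

/-- The tensor product of a family of relations along a list of indices. -/
def tens {ι : Type*} {X : ι → M} (p : ∀ i, ParallelPair (X i)) :
    ∀ l : List ι, ParallelPair (FieldTheoryOperads.tens X l)
  | [] => refl _
  | i :: l => (p i).tensor (tens p l)

theorem tens_congr {ι : Type*} {X : ι → M} {p p' : ∀ i, ParallelPair (X i)} :
    ∀ {l : List ι}, (∀ i ∈ l, p i = p' i) → tens p l = tens p' l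
  | [], _ => rfl
  | i :: l, h => by
      simp only [tens, h i List.mem_cons_self,
        tens_congr (l := l) fun j hj => h j (List.mem_cons_of_mem _ hj)]

theorem tens_refl {ι : Type*} (X : ι → M) :
    ∀ l : List ι, tens (fun i => refl (X i)) l = refl (FieldTheoryOperads.tens X l)
  | [] => rfl
  | i :: l => by
      simp only [tens, tens_refl X l]
      simp [tensor, refl]

theorem Coequalizes.tensor {A A' B B' : M} {p : ParallelPair A} {q : ParallelPair B}
    {f : A ⟶ A'} {g : B ⟶ B'} (hf : p.Coequalizes f) (hg : q.Coequalizes g) :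
    (p.tensor q).Coequalizes (f ⊗ₘ g) := by
  unfold Coequalizes at *
  simp only [ParallelPair.tensor, tensorHom_comp_tensorHom, hf, hg]

theorem Coequalizes.tens {ι : Type*} {X Y : ι → M} {p : ∀ i, ParallelPair (X i)}
    {f : ∀ i, X i ⟶ Y i} (h : ∀ i, (p i).Coequalizes (f i)) :
    ∀ l : List ι, (ParallelPair.tens p l).Coequalizes (tensMap f l)
  | [] => rfl
  | i :: l => (h i).tensor (Coequalizes.tens h l)

theorem tens_eq {ι : Type*} {X : ι → M} (p : ∀ i, ParallelPair (X i)) :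
    ∀ l : List ι, ParallelPair.tens p l = ⟨FieldTheoryOperads.tens (fun i => (p i).src) l,
      tensMap (fun i => (p i).fst) l, tensMap (fun i => (p i).snd) l⟩
  | [] => rfl
  | i :: l => by rw [ParallelPair.tens, tens_eq p l]; rfl

end ParallelPair

/-- The morphism `q : A ⟶ B` exhibits `B` as the quotient of `A` by the relations `p s`. -/
structure IsJointCoequalizer {A B : M} {S : Type*} (p : S → ParallelPair A) (q : A ⟶ B) :
    Prop where
  condition : ∀ s, (p s).Coequalizes q
  existsUnique_desc : ∀ ⦃V : M⦄ (φ : A ⟶ V), (∀ s, (p s).Coequalizes φ) → ∃! ψ : B ⟶ V, q ≫ ψ = φ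

namespace IsJointCoequalizer

theorem epi {A B : M} {S : Type*} {p : S → ParallelPair A} {q : A ⟶ B}
    (h : IsJointCoequalizer p q) : Epi q :=
  ⟨fun _ g e => (h.existsUnique_desc (q ≫ g) fun s => (h.condition s).comp g).unique e rfl⟩

/-- The morphism out of a quotient induced by a morphism that respects the relations. -/
noncomputable def desc {A B V : M} {S : Type*} {p : S → ParallelPair A} {q : A ⟶ B}
    (h : IsJointCoequalizer p q) (φ : A ⟶ V) (hφ : ∀ s, (p s).Coequalizes φ) : B ⟶ V :=
  (h.existsUnique_desc φ hφ).choose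

theorem fac {A B V : M} {S : Type*} {p : S → ParallelPair A} {q : A ⟶ B}
    (h : IsJointCoequalizer p q) (φ : A ⟶ V) (hφ : ∀ s, (p s).Coequalizes φ) :
    q ≫ h.desc φ hφ = φ :=
  (h.existsUnique_desc φ hφ).choose_spec.1

theorem exists_of_hasColimits [HasColimits M] {A : M} {S : Type v} (p : S → ParallelPair A) :
    ∃ (B : M) (q : A ⟶ B), IsJointCoequalizer p q := by
  refine ⟨coequalizer (Sigma.desc fun s => (p s).fst) (Sigma.desc fun s => (p s).snd),
    coequalizer.π _ _, fun s => ?_, fun V φ hφ => ?_⟩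
  · have := congrArg (fun x => Sigma.ι (fun s => (p s).src) s ≫ x)
      (coequalizer.condition (Sigma.desc fun s => (p s).fst) (Sigma.desc fun s => (p s).snd))
    simpa [ParallelPair.Coequalizes] using this
  · refine ⟨coequalizer.desc φ (Sigma.hom_ext _ _ fun s => ?_), coequalizer.π_desc _ _,
      fun ψ hψ => coequalizer.hom_ext ?_⟩
    · simpa [ParallelPair.Coequalizes] using hφ s
    · rw [hψ, coequalizer.π_desc]

theorem comp_iso {A B B' : M} {S : Type*} {p : S → ParallelPair A} {q : A ⟶ B}
    (h : IsJointCoequalizer p q) (f : B ⟶ B') [IsIso f] : IsJointCoequalizer p (q ≫ f) where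
  condition s := (h.condition s).comp f
  existsUnique_desc V φ hφ := by
    refine ⟨inv f ≫ h.desc φ hφ, by simp [h.fac], fun ψ hψ => ?_⟩
    have := h.epi
    rw [IsIso.eq_inv_comp, ← cancel_epi q, h.fac, ← hψ, Category.assoc]

variable [MonoidalCategory M] [MonoidalClosed M]

/-- Tensoring with an object preserves quotients, because it is a left adjoint. -/
theorem whiskerLeft {A B : M} {S : Type*} {p : S → ParallelPair A} {q : A ⟶ B}
    (h : IsJointCoequalizer p q) (W : M) :
    IsJointCoequalizer (fun s => (ParallelPair.refl W).tensor (p s)) (W ◁ q) where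
  condition s := by
    rw [← id_tensorHom]
    exact (ParallelPair.refl_coequalizes _).tensor (h.condition s)
  existsUnique_desc V φ hφ := by
    have hφ' : ∀ s, (p s).Coequalizes (MonoidalClosed.curry φ) := fun s => by
      have := hφ s
      simp only [ParallelPair.Coequalizes, ParallelPair.tensor, ParallelPair.refl,
        id_tensorHom] at this ⊢
      rw [← MonoidalClosed.curry_natural_left, ← MonoidalClosed.curry_natural_left, this]
    refine ⟨MonoidalClosed.uncurry (h.desc _ hφ'), ?_, fun ψ hψ => ?_⟩
    · dsimp only
      rw [← MonoidalClosed.uncurry_natural_left, h.fac, MonoidalClosed.uncurry_curry]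
    · have := h.epi
      rw [← MonoidalClosed.curry_eq_iff, ← cancel_epi q, h.fac, ← hψ,
        MonoidalClosed.curry_natural_left]

variable [SymmetricCategory M]

theorem whiskerRight {A B : M} {S : Type*} {p : S → ParallelPair A} {q : A ⟶ B}
    (h : IsJointCoequalizer p q) (W : M) :
    IsJointCoequalizer (fun s => (p s).tensor (ParallelPair.refl W)) (q ▷ W) where
  condition s := by
    rw [← tensorHom_id]
    exact (h.condition s).tensor (ParallelPair.refl_coequalizes _)
  existsUnique_desc V φ hφ := by
    have hφ' : ∀ s, ((ParallelPair.refl W).tensor (p s)).Coequalizes ((β_ W A).hom ≫ φ) :=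
      fun s => by
        have := hφ s
        simp only [ParallelPair.Coequalizes, ParallelPair.tensor, ParallelPair.refl,
          id_tensorHom, tensorHom_id] at this ⊢
        simp only [BraidedCategory.braiding_naturality_right_assoc, this]
    obtain ⟨d, hd, hd'⟩ := (h.whiskerLeft W).existsUnique_desc _ hφ'
    dsimp only at hd hd'
    refine ⟨(β_ B W).hom ≫ d, ?_, fun ψ hψ => ?_⟩
    · dsimp only
      rw [BraidedCategory.braiding_naturality_left_assoc, hd, SymmetricCategory.symmetry_assoc]
    · rw [← hd' ((β_ W B).hom ≫ ψ) (by
        rw [BraidedCategory.braiding_naturality_right_assoc, hψ]),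
        SymmetricCategory.symmetry_assoc]

/-- The tensor product of two quotients is the quotient by the tensor products of relations,
provided that the trivial relation belongs to both families: tensoring it with a relation on one
factor lets the other factor vary freely. -/
theorem tensorHom {A B A' B' : M} {S S' : Type*} {p : S → ParallelPair A} {q : A ⟶ B}
    {p' : S' → ParallelPair A'} {q' : A' ⟶ B'} (h : IsJointCoequalizer p q)
    (h' : IsJointCoequalizer p' q') (hp : ∃ s, p s = ParallelPair.refl A)
    (hp' : ∃ s, p' s = ParallelPair.refl A') :
    IsJointCoequalizer (fun s : S × S' => (p s.1).tensor (p' s.2)) (q ⊗ₘ q') where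
  condition s := (h.condition s.1).tensor (h'.condition s.2)
  existsUnique_desc V φ hφ := by
    obtain ⟨s₀, hs₀⟩ := hp
    obtain ⟨s₀', hs₀'⟩ := hp'
    obtain ⟨d, hd, hd'⟩ := (h'.whiskerLeft A).existsUnique_desc φ fun s => by
      rw [← hs₀]
      exact hφ (s₀, s)
    obtain ⟨e, he, he'⟩ := (h.whiskerRight B').existsUnique_desc d fun s => by
      have := (h'.whiskerLeft (p s).src).epi
      have e : ((p s).tensor (p' s₀')).Coequalizes φ := hφ (s, s₀')
      rw [hs₀'] at e
      simp only [ParallelPair.Coequalizes, ParallelPair.tensor, ParallelPair.refl,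
        tensorHom_id] at e ⊢
      rw [← cancel_epi ((p s).src ◁ q'), whisker_exchange_assoc, whisker_exchange_assoc, hd, e]
    refine ⟨e, ?_, fun ψ hψ => he' ψ (hd' _ ?_)⟩
    · dsimp only
      rw [tensorHom_def', Category.assoc, he, hd]
    · dsimp only
      rw [← hψ, tensorHom_def', Category.assoc]

theorem tensMap {ι : Type*} [DecidableEq ι] {X Y : ι → M} {S : ι → Type*}
    {p : ∀ i, S i → ParallelPair (X i)} {q : ∀ i, X i ⟶ Y i}
    (h : ∀ i, IsJointCoequalizer (p i) (q i)) (hp : ∀ i, ∃ s, p i s = ParallelPair.refl (X i)) :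
    ∀ {l : List ι}, l.Nodup →
      IsJointCoequalizer (fun s : ∀ i, S i => ParallelPair.tens (fun i => p i (s i)) l)
        (tensMap q l)
  | [], _ => ⟨fun _ => rfl, fun V φ _ => ⟨φ, Category.id_comp _, fun ψ hψ =>
      (Category.id_comp ψ).symm.trans hψ⟩⟩
  | i :: l, hl => by
      have ih := tensMap h hp (List.nodup_cons.mp hl).2
      choose s₀ hs₀ using hp
      have ht := (h i).tensorHom ih ⟨s₀ i, hs₀ i⟩ ⟨s₀, by
        simp only [hs₀]
        exact ParallelPair.tens_refl X l⟩
      refine ⟨fun s => ParallelPair.Coequalizes.tens (fun j => (h j).condition (s j)) _,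
        fun V φ hφ => ht.existsUnique_desc φ fun s => ?_⟩
      · -- the relation in the first factor and those in the others are chosen independently,
        -- since `i` does not occur in `l`
        have e := hφ (Function.update s.2 i s.1)
        have hne : ∀ j ∈ l, p j (Function.update s.2 i s.1 j) = p j (s.2 j) := fun j hj => by
          rw [Function.update_of_ne]
          rintro rfl
          exact (List.nodup_cons.mp hl).1 hj
        simp only [ParallelPair.tens, Function.update_self, ParallelPair.tens_congr hne] at e
        exact e

end IsJointCoequalizer

end ParallelPairs

/-! ### Quotients of operads -/

section Epimorphisms

variable {M : Type u} [Category.{v} M] [MonoidalCategory M] [MonoidalClosed M]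

theorem epi_whiskerLeft (W : M) {A B : M} (f : A ⟶ B) [Epi f] : Epi (W ◁ f) :=
  inferInstanceAs (Epi ((tensorLeft W).map f))

variable [SymmetricCategory M]

theorem epi_whiskerRight {A B : M} (f : A ⟶ B) [Epi f] (W : M) : Epi (f ▷ W) := by
  have := epi_whiskerLeft W f
  have e : f ▷ W = (β_ A W).hom ≫ W ◁ f ≫ (β_ B W).inv := by simp
  rw [e]
  infer_instance

theorem epi_tensorHom {A B A' B' : M} (f : A ⟶ B) (g : A' ⟶ B') [Epi f] [Epi g] :
    Epi (f ⊗ₘ g) := by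
  have := epi_whiskerLeft B g
  have := epi_whiskerRight f A'
  rw [MonoidalCategory.tensorHom_def]
  infer_instance

theorem epi_tensMap {ι : Type*} {X Y : ι → M} (f : ∀ i, X i ⟶ Y i) (h : ∀ i, Epi (f i)) :
    ∀ l : List ι, Epi (tensMap f l)
  | [] => inferInstanceAs (Epi (𝟙 _))
  | i :: l => by
      have := h i
      have := epi_tensMap f h l
      exact epi_tensorHom (f i) (tensMap f l)

end Epimorphisms

section QuotientData

variable {C : Type w} {M : Type u} [Category.{v} M] [MonoidalCategory M]

/-- The morphisms `q c t` commute with the structure maps of operads. The axioms of operads are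
not required, so that they can be deduced for the target from those of the source. -/
structure OperadData.IsHom (O D : OperadData C M)
    (q : ∀ {n : ℕ} (c : Fin n → C) (t : C), O.obj c t ⟶ D.obj c t) : Prop where
  perm : ∀ {n : ℕ} (σ : Equiv.Perm (Fin n)) (c : Fin n → C) (t : C),
    O.perm σ c t ≫ q (c ∘ σ) t = q c t ≫ D.perm σ c t
  comp : ∀ {n : ℕ} {k : Fin n → ℕ} (t : C) (a : Fin n → C) (b : ∀ i, Fin (k i) → C),
    O.comp t a b ≫ q (concat b) t = (q a t ⊗ₘ tensorMap fun i => q (b i) (a i)) ≫ D.comp t a b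
  one : ∀ c : C, O.one c ≫ q (fun _ => c) c = D.one c

namespace OperadData.IsHom

variable {O D : OperadData C M}
  {q : ∀ {n : ℕ} (c : Fin n → C) (t : C), O.obj c t ⟶ D.obj c t}

theorem reindex (h : IsHom O D q) {m n : ℕ} (e : Fin m ≃ Fin n) {c : Fin n → C}
    {c' : Fin m → C} (hc : ∀ i, c' i = c (e i)) (t : C) :
    O.reindex e hc t ≫ q c' t = q c t ≫ D.reindex e hc t := by
  obtain rfl : m = n := by simpa using Fintype.card_congr e
  obtain rfl : c' = c ∘ e := funext hc
  exact h.perm e c t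

end OperadData.IsHom

variable [SymmetricCategory M] [MonoidalClosed M]

/-- The axioms of an operad descend along componentwise epimorphisms. -/
def Operad.ofEpi (O : Operad C M) (D : OperadData C M)
    (q : ∀ {n : ℕ} (c : Fin n → C) (t : C), O.obj c t ⟶ D.obj c t)
    (h : OperadData.IsHom O.toOperadData D q) (hq : ∀ {n : ℕ} (c : Fin n → C) t, Epi (q c t)) :
    Operad C M where
  toOperadData := D
  perm_one c t := by
    have := hq c t
    refine (cancel_epi (q c t)).1 ((h.perm 1 c t).symm.trans ?_)
    rw [O.perm_one]
    exact (Category.id_comp _).trans (Category.comp_id _).symm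
  perm_mul σ τ c t := by
    have := hq c t
    refine (cancel_epi (q c t)).1 ((h.perm (σ * τ) c t).symm.trans ?_)
    rw [O.perm_mul]
    have e := congrArg (fun x => x ≫ D.perm τ (c ∘ σ) t) (h.perm σ c t)
    simp only [Category.assoc, ← h.perm τ (c ∘ σ) t] at e
    exact (Category.assoc _ _ _).trans e
  assoc {n k l} t a b c := by
    have := epi_tensMap (fun i => q (b i) (a i) ⊗ₘ tensorMap fun j => q (c i j) (b i j))
      (fun i => by
        have := hq (b i) (a i)
        have := epi_tensMap (fun j => q (c i j) (b i j)) (fun j => hq _ _) (List.finRange _)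
        exact epi_tensorHom _ _) (List.finRange n)
    have := hq a t
    have := epi_tensorHom (q a t) (tensorMap fun i => q (b i) (a i) ⊗ₘ
      tensorMap fun j => q (c i j) (b i j))
    have e1 : (q a t ⊗ₘ tensorMap fun i => q (b i) (a i) ⊗ₘ tensorMap fun j => q (c i j) (b i j)) ≫
        D.obj a t ◁ tensorMap (fun i => D.comp (a i) (b i) (c i)) =
        O.obj a t ◁ tensorMap (fun i => O.comp (a i) (b i) (c i)) ≫
          (q a t ⊗ₘ tensorMap fun i => q (concat (c i)) (a i)) := by
      rw [← id_tensorHom, ← id_tensorHom, tensorHom_comp_tensorHom, tensorHom_comp_tensorHom,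
        Category.id_comp, Category.comp_id, tensMap_comp, tensMap_comp]
      simp only [h.comp]
    have e2 : (q a t ⊗ₘ tensorMap fun i => q (b i) (a i) ⊗ₘ tensorMap fun j => q (c i j) (b i j)) ≫
        D.obj a t ◁ tensShuffle (fun i => D.obj (b i) (a i))
            (fun i => tensor fun j => D.obj (c i j) (b i j)) (List.finRange n) =
        O.obj a t ◁ tensShuffle (fun i => O.obj (b i) (a i))
            (fun i => tensor fun j => O.obj (c i j) (b i j)) (List.finRange n) ≫
          (q a t ⊗ₘ (tensorMap fun i => q (b i) (a i)) ⊗ₘ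
            (tensorMap fun i => tensorMap fun j => q (c i j) (b i j))) := by
      rw [← id_tensorHom, ← id_tensorHom, tensorHom_comp_tensorHom, tensorHom_comp_tensorHom,
        Category.id_comp, Category.comp_id, tensShuffle_natural]
    have e3 : ((q a t ⊗ₘ tensorMap fun i => q (b i) (a i)) ⊗ₘ
          (tensorMap fun i => tensorMap fun j => q (c i j) (b i j))) ≫
          (D.comp t a b ⊗ₘ flatten fun i j => D.obj (c i j) (b i j)) =
        (O.comp t a b ⊗ₘ flatten fun i j => O.obj (c i j) (b i j)) ≫
        (q (concat b) t ⊗ₘ tensorMap fun p =>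
          q (c (finSigmaFinEquiv.symm p).1 (finSigmaFinEquiv.symm p).2)
            (b (finSigmaFinEquiv.symm p).1 (finSigmaFinEquiv.symm p).2)) := by
      rw [tensorHom_comp_tensorHom, tensorHom_comp_tensorHom, ← h.comp, flatten_natural]
    rw [← cancel_epi (q a t ⊗ₘ tensorMap fun i => q (b i) (a i) ⊗ₘ
      tensorMap fun j => q (c i j) (b i j)), reassoc_of% e1, ← reassoc_of% h.comp, ← h.reindex,
      reassoc_of% e2, associator_inv_naturality_assoc, reassoc_of% e3, ← h.comp,
      reassoc_of% O.assoc t a b c]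
  one_comp {k} c t := by
    have := epi_tensMap (fun _ : Fin 1 => q c t) (fun _ => hq c t) (List.finRange 1)
    have := epi_whiskerLeft (𝟙_ M) (tensorMap fun _ : Fin 1 => q c t)
    have e1 : 𝟙_ M ◁ tensorMap (fun _ : Fin 1 => q c t) ≫
        D.one t ▷ tensor (fun _ : Fin 1 => D.obj c t) =
        O.one t ▷ tensor (fun _ : Fin 1 => O.obj c t) ≫
          (q (fun _ : Fin 1 => t) t ⊗ₘ tensorMap fun _ : Fin 1 => q c t) := by
      rw [← h.one, ← id_tensorHom, ← tensorHom_id, ← tensorHom_id, tensorHom_comp_tensorHom,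
        tensorHom_comp_tensorHom, Category.id_comp, Category.id_comp, Category.comp_id]
    rw [← cancel_epi (𝟙_ M ◁ tensorMap (fun _ : Fin 1 => q c t)), reassoc_of% e1,
      ← reassoc_of% h.comp t (fun _ : Fin 1 => t) (fun _ => c), ← h.reindex,
      reassoc_of% O.one_comp c t, leftUnitor_naturality_assoc, tensorOne_natural]
  comp_one {n} c t := by
    have := hq c t
    have := epi_whiskerRight (q c t) (tensor fun _ : Fin n => 𝟙_ M)
    have e1 : q c t ▷ tensor (fun _ : Fin n => 𝟙_ M) ≫
        D.obj c t ◁ tensorMap (fun i => D.one (c i)) =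
        O.obj c t ◁ tensorMap (fun i => O.one (c i)) ≫
          (q c t ⊗ₘ tensorMap fun i => q (fun _ : Fin 1 => c i) (c i)) := by
      rw [← id_tensorHom, ← id_tensorHom, ← tensorHom_id, tensorHom_comp_tensorHom,
        tensorHom_comp_tensorHom, Category.id_comp, Category.id_comp, Category.comp_id,
        tensMap_comp]
      simp only [h.one]
    rw [← cancel_epi (q c t ▷ tensor (fun _ : Fin n => 𝟙_ M)), reassoc_of% e1,
      ← reassoc_of% h.comp t c (fun i (_ : Fin 1) => c i), ← h.reindex,
      reassoc_of% O.comp_one c t, ← whisker_exchange_assoc, rightUnitor_naturality]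
  perm_comp {n k} σ t a b := by
    have := hq a t
    have := epi_tensMap (fun i => q (b i) (a i)) (fun i => hq _ _) (List.finRange n)
    have := epi_tensorHom (q a t) (tensorMap fun i => q (b i) (a i))
    rw [← cancel_epi (q a t ⊗ₘ tensorMap fun i => q (b i) (a i)), ← reassoc_of% h.comp,
      ← h.reindex, ← reassoc_of% O.perm_comp σ t a b, tensorHom_comp_tensorHom_assoc,
      permute_natural, ← h.perm, ← tensorHom_comp_tensorHom_assoc]
    have hc := h.comp t (a ∘ σ) (fun i => b (σ i))
    exact congrArg _ hc.symm
  comp_perm {n k} τ t a b := by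
    have := hq a t
    have := epi_tensMap (fun i => q (b i) (a i)) (fun i => hq _ _) (List.finRange n)
    have := epi_tensorHom (q a t) (tensorMap fun i => q (b i) (a i))
    have e1 : (q a t ⊗ₘ tensorMap fun i => q (b i) (a i)) ≫
        D.obj a t ◁ tensorMap (fun i => D.perm (τ i) (b i) (a i)) =
        O.obj a t ◁ tensorMap (fun i => O.perm (τ i) (b i) (a i)) ≫
          (q a t ⊗ₘ tensorMap fun i => q (b i ∘ τ i) (a i)) := by
      rw [← id_tensorHom, ← id_tensorHom, tensorHom_comp_tensorHom, tensorHom_comp_tensorHom,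
        Category.id_comp, Category.comp_id, tensMap_comp, tensMap_comp]
      simp only [h.perm]
    have hc := h.comp t a (fun i => b i ∘ τ i)
    rw [← cancel_epi (q a t ⊗ₘ tensorMap fun i => q (b i) (a i)), ← reassoc_of% h.comp,
      ← h.reindex, ← reassoc_of% O.comp_perm τ t a b, reassoc_of% e1, hc]

end QuotientData

section Quotient

variable {C : Type v} {M : Type u} [Category.{v} M] [MonoidalCategory M] [SymmetricCategory M]

/-- Formal operations built from the generating relations `S` and trivial relations by means of
permutations and operadic compositions. They enumerate a small set of relations on an operad that
is closed under the operad structure and contains the given ones. -/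
inductive Word (S : ∀ n : ℕ, (Fin n → C) → C → Type v) :
    ∀ n : ℕ, (Fin n → C) → C → Type v
  | refl {n : ℕ} (c : Fin n → C) (t : C) : Word S n c t
  | rel {n : ℕ} {c : Fin n → C} {t : C} (s : S n c t) : Word S n c t
  | perm {n : ℕ} (σ : Equiv.Perm (Fin n)) {c : Fin n → C} {t : C} (w : Word S n c t) :
      Word S n (c ∘ σ) t
  | comp {n : ℕ} {k : Fin n → ℕ} {t : C} {a : Fin n → C} {b : ∀ i, Fin (k i) → C}
      (w : Word S n a t) (ws : ∀ i, Word S (k i) (b i) (a i)) : Word S (∑ i, k i) (concat b) t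

variable {S : ∀ n : ℕ, (Fin n → C) → C → Type v} (O : Operad C M)
  (r : ∀ {n : ℕ} {c : Fin n → C} {t : C}, S n c t → ParallelPair (O.obj c t))

/-- The relation on the operad `O` denoted by a word in the relations `r`. -/
def Word.pair : ∀ {n : ℕ} {c : Fin n → C} {t : C}, Word S n c t → ParallelPair (O.obj c t)
  | _, _, _, .refl c t => .refl (O.obj c t)
  | _, _, _, .rel s => r s
  | _, _, _, .perm σ w => (w.pair).map (O.perm σ _ _)
  | _, _, _, .comp w ws =>
      ((w.pair).tensor (.tens (fun i => (ws i).pair) (List.finRange _))).map (O.comp _ _ _)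

theorem Word.exists_pair_eq_refl {n : ℕ} (c : Fin n → C) (t : C) :
    ∃ w : Word S n c t, w.pair O r = .refl (O.obj c t) :=
  ⟨.refl c t, rfl⟩

/-- An operad morphism that respects the generating relations respects all words in them. -/
theorem Word.coequalizes {P : Operad C M} (φ : Operad.Hom O P)
    (hφ : ∀ {n : ℕ} {c : Fin n → C} {t : C} (s : S n c t), (r s).Coequalizes (φ.app c t)) :
    ∀ {n : ℕ} {c : Fin n → C} {t : C} (w : Word S n c t), (w.pair O r).Coequalizes (φ.app c t)
  | _, _, _, .refl c t => ParallelPair.refl_coequalizes _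
  | _, _, _, .rel s => hφ s
  | _, _, _, .perm σ w => by
      refine (ParallelPair.coequalizes_map _ _ _).2 ?_
      rw [φ.perm]
      exact (Word.coequalizes φ hφ w).comp _
  | _, _, _, .comp w ws => by
      refine (ParallelPair.coequalizes_map _ _ _).2 ?_
      rw [φ.comp]
      exact ((Word.coequalizes φ hφ w).tensor
        (.tens (fun i => Word.coequalizes φ hφ (ws i)) _)).comp _

variable [MonoidalClosed M]

/-- The quotient of an operad by a small family of relations, constructed componentwise: the
relations that words denote are closed under the operad structure, and tensor products preserve
colimits in each variable, so the structure maps of `O` descend to the quotients. -/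
theorem exists_operad_quotient [HasColimits M] : ∃ (Q : Operad C M) (π : Operad.Hom O Q),
    ∀ {n : ℕ} (c : Fin n → C) (t : C),
      IsJointCoequalizer (fun w : Word S n c t => w.pair O r) (π.app c t) := by
  choose obj q hq using fun (n : ℕ) (c : Fin n → C) (t : C) =>
    IsJointCoequalizer.exists_of_hasColimits fun w : Word S n c t => w.pair O r
  have hq2 : ∀ {n : ℕ} {k : Fin n → ℕ} (t : C) (a : Fin n → C) (b : ∀ i, Fin (k i) → C), _ :=
    fun {n k} t a b => (hq n a t).tensorHom
      (IsJointCoequalizer.tensMap (fun i => hq (k i) (b i) (a i))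
        (fun i => Word.exists_pair_eq_refl O r (b i) (a i)) (List.nodup_finRange n))
      (Word.exists_pair_eq_refl O r a t)
      ⟨fun i => .refl (b i) (a i), ParallelPair.tens_refl _ _⟩
  have hperm : ∀ {n : ℕ} (σ : Equiv.Perm (Fin n)) (c : Fin n → C) (t : C) (w : Word S n c t),
      (w.pair O r).Coequalizes (O.perm σ c t ≫ q n (c ∘ σ) t) := fun σ c t w =>
    (ParallelPair.coequalizes_map _ _ _).1 ((hq _ (c ∘ σ) t).condition (.perm σ w))
  have hcomp : ∀ {n : ℕ} {k : Fin n → ℕ} (t : C) (a : Fin n → C) (b : ∀ i, Fin (k i) → C)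
      (w : Word S n a t × ∀ i, Word S (k i) (b i) (a i)),
      ((w.1.pair O r).tensor
        (ParallelPair.tens (fun i => (w.2 i).pair O r) (List.finRange n))).Coequalizes
          (O.comp t a b ≫ q _ (concat b) t) := fun t a b w =>
    (ParallelPair.coequalizes_map _ _ _).1 ((hq _ (concat b) t).condition (.comp w.1 w.2))
  let D : OperadData C M :=
    { obj := fun {n} c t => obj n c t
      perm := fun {n} σ c t => (hq n c t).desc _ (hperm σ c t)
      comp := fun {n k} t a b => (hq2 t a b).desc _ (hcomp t a b)
      one := fun c => O.one c ≫ q 1 (fun _ => c) c }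
  have hD : OperadData.IsHom O.toOperadData D fun {n} c t => q n c t :=
    { perm := fun {n} σ c t => ((hq n c t).fac _ (hperm σ c t)).symm
      comp := fun t a b => ((hq2 t a b).fac _ (hcomp t a b)).symm
      one := fun _ => rfl }
  exact ⟨O.ofEpi D (fun {n} c t => q n c t) hD fun {n} c t => (hq n c t).epi,
    ⟨fun {n} c t => q n c t, hD.perm, hD.comp, hD.one⟩, fun {n} c t => hq n c t⟩

variable {O r}

/-- A componentwise quotient by the words in given relations is universal among the operad
morphisms that respect these relations. -/
theorem existsUnique_operad_desc {Q P : Operad C M} (π : O ⟶ Q)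
    (hπ : ∀ {n : ℕ} (c : Fin n → C) (t : C),
      IsJointCoequalizer (fun w : Word S n c t => w.pair O r) (Operad.Hom.app π c t))
    (φ : O ⟶ P)
    (hφ : ∀ {n : ℕ} {c : Fin n → C} {t : C} (s : S n c t),
      (r s).Coequalizes (Operad.Hom.app φ c t)) :
    ∃! ψ : Q ⟶ P, π ≫ ψ = φ := by
  have hw := fun {n : ℕ} (c : Fin n → C) (t : C) (w : Word S n c t) =>
    Word.coequalizes O r φ hφ w
  have he := fun {n : ℕ} (c : Fin n → C) (t : C) => (hπ c t).epi
  have hfac := fun {n : ℕ} (c : Fin n → C) (t : C) => (hπ c t).fac _ (hw c t)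
  refine ⟨({ app := fun {n} c t => (hπ c t).desc _ (hw c t)
             perm := fun {n} σ c t => ?_
             comp := fun {n k} t a b => ?_
             one := fun c => ?_ } : Operad.Hom Q P), ?_, ?_⟩
  · have := he c t
    rw [← cancel_epi (Operad.Hom.app π c t), ← reassoc_of% π.perm σ c t, hfac, reassoc_of% hfac,
      φ.perm]
  · have := he a t
    have := epi_tensMap (fun i => Operad.Hom.app π (b i) (a i)) (fun i => he _ _) (List.finRange n)
    have := epi_tensorHom (Operad.Hom.app π a t) (tensorMap fun i => Operad.Hom.app π (b i) (a i))
    rw [← cancel_epi (Operad.Hom.app π a t ⊗ₘ tensorMap fun i => Operad.Hom.app π (b i) (a i)),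
      ← reassoc_of% π.comp t a b, hfac, φ.comp, tensorHom_comp_tensorHom_assoc, tensMap_comp, hfac]
    simp only [hfac]
  · rw [← π.one, Category.assoc, hfac, φ.one]
  · apply Operad.Hom.ext
    funext n c t
    exact hfac c t
  · intro ψ hψ
    apply Operad.Hom.ext
    funext n c t
    have := he c t
    rw [← cancel_epi (Operad.Hom.app π c t), hfac, ← hψ]
    rfl

end Quotient

/-! ### Coherence of reordered tensor products -/

section Isomorphisms

variable {M : Type u} [Category.{v} M] [MonoidalCategory M]

theorem isIso_tensAppend {ι : Type*} (X : ι → M) : ∀ l l' : List ι, IsIso (tensAppend X l l')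
  | [], l' => by unfold tensAppend; infer_instance
  | i :: l, l' => by
      have := isIso_tensAppend X l l'
      unfold tensAppend
      infer_instance

theorem isIso_tensRename {ι κ : Type*} (g : ι → κ) (X : κ → M) :
    ∀ l : List ι, IsIso (tensRename g X l)
  | [] => inferInstanceAs (IsIso (𝟙 _))
  | i :: l => by
      have := isIso_tensRename g X l
      unfold tensRename
      exact inferInstanceAs (IsIso (X (g i) ◁ tensRename g X l))

theorem isIso_tensSigma {ι : Type*} {κ : ι → Type*} (X : ∀ i, κ i → M) (K : ∀ i, List (κ i)) :
    ∀ l : List ι, IsIso (tensSigma X K l)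
  | [] => inferInstanceAs (IsIso (𝟙 _))
  | i :: l => by
      have := isIso_tensSigma X K l
      have := isIso_tensRename (Sigma.mk i) (fun s : Σ i, κ i => X s.1 s.2) (K i)
      have := isIso_tensAppend (fun s : Σ i, κ i => X s.1 s.2) ((K i).map (Sigma.mk i)) (l.sigma K)
      exact inferInstanceAs (IsIso
        ((tensRename (Sigma.mk i) (fun s : Σ i, κ i => X s.1 s.2) (K i) ⊗ₘ tensSigma X K l) ≫
          tensAppend (fun s : Σ i, κ i => X s.1 s.2) ((K i).map (Sigma.mk i)) (l.sigma K)))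

variable [SymmetricCategory M]

theorem isIso_tensShuffle {ι : Type*} (X Y : ι → M) : ∀ l : List ι, IsIso (tensShuffle X Y l)
  | [] => inferInstanceAs (IsIso (λ_ (𝟙_ M)).inv)
  | i :: l => by
      have := isIso_tensShuffle X Y l
      unfold tensShuffle tensorμ
      infer_instance

theorem isIso_tensInsert {κ : Type*} [DecidableEq κ] (Y : κ → M) (j : κ) :
    ∀ (l : List κ) (h : j ∈ l), IsIso (tensInsert Y j l h)
  | [], h => absurd h List.not_mem_nil
  | k :: l, h => by
      by_cases e : k = j
      · simp only [tensInsert, dif_pos e]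
        infer_instance
      · have := isIso_tensInsert Y j l ((List.mem_cons.mp h).resolve_left (Ne.symm e))
        simp only [tensInsert, dif_neg e]
        infer_instance

theorem isIso_tensReorder {ι κ : Type*} [DecidableEq κ] (e : ι → κ) (X : ι → M) (Y : κ → M)
    (h : ∀ i, X i = Y (e i)) :
    ∀ (l : List ι) (l' : List κ) (hl : (l.map e).Perm l'), IsIso (tensReorder e X Y h l l' hl)
  | [], l', hl => by
      unfold tensReorder
      infer_instance
  | i :: l, l', hl => by
      have := isIso_tensReorder e X Y h l (l'.erase (e i)) (List.cons_perm_iff_perm_erase.mp hl).2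
      have := isIso_tensInsert Y (e i) l' (List.cons_perm_iff_perm_erase.mp hl).1
      unfold tensReorder
      infer_instance

theorem isIso_permute {n : ℕ} (σ : Equiv.Perm (Fin n)) (X : Fin n → M) : IsIso (permute σ X) :=
  isIso_tensReorder _ _ _ _ _ _ _

theorem isIso_flatten {n : ℕ} {k : Fin n → ℕ} (X : ∀ i, Fin (k i) → M) : IsIso (flatten X) := by
  have := isIso_tensSigma X (fun i => List.finRange (k i)) (List.finRange n)
  have := isIso_tensReorder (finSigmaFinEquiv : (Σ i : Fin n, Fin (k i)) → Fin (∑ i, k i))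
    (fun s : Σ i : Fin n, Fin (k i) => X s.1 s.2) (concat X)
    (fun s => congrArg (fun s' : Σ i : Fin n, Fin (k i) => X s'.1 s'.2)
      (Equiv.symm_apply_apply finSigmaFinEquiv s).symm) _ _ (map_finSigmaFinEquiv_perm k)
  unfold flatten
  infer_instance

end Isomorphisms

section Coherence

variable {M : Type u} [Category.{v} M] [MonoidalCategory M]

theorem tens_eq_foldr {ι : Type*} (X : ι → M) :
    ∀ l : List ι, tens X l = (l.map X).foldr (fun A B => A ⊗ B) (𝟙_ M)
  | [] => rfl
  | i :: l => by simp only [tens, List.map_cons, List.foldr_cons, tens_eq_foldr X l]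

/-- Tensor products along lists agree when the lists of factors agree. -/
theorem tens_eq_of_map_eq {ι κ : Type*} {X : ι → M} {Y : κ → M} {l : List ι} {l' : List κ}
    (h : l.map X = l'.map Y) : tens X l = tens Y l' := by
  rw [tens_eq_foldr, tens_eq_foldr, h]

theorem eqToHom_tensorHom_eqToHom {A A' B B' : M} (p : A = A') (q : B = B')
    (r : A ⊗ B = A' ⊗ B') : eqToHom p ⊗ₘ eqToHom q = eqToHom r := by
  subst p q
  simp

theorem whiskerLeft_eqToHom' {A B B' : M} (q : B = B') (r : A ⊗ B = A ⊗ B') :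
    A ◁ eqToHom q = eqToHom r := by
  subst q
  simp

theorem comp_eqToHom_cycle {M : Type u} [Category.{v} M] {A B B₁ B₂ : M} (f : A ⟶ B)
    (p : B = B₁) (q : B₁ = B₂) (r : B₂ = B) :
    ((f ≫ eqToHom p) ≫ eqToHom q) ≫ eqToHom r = f := by
  subst p q
  simp

theorem tensRename_eq_eqToHom {ι κ : Type*} (g : ι → κ) (X : κ → M) :
    ∀ (l : List ι) (p : tens (fun i => X (g i)) l = tens X (l.map g)),
      tensRename g X l = eqToHom p
  | [], _ => rfl
  | i :: l, p => by
      have q : tens (fun i => X (g i)) l = tens X (l.map g) :=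
        tens_eq_of_map_eq (by simp [Function.comp_def])
      have e := tensRename_eq_eqToHom g X l q
      change X (g i) ◁ tensRename g X l = _
      rw [e]
      exact whiskerLeft_eqToHom' q p

theorem tensAppend_nil {ι : Type*} (X : ι → M) :
    ∀ (l : List ι) (p : tens X l = tens X (l ++ [])),
      tensAppend X l [] = (ρ_ (tens X l)).hom ≫ eqToHom p
  | [], p => by
      simp only [tensAppend, eqToHom_refl, Category.comp_id]
      exact unitors_equal
  | i :: l, p => by
      have q : tens X l = tens X (l ++ []) := by rw [List.append_nil]
      change (α_ (X i) (tens X l) (𝟙_ M)).hom ≫ X i ◁ tensAppend X l [] = _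
      rw [tensAppend_nil X l q, MonoidalCategory.whiskerLeft_comp, whiskerLeft_eqToHom' q p,
        ← Category.assoc, ← rightUnitor_tensor_hom]

theorem tensAppend_singleton {ι : Type*} (X : ι → M) (i : ι) (l : List ι) :
    tensAppend X [i] l = (ρ_ (X i)).hom ▷ tens X l := by
  change (α_ (X i) (𝟙_ M) (tens X l)).hom ≫ X i ◁ (λ_ (tens X l)).hom = _
  exact triangle _ _

theorem tensSigma_singleton {ι : Type*} {κ : ι → Type*} (X : ∀ i, κ i → M) (K : ∀ i, List (κ i))
    (i : ι) (p : tens (X i) (K i) = tens (fun s : Σ i, κ i => X s.1 s.2) ([i].sigma K)) :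
    tensSigma X K [i] = (ρ_ (tens (X i) (K i))).hom ≫ eqToHom p := by
  have q : tens (X i) (K i) = tens (fun s : Σ i, κ i => X s.1 s.2) ((K i).map (Sigma.mk i)) :=
    tens_eq_of_map_eq (by simp [Function.comp_def])
  have q' : tens (fun s : Σ i, κ i => X s.1 s.2) ((K i).map (Sigma.mk i)) =
    tens (fun s : Σ i, κ i => X s.1 s.2) ((K i).map (Sigma.mk i) ++ []) := by rw [List.append_nil]
  change (tensRename (Sigma.mk i) (fun s : Σ i, κ i => X s.1 s.2) (K i) ⊗ₘ 𝟙 (𝟙_ M)) ≫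
    tensAppend (fun s : Σ i, κ i => X s.1 s.2) ((K i).map (Sigma.mk i)) [] = _
  rw [tensAppend_nil _ _ q', tensorHom_id, rightUnitor_naturality_assoc]
  have e := tensRename_eq_eqToHom (Sigma.mk i) (fun s : Σ i, κ i => X s.1 s.2) (K i) q
  rw [e]
  exact congrArg _ (eqToHom_trans q q')

theorem tensSigma_one {ι : Type*} (X : ∀ _ : ι, Fin 1 → M) :
    ∀ (l : List ι) (p : tens (fun i => X i 0) l =
      tens (fun s : Σ _ : ι, Fin 1 => X s.1 s.2) (l.sigma fun _ => List.finRange 1)),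
      tensSigma X (fun _ => List.finRange 1) l =
        tensMap (fun i => (tensorOne (X i)).hom) l ≫ eqToHom p
  | [], p => by simp [tensSigma, tensMap]
  | i :: l, p => by
      have q : tens (fun i => X i 0) l =
          tens (fun s : Σ _ : ι, Fin 1 => X s.1 s.2) (l.sigma fun _ => List.finRange 1) :=
        tens_eq_of_map_eq (by
          clear p
          induction l with
          | nil => rfl
          | cons j l ih => exact congrArg (X j 0 :: ·) ih)
      change (X i 0 ◁ 𝟙 (𝟙_ M) ⊗ₘ tensSigma X (fun _ => List.finRange 1) l) ≫
        tensAppend (fun s : Σ _ : ι, Fin 1 => X s.1 s.2) [⟨i, 0⟩] _ =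
          ((ρ_ (X i 0)).hom ⊗ₘ tensMap (fun i => (tensorOne (X i)).hom) l) ≫ eqToHom p
      rw [tensAppend_singleton, tensSigma_one X l q, ← tensorHom_id, tensorHom_comp_tensorHom,
        MonoidalCategory.whiskerLeft_id, Category.id_comp, Category.comp_id]
      have e := whiskerLeft_eqToHom' (A := X i 0) q p
      refine Eq.trans ?_ (congrArg (fun z =>
        ((ρ_ (X i 0)).hom ⊗ₘ tensMap (fun i => (tensorOne (X i)).hom) l) ≫ z) e)
      dsimp only
      rw [← id_tensorHom, tensorHom_comp_tensorHom, Category.comp_id]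

variable [SymmetricCategory M]

theorem tensInsert_head {κ : Type*} [DecidableEq κ] (Y : κ → M) (k : κ) (l : List κ)
    (h : k ∈ k :: l) (p : Y k ⊗ tens Y ((k :: l).erase k) = tens Y (k :: l)) :
    tensInsert Y k (k :: l) h = eqToHom p := by
  simp only [tensInsert, dif_pos]

theorem tensReorder_eq_eqToHom {ι κ : Type*} [DecidableEq κ] (e : ι → κ) (X : ι → M) (Y : κ → M)
    (h : ∀ i, X i = Y (e i)) :
    ∀ (l : List ι) (l' : List κ) (hl : (l.map e).Perm l') (_ : l.map e = l')
      (p : tens X l = tens Y l'), tensReorder e X Y h l l' hl = eqToHom p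
  | [], l', hl, hl', p => rfl
  | i :: l, _, hl, rfl, p => by
      have hm : l.map e = ((i :: l).map e).erase (e i) := by simp
      have q : tens X l = tens Y (((i :: l).map e).erase (e i)) :=
        tens_eq_of_map_eq (by rw [← hm]; simp [h, Function.comp_def])
      have e1 := tensReorder_eq_eqToHom e X Y h l (((i :: l).map e).erase (e i))
        (List.cons_perm_iff_perm_erase.mp hl).2 hm q
      have q' : Y (e i) ⊗ tens Y (((i :: l).map e).erase (e i)) = tens Y ((i :: l).map e) := by
        rw [← hm, List.map_cons]
      have e2 := tensInsert_head Y (e i) (l.map e) (List.cons_perm_iff_perm_erase.mp hl).1 q'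
      change (eqToHom (h i) ⊗ₘ tensReorder e X Y h l (((i :: l).map e).erase (e i)) _) ≫
        tensInsert Y (e i) ((i :: l).map e) _ = _
      rw [e1, eqToHom_tensorHom_eqToHom (h i) q (by rw [h i, q])]
      refine (congrArg _ e2).trans (eqToHom_trans _ _)

theorem map_finRange_eq {m n : ℕ} (f : Fin m → Fin n) (hmn : m = n)
    (hf : ∀ i, (f i : ℕ) = i) : (List.finRange m).map f = List.finRange n := by
  subst hmn
  obtain rfl : f = id := funext fun i => Fin.ext (hf i)
  exact List.map_id _

theorem coe_oneBlock {k : ℕ} (i : Fin k) : (oneBlock k i : ℕ) = i := by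
  change ((finSigmaFinEquiv (⟨0, i⟩ : Σ _ : Fin 1, Fin k) : Fin _) : ℕ) = i
  simp [finSigmaFinEquiv_apply]

theorem coe_singletonBlocks {n : ℕ} (i : Fin n) : (singletonBlocks n i : ℕ) = i := by
  change ((finSigmaFinEquiv (⟨i, 0⟩ : Σ _ : Fin n, Fin 1) : Fin _) : ℕ) = i
  simp [finSigmaFinEquiv_apply]

theorem map_finRange_perm {m n : ℕ} (e : Fin m ≃ Fin n) :
    ((List.finRange n).map e.symm).Perm (List.finRange m) := by
  obtain rfl : m = n := by simpa using Fintype.card_congr e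
  exact Equiv.Perm.map_finRange_perm e.symm

/-- The permutation of factors along a bijection `e : Fin m ≃ Fin n`, for a tuple `X'` that is
equal to `X ∘ e`; compare `OperadData.reindex`. -/
def permuteAlong {m n : ℕ} (e : Fin m ≃ Fin n) {X : Fin n → M} {X' : Fin m → M}
    (h : ∀ i, X' i = X (e i)) : tensor X ⟶ tensor X' :=
  tensReorder (e.symm : Fin n → Fin m) X X' (fun j => by rw [h, Equiv.apply_symm_apply])
    _ _ (map_finRange_perm e)

theorem permuteAlong_eq_eqToHom {m n : ℕ} (e : Fin m ≃ Fin n) {X : Fin n → M} {X' : Fin m → M}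
    (h : ∀ i, X' i = X (e i)) (he : ∀ i, (e i : ℕ) = i) (p : tensor X = tensor X') :
    permuteAlong e h = eqToHom p :=
  tensReorder_eq_eqToHom _ _ _ _ _ _ _
    (map_finRange_eq _ (by simpa using (Fintype.card_congr e).symm) fun i => by
      rw [← he, Equiv.apply_symm_apply]) p

/-- Coherence for the left unit axiom: for a single block, flattening only removes the unit. -/
theorem flatten_oneBlock {k : ℕ} (X : Fin 1 → Fin k → M)
    (h : ∀ i, X 0 i = concat X (oneBlock k i)) :
    flatten X ≫ permuteAlong (oneBlock k) h = (tensorOne fun i => tensor (X i)).hom := by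
  have hm : ((List.sigma (List.finRange 1) fun _ => List.finRange k).map
      (finSigmaFinEquiv : (Σ i : Fin 1, Fin k) → Fin (∑ _ : Fin 1, k))) =
        List.finRange (∑ _ : Fin 1, k) := by
    change (((List.finRange k).map (Sigma.mk (β := fun _ : Fin 1 => Fin k) 0) ++ []).map _) = _
    rw [List.append_nil, List.map_map]
    exact map_finRange_eq _ (by simp) fun i => coe_oneBlock i
  have p1 : tens (X 0) (List.finRange k) = tens (fun s : Σ _ : Fin 1, Fin k => X s.1 s.2)
      (([0] : List (Fin 1)).sigma fun _ => List.finRange k) :=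
    tens_eq_of_map_eq (by simp [List.sigma, Function.comp_def])
  have p2 : tens (fun s : Σ _ : Fin 1, Fin k => X s.1 s.2)
      ((List.finRange 1).sigma fun _ => List.finRange k) =
        tens (concat X) (List.finRange (∑ _ : Fin 1, k)) :=
    tens_eq_of_map_eq (by
      rw [← hm, List.map_map]; congr 1; funext s; exact (concat_apply X s).symm)
  have p3 : tensor (concat X) = tensor (X 0) := (p1.trans p2).symm
  unfold flatten
  rw [permuteAlong_eq_eqToHom _ h (fun i => coe_oneBlock i) p3,
    tensReorder_eq_eqToHom _ _ _ _ _ _ _ hm p2]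
  change (tensSigma X (fun _ => List.finRange k) [0] ≫ _) ≫ _ = _
  rw [tensSigma_singleton _ _ _ p1]
  exact comp_eqToHom_cycle _ p1 p2 p3

/-- Coherence for the right unit axiom: for blocks of length one, flattening only removes the unit in
each block. -/
theorem flatten_singletonBlocks {n : ℕ} (X : Fin n → Fin 1 → M)
    (h : ∀ i, X i 0 = concat (k := fun _ => 1) X (singletonBlocks n i)) :
    flatten X ≫ permuteAlong (singletonBlocks n) h = tensorMap fun i => (tensorOne (X i)).hom := by
  have hm : ((List.sigma (List.finRange n) fun _ => List.finRange 1).map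
      (finSigmaFinEquiv : (Σ i : Fin n, Fin 1) → Fin (∑ _ : Fin n, 1))) =
        List.finRange (∑ _ : Fin n, 1) := by
    rw [← map_finRange_eq (singletonBlocks n) (by simp) fun i => coe_singletonBlocks i]
    generalize List.finRange n = l
    induction l with
    | nil => rfl
    | cons i l ih => exact congrArg (singletonBlocks n i :: ·) ih
  have p2 : tens (fun s : Σ _ : Fin n, Fin 1 => X s.1 s.2)
      ((List.finRange n).sigma fun _ => List.finRange 1) =
        tens (concat (k := fun _ => 1) X) (List.finRange (∑ _ : Fin n, 1)) :=
    tens_eq_of_map_eq (by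
      rw [← hm, List.map_map]; congr 1; funext s; exact (concat_apply (k := fun _ => 1) X s).symm)
  have p3 : tensor (concat (k := fun _ => 1) X) = tensor fun i => X i 0 :=
    tens_eq_of_map_eq (by
      rw [← map_finRange_eq (singletonBlocks n) (by simp) fun i => coe_singletonBlocks i,
        List.map_map]
      congr 1; funext i; exact (h i).symm)
  unfold flatten
  rw [permuteAlong_eq_eqToHom _ h (fun i => coe_singletonBlocks i) p3,
    tensReorder_eq_eqToHom _ _ _ _ _ _ _ hm p2, tensSigma_one X _ (p3.symm.trans p2.symm)]
  simp

end Coherence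

/-! ### Unary operations -/

section Unary

variable {M : Type u} [Category.{v} M] [MonoidalCategory M]

theorem isIso_tensUnit {ι : Type*} : ∀ l : List ι, IsIso (tensUnit (M := M) l)
  | [] => inferInstanceAs (IsIso (𝟙 _))
  | i :: l => by
      have := isIso_tensUnit l
      unfold tensUnit
      infer_instance

variable [SymmetricCategory M]

theorem tensShuffle_unit {ι : Type*} (Y : ι → M) : ∀ l : List ι,
    tensShuffle (fun _ => 𝟙_ M) Y l ≫ tensUnit l ▷ tens Y l ≫ (λ_ (tens Y l)).hom =
      tensMap (fun i => (λ_ (Y i)).hom) l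
  | [] => by simp [tensShuffle, tensUnit, tensMap]
  | i :: l => by
      have ih := tensShuffle_unit Y l
      change ((𝟙_ M ⊗ Y i) ◁ tensShuffle (fun _ => 𝟙_ M) Y l ≫ tensorμ (𝟙_ M) (Y i) _ (tens Y l)) ≫
        ((λ_ _).hom ≫ tensUnit l) ▷ (Y i ⊗ tens Y l) ≫ (λ_ (Y i ⊗ tens Y l)).hom =
          (λ_ (Y i)).hom ⊗ₘ tensMap (fun i => (λ_ (Y i)).hom) l
      have h := tensorμ_natural (𝟙 (𝟙_ M)) (𝟙 (Y i)) (tensUnit (M := M) l) (𝟙 (tens Y l))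
      simp only [id_tensorHom, tensorHom_id, id_whiskerRight] at h
      rw [← leftUnitor_naturality, comp_whiskerRight, Category.assoc, Category.assoc,
        ← reassoc_of% h, ← leftUnitor_monoidal, ← ih, ← MonoidalCategory.whiskerLeft_comp_assoc,
        ← id_tensorHom, tensorHom_comp_tensorHom, Category.id_comp, Category.assoc]

theorem tensMap_leftUnitor_inv_tensShuffle {ι : Type*} (Y : ι → M) (l : List ι) :
    haveI := isIso_tensUnit (M := M) l
    tensMap (fun i => (λ_ (Y i)).inv) l ≫ tensShuffle (fun _ => 𝟙_ M) Y l =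
      (λ_ (tens Y l)).inv ≫ inv (tensUnit l) ▷ tens Y l := by
  have := isIso_tensUnit (M := M) l
  rw [← cancel_mono (tensUnit l ▷ tens Y l), ← cancel_mono (λ_ (tens Y l)).hom]
  simp only [Category.assoc, tensShuffle_unit, tensMap_comp, Iso.inv_hom_id, tensMap_id]
  simp

variable {C : Type w} {O : Operad C M}

/-- Composition of the operations in `O (c; s)` with a unary operation `u : s ⟶ t`. -/
def OperadData.postComp (O : OperadData C M) {s t : C} (u : 𝟙_ M ⟶ O.obj (fun _ : Fin 1 => s) t)
    {k : ℕ} (c : Fin k → C) : O.obj c s ⟶ O.obj c t :=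
  (λ_ _).inv ≫ (u ⊗ₘ (tensorOne fun _ => O.obj c s).inv) ≫
    O.comp t (fun _ : Fin 1 => s) (fun _ => c) ≫ O.reindex (oneBlock k) (concat_oneBlock c) t

/-- Composition of the operations in `O (a; t)` with unary operations `u i : c i ⟶ a i`. -/
noncomputable def OperadData.preComp (O : OperadData C M) {n : ℕ} {c a : Fin n → C}
    (u : ∀ i, 𝟙_ M ⟶ O.obj (fun _ : Fin 1 => c i) (a i)) (t : C) : O.obj a t ⟶ O.obj c t :=
  haveI := isIso_tensUnit (M := M) (List.finRange n)
  (ρ_ _).inv ≫ O.obj a t ◁ inv (tensUnit (List.finRange n)) ≫ O.obj a t ◁ tensorMap u ≫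
    O.comp t a (fun i _ => c i) ≫ O.reindex (singletonBlocks n) (concat_singletonBlocks c) t

theorem Operad.postComp_one (O : Operad C M) {k : ℕ} (c : Fin k → C) (t : C) :
    O.postComp (O.one t) c = 𝟙 (O.obj c t) := by
  rw [OperadData.postComp, MonoidalCategory.tensorHom_def', Category.assoc,
    O.one_comp c t]
  simp

theorem Operad.preComp_one (O : Operad C M) {n : ℕ} (c : Fin n → C) (t : C) :
    O.preComp (fun i => O.one (c i)) t = 𝟙 (O.obj c t) := by
  have := isIso_tensUnit (M := M) (List.finRange n)
  rw [OperadData.preComp, O.comp_one c t, ← MonoidalCategory.whiskerLeft_comp_assoc]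
  simp

namespace OperadAlgebra

/-- The morphism by which a unary operation acts on an algebra. -/
def unary (A : OperadAlgebra O) {s t : C} (u : 𝟙_ M ⟶ O.obj (fun _ : Fin 1 => s) t) :
    A.carrier s ⟶ A.carrier t :=
  (λ_ (A.carrier s)).inv ≫ (u ⊗ₘ (tensorOne fun _ => A.carrier s).inv) ≫ A.act (fun _ => s) t

theorem act_reindex (A : OperadAlgebra O) {m n : ℕ} (e : Fin m ≃ Fin n) {c : Fin n → C}
    {c' : Fin m → C} (hc : ∀ i, c' i = c (e i)) (t : C)
    (h : ∀ i, A.carrier (c' i) = A.carrier (c (e i))) :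
    (O.reindex e hc t ⊗ₘ permuteAlong (X := fun i => A.carrier (c i)) e h) ≫ A.act c' t =
      A.act c t := by
  obtain rfl : m = n := by simpa using Fintype.card_congr e
  obtain rfl : c' = c ∘ e := funext hc
  exact A.equivariant e c t

/-- Composite operations with a unary outer operation act by composition of the actions. -/
theorem act_postComp (A : OperadAlgebra O) {s t : C} (u : 𝟙_ M ⟶ O.obj (fun _ : Fin 1 => s) t)
    {k : ℕ} (c : Fin k → C) :
    A.act c s ≫ A.unary u = O.postComp u c ▷ tensor (fun i => A.carrier (c i)) ≫ A.act c t := by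
  set T := tensor fun i => A.carrier (c i)
  have h1 := A.assoc (n := 1) (k := fun _ => k) t (fun _ => s) (fun _ => c)
  have h2 := A.act_reindex (oneBlock k) (concat_oneBlock c) t
    (fun i => congrArg A.carrier (concat_oneBlock c i))
  have h3 := flatten_oneBlock (fun (_ : Fin 1) i => A.carrier (c i))
    (fun i => congrArg A.carrier (concat_oneBlock c i))
  have h4 : (tensorOne fun _ => O.obj c s ⊗ T).inv ≫
      tensShuffle (fun _ : Fin 1 => O.obj c s) (fun _ => T) (List.finRange 1) =
        ((tensorOne fun _ => O.obj c s).inv ⊗ₘ (tensorOne fun _ => T).inv) := by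
    rw [Iso.inv_comp_eq]
    change (O.obj c s ⊗ T) ◁ (λ_ (𝟙_ M)).inv ≫ tensorμ _ _ _ _ =
      (ρ_ _).hom ≫ ((ρ_ _).inv ⊗ₘ (ρ_ _).inv)
    rw [tensor_right_unitality]
    simp
  have h5 : A.act c s ≫ (tensorOne fun _ => A.carrier s).inv =
      (tensorOne fun _ => O.obj c s ⊗ T).inv ≫ tensorMap (fun _ : Fin 1 => A.act c s) := by
    rw [Iso.eq_inv_comp, ← Category.assoc, Iso.comp_inv_eq]
    exact (tensorOne_natural fun _ : Fin 1 => A.act c s).symm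
  have h6 : A.act c s ≫ (λ_ (A.carrier s)).inv ≫ (u ⊗ₘ (tensorOne fun _ => A.carrier s).inv) =
      (λ_ (O.obj c s ⊗ T)).inv ≫ (u ⊗ₘ (tensorOne fun _ => O.obj c s ⊗ T).inv) ≫
        O.obj (fun _ : Fin 1 => s) t ◁ tensorMap (fun _ : Fin 1 => A.act c s) := by
    rw [leftUnitor_inv_naturality_assoc, ← id_tensorHom, ← id_tensorHom, tensorHom_comp_tensorHom,
      tensorHom_comp_tensorHom, h5, Category.id_comp, Category.comp_id]
  have h7 : (O.comp t (fun _ : Fin 1 => s) (fun _ => c) ⊗ₘ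
      flatten fun (_ : Fin 1) i => A.carrier (c i)) ≫ A.act (concat fun _ : Fin 1 => c) t =
        ((O.comp t (fun _ : Fin 1 => s) (fun _ => c) ≫
          O.reindex (oneBlock k) (concat_oneBlock c) t) ⊗ₘ (tensorOne fun _ => T).hom) ≫
            A.act c t := by
    rw [← h3, ← tensorHom_comp_tensorHom, Category.assoc]
    exact congrArg _ h2.symm
  have h8 : (u ⊗ₘ (tensorOne fun _ => O.obj c s ⊗ T).inv) ≫ O.obj (fun _ : Fin 1 => s) t ◁
      tensShuffle (fun _ : Fin 1 => O.obj c s) (fun _ => T) (List.finRange 1) =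
        u ⊗ₘ ((tensorOne fun _ => O.obj c s).inv ⊗ₘ (tensorOne fun _ => T).inv) := by
    rw [← id_tensorHom, tensorHom_comp_tensorHom, h4, Category.comp_id]
  have h9 : (λ_ (O.obj c s ⊗ T)).inv ≫ (α_ (𝟙_ M) (O.obj c s) T).inv =
      (λ_ (O.obj c s)).inv ▷ T := by
    monoidal
  unfold unary
  rw [reassoc_of% h6, h1, reassoc_of% h8, h7, associator_inv_naturality_assoc,
    tensorHom_comp_tensorHom_assoc, Iso.inv_hom_id, OperadData.postComp, tensorHom_id,
    reassoc_of% h9, ← comp_whiskerRight_assoc]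

/-- Composite operations with unary inner operations act by composition of the actions. -/
theorem act_preComp (A : OperadAlgebra O) {n : ℕ} {c a : Fin n → C}
    (u : ∀ i, 𝟙_ M ⟶ O.obj (fun _ : Fin 1 => c i) (a i)) (t : C) :
    O.obj a t ◁ tensorMap (fun i => A.unary (u i)) ≫ A.act a t =
      O.preComp u t ▷ tensor (fun i => A.carrier (c i)) ≫ A.act c t := by
  set T := tensor fun i => A.carrier (c i)
  have := isIso_tensUnit (M := M) (List.finRange n)
  have h1 := A.assoc (n := n) (k := fun _ => 1) t a (fun i _ => c i)
  have h2 := A.act_reindex (singletonBlocks n) (concat_singletonBlocks c) t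
    (fun i => congrArg A.carrier (concat_singletonBlocks c i))
  have h3 := flatten_singletonBlocks (fun i (_ : Fin 1) => A.carrier (c i))
    (fun i => congrArg A.carrier (concat_singletonBlocks c i))
  have h4 := tensMap_leftUnitor_inv_tensShuffle (fun i => A.carrier (c i)) (List.finRange n)
  have h5 : (tensorMap fun i => A.unary (u i)) = tensorMap (fun i => (λ_ (A.carrier (c i))).inv) ≫
      (tensorMap fun i => u i ⊗ₘ (tensorOne fun _ => A.carrier (c i)).inv) ≫
        tensorMap fun i => A.act (fun _ : Fin 1 => c i) (a i) := by
    rw [tensMap_comp, tensMap_comp]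
    rfl
  have h6 : tensorMap (fun i => (λ_ (A.carrier (c i))).inv) ≫
      (tensorMap fun i => u i ⊗ₘ (tensorOne fun _ => A.carrier (c i)).inv) ≫
        tensShuffle (fun i => O.obj (fun _ : Fin 1 => c i) (a i))
          (fun i => tensor fun _ : Fin 1 => A.carrier (c i)) (List.finRange n) =
      (λ_ T).inv ≫ (inv (tensUnit (List.finRange n)) ≫ tensorMap u ⊗ₘ
        tensorMap fun i => (tensorOne fun _ => A.carrier (c i)).inv) := by
    rw [tensShuffle_natural, reassoc_of% h4, ← tensorHom_id, tensorHom_comp_tensorHom,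
      Category.id_comp]
  have h7 : (O.comp t a (fun i (_ : Fin 1) => c i) ⊗ₘ
      flatten fun i (_ : Fin 1) => A.carrier (c i)) ≫
        A.act (concat (k := fun _ => 1) fun i (_ : Fin 1) => c i) t =
        ((O.comp t a (fun i (_ : Fin 1) => c i) ≫
          O.reindex (singletonBlocks n) (concat_singletonBlocks c) t) ⊗ₘ
            tensorMap fun i => (tensorOne fun _ => A.carrier (c i)).hom) ≫ A.act c t := by
    rw [← h3, ← tensorHom_comp_tensorHom, Category.assoc]
    exact congrArg _ h2.symm
  have h8 : (tensorMap fun i => (tensorOne fun _ : Fin 1 => A.carrier (c i)).inv) ≫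
      (tensorMap fun i => (tensorOne fun _ : Fin 1 => A.carrier (c i)).hom) = 𝟙 T := by
    rw [tensMap_comp]
    simp only [Iso.inv_hom_id, tensMap_id]
    rfl
  have h9 : O.obj a t ◁ (λ_ T).inv ≫ (α_ (O.obj a t) (𝟙_ M) T).inv = (ρ_ (O.obj a t)).inv ▷ T := by
    monoidal
  rw [h5, MonoidalCategory.whiskerLeft_comp, MonoidalCategory.whiskerLeft_comp]
  simp only [Category.assoc]
  rw [h1, ← MonoidalCategory.whiskerLeft_comp_assoc, ← MonoidalCategory.whiskerLeft_comp_assoc,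
    Category.assoc, h6, h7, MonoidalCategory.whiskerLeft_comp_assoc, ← id_tensorHom _ (_ ⊗ₘ _),
    associator_inv_naturality_assoc, tensorHom_comp_tensorHom_assoc, h8, tensorHom_id,
    reassoc_of% h9, ← comp_whiskerRight_assoc, OperadData.preComp]
  simp only [id_tensorHom, MonoidalCategory.whiskerLeft_comp, Category.assoc]
  rfl

end OperadAlgebra

namespace IsAux

variable {C : Type v} [SmallCategory C] {P : Operad Unit M} {D : OperadData C M}
  {ι : ∀ {n : ℕ} (c : Fin n → C) (t : C) (_ : ∀ i, c i ⟶ t),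
    P.obj (fun _ : Fin n => ()) () ⟶ D.obj c t}

/-- In the auxiliary operad, postcomposition with a unary operation in the summand of `g` composes
the indices of the summands with `g`. -/
theorem ι_postComp (h : IsAux P D ι) {s t : C} (g : s ⟶ t)
    (u : 𝟙_ M ⟶ P.obj (fun _ : Fin 1 => ()) ()) {k : ℕ} (c : Fin k → C) (f : ∀ i, c i ⟶ s) :
    ι c s f ≫ D.postComp (u ≫ ι (fun _ => s) t fun _ => g) c =
      P.postComp u (fun _ : Fin k => ()) ≫ ι c t fun i => f i ≫ g := by
  have h1 := h.reindex (oneBlock k) (concat_oneBlock c) t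
    (compTuple (fun _ => g) fun _ => f) (fun i => f i ≫ g) (fun j =>
      compTuple_cast (fun _ : Fin 1 => g) (fun _ => f) ⟨0, j⟩ (oneBlock k j) rfl
        (concat_apply (k := fun _ => k) (fun _ => c) ⟨0, j⟩).symm)
  have e1 : ι c s f ≫ (tensorOne fun _ => D.obj c s).inv =
      (tensorOne fun _ => P.obj (fun _ : Fin k => ()) ()).inv ≫
        tensorMap fun _ : Fin 1 => ι c s f := by
    rw [Iso.eq_inv_comp, ← Category.assoc, Iso.comp_inv_eq]
    exact (tensorOne_natural fun _ : Fin 1 => ι c s f).symm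
  have e2 : ι c s f ≫ (λ_ _).inv ≫
      ((u ≫ ι (fun _ => s) t fun _ => g) ⊗ₘ (tensorOne fun _ => D.obj c s).inv) =
        (λ_ _).inv ≫ (u ⊗ₘ (tensorOne fun _ => P.obj (fun _ : Fin k => ()) ()).inv) ≫
          (ι (fun _ => s) t (fun _ => g) ⊗ₘ tensorMap fun _ : Fin 1 => ι c s f) := by
    rw [leftUnitor_inv_naturality_assoc, ← id_tensorHom, tensorHom_comp_tensorHom,
      tensorHom_comp_tensorHom, e1, Category.id_comp]
  rw [OperadData.postComp, reassoc_of% e2, reassoc_of% h.comp, h1, OperadData.postComp]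
  simp only [Category.assoc]

/-- In the auxiliary operad, precomposition with unary operations in the summands of `g i` composes
the indices of the summands with the `g i`. -/
theorem ι_preComp (h : IsAux P D ι) {n : ℕ} {c a : Fin n → C} {t : C} (g : ∀ i, c i ⟶ a i)
    (u : ∀ _ : Fin n, 𝟙_ M ⟶ P.obj (fun _ : Fin 1 => ()) ()) (f : ∀ i, a i ⟶ t) :
    ι a t f ≫ D.preComp (fun i => u i ≫ ι (fun _ => c i) (a i) fun _ => g i) t =
      P.preComp (c := fun _ => ()) (a := fun _ => ()) u () ≫ ι c t fun i => g i ≫ f i := by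
  have := isIso_tensUnit (M := M) (List.finRange n)
  have h1 := h.reindex (singletonBlocks n) (concat_singletonBlocks c) t
    (compTuple f fun i _ => g i) (fun i => g i ≫ f i) (fun j =>
      compTuple_cast f (fun i (_ : Fin 1) => g i) ⟨j, 0⟩ (singletonBlocks n j) rfl
        (concat_apply (k := fun _ => 1) (fun i _ => c i) ⟨j, 0⟩).symm)
  have hc := h.comp t a (fun i (_ : Fin 1) => c i) f (fun i _ => g i)
  have e1 : ι a t f ≫ (ρ_ _).inv ≫ D.obj a t ◁ inv (tensUnit (List.finRange n)) ≫
      D.obj a t ◁ tensorMap (fun i => u i ≫ ι (fun _ : Fin 1 => c i) (a i) fun _ => g i) =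
        (ρ_ _).inv ≫ P.obj (fun _ : Fin n => ()) () ◁ inv (tensUnit (List.finRange n)) ≫
          P.obj (fun _ : Fin n => ()) () ◁ tensorMap u ≫
            (ι a t f ⊗ₘ tensorMap fun i => ι (fun _ : Fin 1 => c i) (a i) fun _ => g i) := by
    have e2 : (tensorMap fun i => u i ≫ ι (fun _ : Fin 1 => c i) (a i) fun _ => g i) =
        tensorMap u ≫ tensorMap fun i => ι (fun _ : Fin 1 => c i) (a i) fun _ => g i :=
      (tensMap_comp _ _ _).symm
    rw [rightUnitor_inv_naturality_assoc, e2]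
    simp only [← id_tensorHom, ← tensorHom_id, tensorHom_comp_tensorHom, Category.id_comp,
      Category.comp_id]
  rw [OperadData.preComp, reassoc_of% e1, reassoc_of% hc, h1, OperadData.preComp]
  simp only [Category.assoc]

end IsAux

end Unary

/-! ### Restriction and extension of algebras -/

section ChangeOfOperads

variable {M : Type u} [Category.{v} M] [MonoidalCategory M] [SymmetricCategory M]

namespace OperadAlgebra

/-- Restriction of an algebra along a map `f` of colours and compatible morphisms `q` between the
objects of operations. -/
def pullback {C C' : Type*} {O : Operad C M} {O' : Operad C' M} (f : C' → C)
    (q : ∀ {n : ℕ} (c : Fin n → C') (t : C'), O'.obj c t ⟶ O.obj (fun i => f (c i)) (f t))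
    (hperm : ∀ {n : ℕ} (σ : Equiv.Perm (Fin n)) (c : Fin n → C') (t : C'),
      O'.perm σ c t ≫ q (c ∘ σ) t = q c t ≫ O.perm σ (fun i => f (c i)) (f t))
    (hcomp : ∀ {n : ℕ} {k : Fin n → ℕ} (t : C') (a : Fin n → C') (b : ∀ i, Fin (k i) → C'),
      O'.comp t a b ≫ q (concat b) t = (q a t ⊗ₘ tensorMap fun i => q (b i) (a i)) ≫
        O.comp (f t) (fun i => f (a i)) (fun i j => f (b i j)))
    (hone : ∀ c : C', O'.one c ≫ q (fun _ => c) c = O.one (f c))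
    (A : OperadAlgebra O) : OperadAlgebra O' where
  carrier c := A.carrier (f c)
  act c t := q c t ▷ _ ≫ A.act (fun i => f (c i)) (f t)
  assoc {n k} t a b := by
    have h1 := A.assoc (f t) (fun i => f (a i)) (fun i j => f (b i j))
    have e1 : O'.obj a t ◁ (tensorMap fun i =>
        q (b i) (a i) ▷ tensor (fun j => A.carrier (f (b i j))) ≫
          A.act (fun j => f (b i j)) (f (a i))) ≫ q a t ▷ _ =
        (q a t ⊗ₘ tensorMap fun i => q (b i) (a i) ⊗ₘ
            tensorMap fun j => 𝟙 (A.carrier (f (b i j)))) ≫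
          O.obj (fun i => f (a i)) (f t) ◁ tensorMap fun i =>
            A.act (fun j => f (b i j)) (f (a i)) := by
      rw [← id_tensorHom, ← tensorHom_id, ← id_tensorHom, tensorHom_comp_tensorHom,
        tensorHom_comp_tensorHom, Category.id_comp, Category.comp_id, Category.comp_id,
        tensMap_comp]
      simp only [tensMap_id, tensorHom_id]
    have e2 : (q a t ⊗ₘ tensorMap fun i => q (b i) (a i) ⊗ₘ
            tensorMap fun j => 𝟙 (A.carrier (f (b i j)))) ≫
          O.obj (fun i => f (a i)) (f t) ◁ tensShuffle
            (fun i => O.obj (fun j => f (b i j)) (f (a i)))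
            (fun i => tensor fun j => A.carrier (f (b i j))) (List.finRange n) =
        O'.obj a t ◁ tensShuffle (fun i => O'.obj (b i) (a i))
            (fun i => tensor fun j => A.carrier (f (b i j))) (List.finRange n) ≫
          (q a t ⊗ₘ ((tensorMap fun i => q (b i) (a i)) ⊗ₘ
            tensorMap fun i => tensorMap fun j => 𝟙 (A.carrier (f (b i j))))) := by
      rw [← id_tensorHom, ← id_tensorHom, tensorHom_comp_tensorHom, tensorHom_comp_tensorHom,
        Category.id_comp, Category.comp_id, tensShuffle_natural]
    have e3 : ((q a t ⊗ₘ tensorMap fun i => q (b i) (a i)) ⊗ₘ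
        tensorMap fun i => tensorMap fun j => 𝟙 (A.carrier (f (b i j)))) ≫
          (O.comp (f t) (fun i => f (a i)) (fun i j => f (b i j)) ⊗ₘ
            flatten fun i j => A.carrier (f (b i j))) =
        (O'.comp t a b ⊗ₘ flatten fun i j => A.carrier (f (b i j))) ≫ q (concat b) t ▷ _ := by
      rw [tensorHom_comp_tensorHom, ← hcomp, ← tensorHom_id, tensorHom_comp_tensorHom]
      simp only [tensMap_id, Category.id_comp, Category.comp_id]
    rw [reassoc_of% e1, h1, reassoc_of% e2, associator_inv_naturality_assoc, reassoc_of% e3]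
  unit c := by
    rw [← comp_whiskerRight_assoc, hone]
    exact A.unit (f c)
  equivariant σ c t := by
    have h := A.equivariant σ (fun i => f (c i)) (f t)
    have e : (O'.perm σ c t ⊗ₘ permute σ fun i => A.carrier (f (c i))) ≫ q (c ∘ σ) t ▷ _ =
        q c t ▷ _ ≫ (O.perm σ (fun i => f (c i)) (f t) ⊗ₘ
          permute σ fun i => A.carrier (f (c i))) := by
      rw [← tensorHom_id, ← tensorHom_id, tensorHom_comp_tensorHom, tensorHom_comp_tensorHom,
        hperm, Category.id_comp, Category.comp_id]
    have e' := congrArg (fun x => x ≫ A.act (fun i => f (c (σ i))) (f t)) e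
    simp only [Category.assoc] at e'
    exact e'.trans (congrArg _ h)

/-- Restriction of algebras along an operad morphism. -/
def restrict {C : Type*} {O O' : Operad C M} (φ : O' ⟶ O) (A : OperadAlgebra O) :
    OperadAlgebra O' :=
  A.pullback (fun c => c) (fun c t => Operad.Hom.app φ c t) φ.perm φ.comp φ.one

/-- The action on `A` identifies the operations related by `p`. -/
def Respects {C : Type*} {O : Operad C M} (A : OperadAlgebra O) {n : ℕ} {c : Fin n → C} {t : C}
    (p : ParallelPair (O.obj c t)) : Prop :=
  (p.tensor (.refl (tensor fun i => A.carrier (c i)))).Coequalizes (A.act c t)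

theorem respects_iff {C : Type*} {O : Operad C M} (A : OperadAlgebra O) {n : ℕ} {c : Fin n → C}
    {t : C} (p : ParallelPair (O.obj c t)) :
    A.Respects p ↔ p.fst ▷ _ ≫ A.act c t = p.snd ▷ _ ≫ A.act c t := by
  rw [← tensorHom_id, ← tensorHom_id]
  rfl

theorem Respects.perm {C : Type*} {O : Operad C M} {A : OperadAlgebra O} {n : ℕ} {c : Fin n → C}
    {t : C} {p : ParallelPair (O.obj c t)} (h : A.Respects p) (σ : Equiv.Perm (Fin n)) :
    A.Respects (p.map (O.perm σ c t)) := by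
  rw [respects_iff] at h ⊢
  have := isIso_permute σ fun i => A.carrier (c i)
  have key : ∀ l : p.src ⟶ O.obj c t, p.src ◁ (permute σ fun i => A.carrier (c i)) ≫
      (l ≫ O.perm σ c t) ▷ (tensor fun i => A.carrier (c (σ i))) ≫ A.act (c ∘ σ) t =
        l ▷ _ ≫ A.act c t := fun l => by
    have e : p.src ◁ (permute σ fun i => A.carrier (c i)) ≫
      (l ≫ O.perm σ c t) ▷ (tensor fun i => A.carrier (c (σ i))) =
        l ▷ _ ≫ (O.perm σ c t ⊗ₘ permute σ fun i => A.carrier (c i)) := by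
      rw [← id_tensorHom, ← tensorHom_id, ← tensorHom_id, tensorHom_comp_tensorHom,
        tensorHom_comp_tensorHom, Category.id_comp, Category.id_comp, Category.comp_id]
    rw [reassoc_of% e]
    exact congrArg _ (A.equivariant σ c t)
  refine (cancel_epi (p.src ◁ (permute σ fun i => A.carrier (c i)))).1 ?_
  exact (key p.fst).trans (h.trans (key p.snd).symm)

theorem Respects.comp {C : Type*} {O : Operad C M} {A : OperadAlgebra O} {n : ℕ} {k : Fin n → ℕ}
    {t : C} {a : Fin n → C} {b : ∀ i, Fin (k i) → C} {p : ParallelPair (O.obj a t)}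
    {p' : ∀ i, ParallelPair (O.obj (b i) (a i))} (h : A.Respects p) (h' : ∀ i, A.Respects (p' i)) :
    A.Respects ((p.tensor (.tens p' (List.finRange n))).map (O.comp t a b)) := by
  simp only [respects_iff] at h h' ⊢
  rw [ParallelPair.tens_eq]
  -- the source of the associativity axiom, as opposed to that of the action of a composite
  let E : p.src ⊗ tensor (fun i => (p' i).src ⊗ tensor fun j => A.carrier (b i j)) ⟶
      (p.src ⊗ tensor fun i => (p' i).src) ⊗ tensor (concat fun i j => A.carrier (b i j)) :=
    p.src ◁ tensShuffle (fun i => (p' i).src) (fun i => tensor fun j => A.carrier (b i j))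
      (List.finRange n) ≫ (α_ _ _ _).inv ≫ _ ◁ flatten fun i j => A.carrier (b i j)
  have : IsIso E := by
    have := isIso_flatten fun i j => A.carrier (b i j)
    have := isIso_tensShuffle (fun i => (p' i).src) (fun i => tensor fun j => A.carrier (b i j))
      (List.finRange n)
    infer_instance
  have key : ∀ (l : p.src ⟶ O.obj a t) (l' : ∀ i, (p' i).src ⟶ O.obj (b i) (a i)),
      E ≫ ((l ⊗ₘ tensorMap l') ≫ O.comp t a b) ▷ tensor (concat fun i j => A.carrier (b i j)) ≫
        A.act (concat b) t =
      p.src ◁ (tensorMap fun i => l' i ▷ (tensor fun j => A.carrier (b i j)) ≫ A.act (b i) (a i)) ≫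
        l ▷ _ ≫ A.act a t := fun l l' => by
    have e1 : p.src ◁ (tensorMap fun i => l' i ▷ (tensor fun j => A.carrier (b i j)) ≫
        A.act (b i) (a i)) ≫ l ▷ _ =
        (l ⊗ₘ tensorMap fun i => l' i ⊗ₘ tensorMap fun j => 𝟙 (A.carrier (b i j))) ≫
          O.obj a t ◁ tensorMap fun i => A.act (b i) (a i) := by
      rw [← id_tensorHom, ← tensorHom_id, ← id_tensorHom, tensorHom_comp_tensorHom,
        tensorHom_comp_tensorHom, Category.id_comp, Category.comp_id, Category.comp_id,
        tensMap_comp]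
      simp only [tensMap_id, tensorHom_id]
    have e2 : (l ⊗ₘ tensorMap fun i => l' i ⊗ₘ tensorMap fun j => 𝟙 (A.carrier (b i j))) ≫
          O.obj a t ◁ tensShuffle (fun i => O.obj (b i) (a i))
            (fun i => tensor fun j => A.carrier (b i j)) (List.finRange n) =
        p.src ◁ tensShuffle (fun i => (p' i).src)
            (fun i => tensor fun j => A.carrier (b i j)) (List.finRange n) ≫
          (l ⊗ₘ (tensorMap l' ⊗ₘ
            tensorMap fun i => tensorMap fun j => 𝟙 (A.carrier (b i j)))) := by
      rw [← id_tensorHom, ← id_tensorHom, tensorHom_comp_tensorHom, tensorHom_comp_tensorHom,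
        Category.id_comp, Category.comp_id, tensShuffle_natural]
    have e3 : ((l ⊗ₘ tensorMap l') ⊗ₘ
        tensorMap fun i => tensorMap fun j => 𝟙 (A.carrier (b i j))) ≫
          (O.comp t a b ⊗ₘ flatten fun i j => A.carrier (b i j)) =
        (p.src ⊗ tensor fun i => (p' i).src) ◁ (flatten fun i j => A.carrier (b i j)) ≫
          ((l ⊗ₘ tensorMap l') ≫ O.comp t a b) ▷ _ := by
      rw [tensorHom_comp_tensorHom, ← tensorHom_id, ← id_tensorHom, tensorHom_comp_tensorHom]
      simp only [tensMap_id, Category.id_comp, Category.comp_id]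
    rw [reassoc_of% e1, A.assoc, reassoc_of% e2, associator_inv_naturality_assoc, reassoc_of% e3]
    simp only [E, Category.assoc]
  -- `E` is invertible, and by `key` both sides are determined by the actions of the factors
  refine (cancel_epi E).1 ((key _ _).trans (Eq.trans ?_ (key _ _).symm))
  simp only [h, h']

end OperadAlgebra

end ChangeOfOperads

section Extension

variable {M : Type u} [Category.{v} M] [MonoidalCategory M] [SymmetricCategory M]
variable {C : Type v} {S : ∀ n : ℕ, (Fin n → C) → C → Type v} {O : Operad C M}
  {r : ∀ {n : ℕ} {c : Fin n → C} {t : C}, S n c t → ParallelPair (O.obj c t)}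

namespace OperadAlgebra

/-- An algebra that respects the generating relations respects all words in them. -/
theorem respects_word (A : OperadAlgebra O)
    (hA : ∀ {n : ℕ} {c : Fin n → C} {t : C} (s : S n c t), A.Respects (r s)) :
    ∀ {n : ℕ} {c : Fin n → C} {t : C} (w : Word S n c t), A.Respects (w.pair O r)
  | _, _, _, .refl c t => rfl
  | _, _, _, .rel s => hA s
  | _, _, _, .perm σ w => (respects_word A hA w).perm σ
  | _, _, _, .comp w ws => (respects_word A hA w).comp fun i => respects_word A hA (ws i)

variable [MonoidalClosed M] {Q : Operad C M} {π : O ⟶ Q}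

/-- The axioms of an algebra descend along componentwise epimorphisms of operads. -/
def ofEpi (hπ : ∀ {n : ℕ} (c : Fin n → C) (t : C), Epi (Operad.Hom.app π c t))
    (A : OperadAlgebra O)
    (act : ∀ {n : ℕ} (c : Fin n → C) (t : C),
      Q.obj c t ⊗ tensor (fun i => A.carrier (c i)) ⟶ A.carrier t)
    (hact : ∀ {n : ℕ} (c : Fin n → C) (t : C),
      Operad.Hom.app π c t ▷ _ ≫ act c t = A.act c t) :
    OperadAlgebra Q where
  carrier := A.carrier
  act c t := act c t
  assoc {n k} t a b := by
    let e : O.obj a t ⊗ tensor (fun i => O.obj (b i) (a i) ⊗ tensor fun j => A.carrier (b i j)) ⟶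
        Q.obj a t ⊗ tensor (fun i => Q.obj (b i) (a i) ⊗ tensor fun j => A.carrier (b i j)) :=
      Operad.Hom.app π a t ⊗ₘ tensorMap fun i => Operad.Hom.app π (b i) (a i) ⊗ₘ
        tensorMap fun j => 𝟙 (A.carrier (b i j))
    have : Epi e := by
      have := hπ a t
      have := epi_tensMap (fun i => Operad.Hom.app π (b i) (a i) ⊗ₘ
        tensorMap fun j => 𝟙 (A.carrier (b i j))) (fun i => by
          have := hπ (b i) (a i)
          have := epi_tensMap (fun j => 𝟙 (A.carrier (b i j))) (fun _ => inferInstance)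
            (List.finRange (k i))
          exact epi_tensorHom _ _) (List.finRange n)
      exact epi_tensorHom _ _
    have e1 : e ≫ Q.obj a t ◁ (tensorMap fun i => act (b i) (a i)) =
        O.obj a t ◁ (tensorMap fun i => A.act (b i) (a i)) ≫ Operad.Hom.app π a t ▷ _ := by
      rw [← id_tensorHom, ← tensorHom_id, ← id_tensorHom, tensorHom_comp_tensorHom,
        tensorHom_comp_tensorHom, Category.id_comp, Category.comp_id, Category.comp_id,
        tensMap_comp]
      simp only [tensMap_id, tensorHom_id, hact]
    have e2 : e ≫ Q.obj a t ◁ tensShuffle (fun i => Q.obj (b i) (a i))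
            (fun i => tensor fun j => A.carrier (b i j)) (List.finRange n) =
        O.obj a t ◁ tensShuffle (fun i => O.obj (b i) (a i))
            (fun i => tensor fun j => A.carrier (b i j)) (List.finRange n) ≫
          (Operad.Hom.app π a t ⊗ₘ ((tensorMap fun i => Operad.Hom.app π (b i) (a i)) ⊗ₘ
            tensorMap fun i => tensorMap fun j => 𝟙 (A.carrier (b i j)))) := by
      rw [← id_tensorHom, ← id_tensorHom, tensorHom_comp_tensorHom, tensorHom_comp_tensorHom,
        Category.id_comp, Category.comp_id, tensShuffle_natural]
    have e3 : ((Operad.Hom.app π a t ⊗ₘ tensorMap fun i => Operad.Hom.app π (b i) (a i)) ⊗ₘ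
        tensorMap fun i => tensorMap fun j => 𝟙 (A.carrier (b i j))) ≫
          (Q.comp t a b ⊗ₘ flatten fun i j => A.carrier (b i j)) =
        (O.comp t a b ⊗ₘ flatten fun i j => A.carrier (b i j)) ≫
          Operad.Hom.app π (concat b) t ▷ _ := by
      rw [tensorHom_comp_tensorHom, ← Operad.Hom.comp π, ← tensorHom_id, tensorHom_comp_tensorHom]
      simp only [tensMap_id, Category.id_comp, Category.comp_id]
    rw [← cancel_epi e, reassoc_of% e1, hact, reassoc_of% e2, associator_inv_naturality_assoc,
      reassoc_of% e3, hact, A.assoc]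
  unit c := by
    rw [← Operad.Hom.one π, comp_whiskerRight, Category.assoc]
    exact (congrArg _ (hact _ _)).trans (A.unit c)
  equivariant σ c t := by
    have := hπ c t
    have := epi_whiskerRight (Operad.Hom.app π c t) (tensor fun i => A.carrier (c i))
    have e : Operad.Hom.app π c t ▷ (tensor fun i => A.carrier (c i)) ≫
        (Q.perm σ c t ⊗ₘ permute σ fun i => A.carrier (c i)) =
        (O.perm σ c t ⊗ₘ permute σ fun i => A.carrier (c i)) ≫
          Operad.Hom.app π (c ∘ σ) t ▷ _ := by
      rw [← tensorHom_id, ← tensorHom_id, tensorHom_comp_tensorHom, tensorHom_comp_tensorHom,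
        Operad.Hom.perm π, Category.id_comp, Category.comp_id]
    rw [← cancel_epi (Operad.Hom.app π c t ▷ (tensor fun i => A.carrier (c i))), reassoc_of% e,
      hact]
    exact (congrArg _ (hact _ _)).trans (A.equivariant σ c t)

/-- The extension of an algebra that respects the generating relations to the quotient operad. -/
noncomputable def extend
    (hπ : ∀ {n : ℕ} (c : Fin n → C) (t : C),
      IsJointCoequalizer (fun w : Word S n c t => w.pair O r) (Operad.Hom.app π c t))
    (A : OperadAlgebra O)
    (hA : ∀ {n : ℕ} {c : Fin n → C} {t : C} (s : S n c t), A.Respects (r s)) :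
    OperadAlgebra Q :=
  A.ofEpi (fun c t => (hπ c t).epi)
    (fun c t => ((hπ c t).whiskerRight _).desc (A.act c t) (A.respects_word hA))
    (fun c t => ((hπ c t).whiskerRight _).fac (A.act c t) (A.respects_word hA))

theorem app_extend_act
    (hπ : ∀ {n : ℕ} (c : Fin n → C) (t : C),
      IsJointCoequalizer (fun w : Word S n c t => w.pair O r) (Operad.Hom.app π c t))
    (A : OperadAlgebra O)
    (hA : ∀ {n : ℕ} {c : Fin n → C} {t : C} (s : S n c t), A.Respects (r s)) {n : ℕ}
    (c : Fin n → C) (t : C) :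
    Operad.Hom.app π c t ▷ (tensor fun i => A.carrier (c i)) ≫ (A.extend hπ hA).act c t =
      A.act c t :=
  ((hπ c t).whiskerRight _).fac (A.act c t) (A.respects_word hA)

end OperadAlgebra
end Extension

/-! ### Algebras over the auxiliary operad as functors -/

section AlgebraMorphisms

variable {M : Type u} [Category.{v} M] [MonoidalCategory M] [SymmetricCategory M]

namespace OperadAlgebra

theorem eq_of_act {C : Type*} {O : Operad C M} {A B : OperadAlgebra O}
    (hc : A.carrier = B.carrier)
    (h : ∀ (n : ℕ) (c : Fin n → C) (t : C), HEq (A.act c t) (B.act c t)) : A = B := by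
  obtain ⟨X, a, _, _, _⟩ := A
  obtain ⟨Y, b, _, _, _⟩ := B
  obtain rfl : X = Y := hc
  have e : @a = @b := by
    funext n c t
    exact eq_of_heq (h n c t)
  subst e
  rfl

theorem hom_heq {C : Type*} {O : Operad C M} {A A' B B' : OperadAlgebra O} (hA : A = A')
    (hB : B = B') {f : A ⟶ B} {g : A' ⟶ B'} (h : ∀ c, HEq (Hom.app f c) (Hom.app g c)) :
    HEq f g := by
  subst hA hB
  exact heq_of_eq (Hom.ext (funext fun c => eq_of_heq (h c)))

/-- Restriction along an operad morphism does not change the components of morphisms. -/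
def restrictFunctor {C : Type*} {O O' : Operad C M} (φ : O' ⟶ O) :
    OperadAlgebra O ⥤ OperadAlgebra O' where
  obj A := A.restrict φ
  map {A B} κ :=
    ({ app := fun c => Hom.app κ c
       act := fun c t => by
        have e1 := congrArg (fun x => Operad.Hom.app φ c t ▷ _ ≫ x) (Hom.act κ c t)
        have e2 := whisker_exchange_assoc (Operad.Hom.app φ c t)
          (tensorMap fun i => Hom.app κ (c i)) (B.act c t)
        exact (Category.assoc _ _ _).trans (e1.trans e2.symm) } : Hom (A.restrict φ) (B.restrict φ))

theorem unary_naturality {C : Type*} {O : Operad C M} {A B : OperadAlgebra O} (κ : A ⟶ B)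
    {s t : C} (u : 𝟙_ M ⟶ O.obj (fun _ : Fin 1 => s) t) :
    A.unary u ≫ Hom.app κ t = Hom.app κ s ≫ B.unary u := by
  have e : Hom.app κ s ≫ (tensorOne fun _ => B.carrier s).inv =
      (tensorOne fun _ => A.carrier s).inv ≫ tensorMap fun _ : Fin 1 => Hom.app κ s := by
    rw [Iso.eq_inv_comp, ← Category.assoc, Iso.comp_inv_eq]
    exact (tensorOne_natural fun _ : Fin 1 => Hom.app κ s).symm
  have e1 : (u ⊗ₘ (tensorOne fun _ => A.carrier s).inv) ≫
      O.obj (fun _ : Fin 1 => s) t ◁ tensorMap (fun _ : Fin 1 => Hom.app κ s) =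
        𝟙_ M ◁ Hom.app κ s ≫ (u ⊗ₘ (tensorOne fun _ => B.carrier s).inv) := by
    rw [← id_tensorHom, ← id_tensorHom, tensorHom_comp_tensorHom, tensorHom_comp_tensorHom, e,
      Category.id_comp, Category.comp_id]
  unfold unary
  rw [Category.assoc, Category.assoc, Hom.act κ, reassoc_of% e1, leftUnitor_inv_naturality_assoc]

end OperadAlgebra

end AlgebraMorphisms

namespace IsAux

variable {M : Type u} [Category.{v} M] [MonoidalCategory M] [SymmetricCategory M]
variable {C : Type v} [SmallCategory C] {P : Operad Unit M} {D : Operad C M}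
  {ι : ∀ {n : ℕ} (c : Fin n → C) (t : C) (_ : ∀ i, c i ⟶ t),
    P.obj (fun _ : Fin n => ()) () ⟶ D.obj c t}

/-- The unary operation of the auxiliary operad given by a morphism of `C`. -/
def unaryOp (_ : IsAux P D.toOperadData ι) {s t : C} (f : s ⟶ t) :
    𝟙_ M ⟶ D.obj (fun _ : Fin 1 => s) t :=
  P.one () ≫ ι (fun _ : Fin 1 => s) t fun _ => f

section ToFunctor

variable (h : IsAux P D.toOperadData ι) (A : OperadAlgebra D)

theorem ι_act_unary {n : ℕ} {c : Fin n → C} {s t : C} (f : ∀ i, c i ⟶ s) (g : s ⟶ t) :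
    ι c s f ▷ _ ≫ A.act c s ≫ A.unary (h.unaryOp g) = ι c t (fun i => f i ≫ g) ▷ _ ≫ A.act c t := by
  have e := h.ι_postComp g (P.one ()) c f
  rw [P.postComp_one] at e
  rw [A.act_postComp, ← comp_whiskerRight_assoc]
  exact congrArg (fun x => x ▷ _ ≫ A.act c t) (e.trans (Category.id_comp _))

theorem tensorMap_unary_ι_act {n : ℕ} {c a : Fin n → C} {t : C} (g : ∀ i, c i ⟶ a i)
    (f : ∀ i, a i ⟶ t) :
    P.obj (fun _ : Fin n => ()) () ◁ (tensorMap fun i => A.unary (h.unaryOp (g i))) ≫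
        ι a t f ▷ _ ≫ A.act a t =
      ι c t (fun i => g i ≫ f i) ▷ _ ≫ A.act c t := by
  have e := h.ι_preComp g (fun _ => P.one ()) f
  have hP := P.preComp_one (fun _ : Fin n => ()) ()
  rw [hP] at e
  rw [whisker_exchange_assoc, A.act_preComp, ← comp_whiskerRight_assoc]
  exact congrArg (fun x => x ▷ _ ≫ A.act c t) (e.trans (Category.id_comp _))

theorem unary_unaryOp_id (t : C) : A.unary (h.unaryOp (𝟙 t)) = 𝟙 (A.carrier t) := by
  have e : h.unaryOp (𝟙 t) = D.one t := (h.one t).symm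
  rw [e, OperadAlgebra.unary, MonoidalCategory.tensorHom_def', Category.assoc, A.unit]
  simp

theorem unary_unaryOp_comp {s t t' : C} (f : s ⟶ t) (g : t ⟶ t') :
    A.unary (h.unaryOp (f ≫ g)) = A.unary (h.unaryOp f) ≫ A.unary (h.unaryOp g) := by
  have e := h.ι_act_unary A (fun _ : Fin 1 => f) g
  have e' : ∀ {t : C} (k : s ⟶ t), (h.unaryOp k ⊗ₘ (tensorOne fun _ => A.carrier s).inv) =
      (P.one () ⊗ₘ (tensorOne fun _ => A.carrier s).inv) ≫
        ι (fun _ : Fin 1 => s) t (fun _ => k) ▷ _ := fun k => by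
    rw [← tensorHom_id, tensorHom_comp_tensorHom, Category.comp_id]
    rfl
  rw [OperadAlgebra.unary, e', OperadAlgebra.unary, e']
  simp only [Category.assoc]
  rw [e]

end ToFunctor

/-- The functor `C ⥤ Alg_P` determined by an algebra over the auxiliary operad: `P` acts through
the summands of identities, and the morphisms of `C` act as unary operations. -/
def toFunctor (h : IsAux P D.toOperadData ι) (A : OperadAlgebra D) : C ⥤ OperadAlgebra P where
  obj t := A.pullback (fun _ : Unit => t)
    (fun {n} _ _ => ι (fun _ : Fin n => t) t fun _ => 𝟙 t)
    (fun {n} σ _ _ => (h.perm σ (fun _ => t) t fun _ => 𝟙 t).symm)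
    (fun {n k} _ _ _ => by
      refine Eq.trans ?_ (h.comp t (fun _ : Fin n => t) (fun i (_ : Fin (k i)) => t)
        (fun _ => 𝟙 t) fun _ _ => 𝟙 t).symm
      have e : (compTuple (fun _ : Fin n => 𝟙 t) fun i (_ : Fin (k i)) => 𝟙 t) = fun _ => 𝟙 t :=
        funext fun _ => Category.id_comp _
      rw [e])
    (fun _ => (h.one t).symm)
  map {s t} f :=
    ({ app := fun _ => A.unary (h.unaryOp f)
       act := fun {n} _ _ => by
        have h1 := h.ι_act_unary A (fun _ : Fin n => 𝟙 s) f
        have h2 := h.tensorMap_unary_ι_act A (fun _ : Fin n => f) (fun _ : Fin n => 𝟙 t)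
        simp only [Category.id_comp, Category.comp_id] at h1 h2
        exact (Category.assoc _ _ _).trans (h1.trans h2.symm) } :
      OperadAlgebra.Hom (A.pullback (fun _ : Unit => s) _ _ _ _)
        (A.pullback (fun _ : Unit => t) _ _ _ _))
  map_id t := OperadAlgebra.Hom.ext (funext fun _ => h.unary_unaryOp_id A t)
  map_comp f g := OperadAlgebra.Hom.ext (funext fun _ => h.unary_unaryOp_comp A f g)

/-- The passage from algebras over the auxiliary operad to functors `C ⥤ Alg_P`. -/
def toFunctorFunctor (h : IsAux P D.toOperadData ι) :
    OperadAlgebra D ⥤ (C ⥤ OperadAlgebra P) where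
  obj A := h.toFunctor A
  map {A B} κ :=
    { app := fun t =>
        ({ app := fun _ => OperadAlgebra.Hom.app κ t
           act := fun {n} _ _ => by
            have e1 := congrArg (fun x => ι (fun _ : Fin n => t) t (fun _ => 𝟙 t) ▷ _ ≫ x)
              (OperadAlgebra.Hom.act κ (fun _ : Fin n => t) t)
            have e2 := whisker_exchange_assoc (ι (fun _ : Fin n => t) t fun _ => 𝟙 t)
              (tensorMap fun _ : Fin n => OperadAlgebra.Hom.app κ t) (B.act (fun _ => t) t)
            exact (Category.assoc _ _ _).trans (e1.trans e2.symm) } :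
          OperadAlgebra.Hom ((h.toFunctor A).obj t) ((h.toFunctor B).obj t))
      naturality := fun s t f => OperadAlgebra.Hom.ext (funext fun _ =>
        OperadAlgebra.unary_naturality κ (h.unaryOp f)) }

section OfFunctor

variable [MonoidalClosed M] (h : IsAux P D.toOperadData ι) (F : C ⥤ OperadAlgebra P)

/-- The action of the auxiliary operad on a functor `C ⥤ Alg_P`. An operation in the summand of
`f = (f₁, …, fₙ)` acts by the `F(fᵢ)`, followed by the action of `P`. -/
noncomputable def functorAct {n : ℕ} (c : Fin n → C) (t : C) :
    D.obj c t ⊗ tensor (fun i => (F.obj (c i)).carrier ()) ⟶ (F.obj t).carrier () :=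
  ((h.isCoprod c t).whiskerRight _).desc fun f =>
    P.obj (fun _ : Fin n => ()) () ◁ (tensorMap fun i => OperadAlgebra.Hom.app (F.map (f i)) ()) ≫
      (F.obj t).act (fun _ => ()) ()

theorem ι_functorAct {n : ℕ} {c : Fin n → C} {t : C} (f : ∀ i, c i ⟶ t) :
    ι c t f ▷ _ ≫ h.functorAct F c t =
      P.obj (fun _ : Fin n => ()) () ◁
        (tensorMap fun i => OperadAlgebra.Hom.app (F.map (f i)) ()) ≫
          (F.obj t).act (fun _ => ()) () :=
  ((h.isCoprod c t).whiskerRight _).fac _ f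

/-- The algebra over the auxiliary operad determined by a functor `C ⥤ Alg_P`. -/
noncomputable def ofFunctor : OperadAlgebra D where
  carrier c := (F.obj c).carrier ()
  act c t := h.functorAct F c t
  assoc {n k} t a b := by
    apply ((h.isCoprod a t).tensorHom (IsCoprod.tensorMap fun i =>
      (h.isCoprod (b i) (a i)).whiskerRight
        (tensor fun j => (F.obj (b i j)).carrier ()))).hom_ext
    rintro ⟨f, g⟩
    dsimp only
    -- the composites `b i j ⟶ a i ⟶ t`, as acting on the components of `F`
    let ψ : ∀ i j, (F.obj (b i j)).carrier () ⟶ (F.obj t).carrier () := fun i j =>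
      OperadAlgebra.Hom.app (F.map (g i j ≫ f i)) ()
    have e0 : ∀ i, (ι (b i) (a i) (g i) ▷ _ ≫ h.functorAct F (b i) (a i)) ≫
        OperadAlgebra.Hom.app (F.map (f i)) () =
          P.obj (fun _ : Fin (k i) => ()) () ◁ tensorMap (ψ i) ≫
            (F.obj t).act (fun _ => ()) () := fun i => by
      rw [ι_functorAct, Category.assoc, OperadAlgebra.Hom.act (F.map (f i)),
        ← MonoidalCategory.whiskerLeft_comp_assoc, tensMap_comp]
      simp only [ψ, F.map_comp]
      rfl
    have e1 : (ι a t f ⊗ₘ tensorMap fun i => ι (b i) (a i) (g i) ▷ _) ≫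
        D.obj a t ◁ (tensorMap fun i => h.functorAct F (b i) (a i)) =
        P.obj (fun _ : Fin n => ()) () ◁ (tensorMap fun i =>
          ι (b i) (a i) (g i) ▷ _ ≫ h.functorAct F (b i) (a i)) ≫ ι a t f ▷ _ := by
      rw [← id_tensorHom, ← tensorHom_id, ← id_tensorHom, tensorHom_comp_tensorHom,
        tensorHom_comp_tensorHom, Category.id_comp, Category.comp_id, Category.comp_id,
        tensMap_comp]
    have e2 : (ι a t f ⊗ₘ tensorMap fun i => ι (b i) (a i) (g i) ⊗ₘ
          tensorMap fun j => 𝟙 ((F.obj (b i j)).carrier ())) ≫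
          D.obj a t ◁ tensShuffle (fun i => D.obj (b i) (a i))
            (fun i => tensor fun j => (F.obj (b i j)).carrier ()) (List.finRange n) =
        P.obj (fun _ : Fin n => ()) () ◁ tensShuffle (fun i => P.obj (fun _ : Fin (k i) => ()) ())
            (fun i => tensor fun j => (F.obj (b i j)).carrier ()) (List.finRange n) ≫
          (ι a t f ⊗ₘ ((tensorMap fun i => ι (b i) (a i) (g i)) ⊗ₘ
            tensorMap fun i => tensorMap fun j => 𝟙 ((F.obj (b i j)).carrier ()))) := by
      rw [← id_tensorHom, ← id_tensorHom, tensorHom_comp_tensorHom, tensorHom_comp_tensorHom,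
        Category.id_comp, Category.comp_id, tensShuffle_natural]
    have e3 : ((ι a t f ⊗ₘ tensorMap fun i => ι (b i) (a i) (g i)) ⊗ₘ
        tensorMap fun i => tensorMap fun j => 𝟙 ((F.obj (b i j)).carrier ())) ≫
          (D.comp t a b ⊗ₘ flatten fun i j => (F.obj (b i j)).carrier ()) =
        (P.comp () (fun _ => ()) (fun _ _ => ()) ⊗ₘ
          flatten fun i j => (F.obj (b i j)).carrier ()) ≫
            ι (concat b) t (compTuple f g) ▷ _ := by
      rw [tensorHom_comp_tensorHom, h.comp, ← tensorHom_id, tensorHom_comp_tensorHom]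
      simp only [tensMap_id, Category.id_comp, Category.comp_id]
    have e4 : P.obj (fun _ : Fin n => ()) () ◁ (tensorMap fun i =>
        P.obj (fun _ : Fin (k i) => ()) () ◁ tensorMap (ψ i)) ≫
          P.obj (fun _ : Fin n => ()) () ◁
            tensShuffle (fun i => P.obj (fun _ : Fin (k i) => ()) ())
              (fun i => tensor fun _ : Fin (k i) => (F.obj t).carrier ()) (List.finRange n) =
        P.obj (fun _ : Fin n => ()) () ◁
            tensShuffle (fun i => P.obj (fun _ : Fin (k i) => ()) ())
              (fun i => tensor fun j => (F.obj (b i j)).carrier ()) (List.finRange n) ≫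
          (𝟙 (P.obj (fun _ : Fin n => ()) ()) ⊗ₘ
            (𝟙 (tensor fun i => P.obj (fun _ : Fin (k i) => ()) ()) ⊗ₘ
              tensorMap fun i => tensorMap (ψ i))) := by
      have := tensShuffle_natural (fun i => 𝟙 (P.obj (fun _ : Fin (k i) => ()) ()))
        (fun i => tensorMap (ψ i)) (List.finRange n)
      simp only [id_tensorHom, tensMap_id] at this ⊢
      rw [← MonoidalCategory.whiskerLeft_comp, ← MonoidalCategory.whiskerLeft_comp, this]
    have e5 : ((𝟙 (P.obj (fun _ : Fin n => ()) ()) ⊗ₘ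
        𝟙 (tensor fun i => P.obj (fun _ : Fin (k i) => ()) ())) ⊗ₘ
          tensorMap fun i => tensorMap (ψ i)) ≫
            (P.comp () (fun _ => ()) (fun _ _ => ()) ⊗ₘ
              flatten fun i (_ : Fin (k i)) => (F.obj t).carrier ()) =
        (P.comp () (fun _ => ()) (fun _ _ => ()) ⊗ₘ
          flatten fun i j => (F.obj (b i j)).carrier ()) ≫ _ ◁ tensorMap fun p =>
            ψ (finSigmaFinEquiv.symm p).1 (finSigmaFinEquiv.symm p).2 := by
      rw [tensorHom_comp_tensorHom, flatten_natural, ← id_tensorHom, tensorHom_comp_tensorHom,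
        id_tensorHom_id, Category.id_comp, Category.comp_id]
    have hP := (F.obj t).assoc () (fun _ : Fin n => ()) (fun i (_ : Fin (k i)) => ())
    rw [reassoc_of% e1, ι_functorAct, ← MonoidalCategory.whiskerLeft_comp_assoc, tensMap_comp]
    simp only [e0]
    rw [← tensMap_comp, MonoidalCategory.whiskerLeft_comp_assoc]
    refine (congrArg _ hP).trans ?_
    simp only [tensMap_id, tensorHom_id] at e2 e3
    rw [reassoc_of% e4, associator_inv_naturality_assoc, reassoc_of% e5, reassoc_of% e2]
    rw [← tensorHom_id, associator_inv_naturality_assoc, tensorHom_id, reassoc_of% e3]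
    exact congrArg (fun x => _ ≫ _ ≫ _ ≫ x) (h.ι_functorAct F (compTuple f g)).symm
  unit c := by
    have hid : OperadAlgebra.Hom.app (F.map (𝟙 c)) () = 𝟙 ((F.obj c).carrier ()) := by
      rw [F.map_id]
      rfl
    have e := h.ι_functorAct F (fun _ : Fin 1 => 𝟙 c)
    simp only [hid, tensMap_id, MonoidalCategory.whiskerLeft_id, Category.id_comp] at e
    rw [h.one, comp_whiskerRight, Category.assoc, e]
    exact (F.obj c).unit ()
  equivariant {n} σ c t := by
    apply ((h.isCoprod c t).whiskerRight _).hom_ext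
    intro f
    have e : ι c t f ▷ (tensor fun i => (F.obj (c i)).carrier ()) ≫ (D.perm σ c t ⊗ₘ
        permute σ fun i => (F.obj (c i)).carrier ()) =
          (P.perm σ (fun _ => ()) () ⊗ₘ permute σ fun i => (F.obj (c i)).carrier ()) ≫
            ι (c ∘ σ) t (fun i => f (σ i)) ▷ _ := by
      rw [← tensorHom_id, ← tensorHom_id, tensorHom_comp_tensorHom, tensorHom_comp_tensorHom,
        h.perm, Category.id_comp, Category.comp_id]
    rw [ι_functorAct, reassoc_of% e]
    refine (congrArg _ (h.ι_functorAct F fun i => f (σ i))).trans ?_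
    have e' : (P.perm σ (fun _ => ()) () ⊗ₘ permute σ fun i => (F.obj (c i)).carrier ()) ≫
        P.obj (fun _ : Fin n => ()) () ◁
          (tensorMap fun i => OperadAlgebra.Hom.app (F.map (f (σ i))) ()) =
        P.obj (fun _ : Fin n => ()) () ◁
          (tensorMap fun i => OperadAlgebra.Hom.app (F.map (f i)) ()) ≫
        (P.perm σ (fun _ => ()) () ⊗ₘ permute σ fun _ => (F.obj t).carrier ()) := by
      have := permute_natural σ fun i => OperadAlgebra.Hom.app (F.map (f i)) ()
      rw [← id_tensorHom, ← id_tensorHom]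
      refine (tensorHom_comp_tensorHom _ _ _ _).trans ?_
      rw [tensorHom_comp_tensorHom, this, Category.id_comp]
      exact congrArg (fun x => x ⊗ₘ _) (Category.comp_id _)
    rw [reassoc_of% e']
    exact congrArg _ ((F.obj t).equivariant σ (fun _ => ()) ())

end OfFunctor

end IsAux

/-! ### Functors and the relations of orthogonal pairs -/

namespace IsAux

variable {M : Type u} [Category.{v} M] [MonoidalCategory M] [SymmetricCategory M]
variable {C : Type v} [SmallCategory C] {P : Operad Unit M} {D : Operad C M}
  {ι : ∀ {n : ℕ} (c : Fin n → C) (t : C) (_ : ∀ i, c i ⟶ t),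
    P.obj (fun _ : Fin n => ()) () ⟶ D.obj c t}

/-- The two ways to precompose a binary operation `p` of `P` with morphisms `f 0` and `f 1` agree:
by the action on the target, and by the operation in the summand of `f`. -/
theorem binary_toFunctor (h : IsAux P D.toOperadData ι) (A : OperadAlgebra D)
    (p : 𝟙_ M ⟶ P.obj (fun _ : Fin 2 => ()) ()) {c : Fin 2 → C} {t : C} (f : ∀ i, c i ⟶ t) :
    (p ⊗ₘ (OperadAlgebra.Hom.app ((h.toFunctor A).map (f 0)) () ⊗ₘ
        OperadAlgebra.Hom.app ((h.toFunctor A).map (f 1)) ())) ≫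
      _ ◁ tensorTwo (fun _ : Fin 2 => ((h.toFunctor A).obj t).carrier ()) ≫
        ((h.toFunctor A).obj t).act (fun _ => ()) () =
    𝟙_ M ◁ tensorTwo (fun i => A.carrier (c i)) ≫ (p ≫ ι c t f) ▷ _ ≫ A.act c t := by
  have e := h.tensorMap_unary_ι_act A f (fun _ : Fin 2 => 𝟙 t)
  simp only [Category.comp_id] at e
  have e2 : (A.unary (h.unaryOp (f 0)) ⊗ₘ A.unary (h.unaryOp (f 1))) ≫
      tensorTwo (fun _ : Fin 2 => A.carrier t) =
        tensorTwo (fun i => A.carrier (c i)) ≫ tensorMap fun i => A.unary (h.unaryOp (f i)) := by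
    change _ ≫ _ ◁ (ρ_ _).inv = (_ ◁ (ρ_ _).inv) ≫ (A.unary (h.unaryOp (f 0)) ⊗ₘ
      (A.unary (h.unaryOp (f 1)) ⊗ₘ 𝟙 (𝟙_ M)))
    rw [← id_tensorHom, ← id_tensorHom, tensorHom_comp_tensorHom, tensorHom_comp_tensorHom,
      tensorHom_id, rightUnitor_inv_naturality, Category.id_comp, Category.comp_id]
  have e3 : (p ⊗ₘ (A.unary (h.unaryOp (f 0)) ⊗ₘ A.unary (h.unaryOp (f 1)))) ≫
      P.obj (fun _ : Fin 2 => ()) () ◁ tensorTwo (fun _ : Fin 2 => A.carrier t) =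
      𝟙_ M ◁ tensorTwo (fun i => A.carrier (c i)) ≫ p ▷ _ ≫
        P.obj (fun _ : Fin 2 => ()) () ◁ tensorMap fun i => A.unary (h.unaryOp (f i)) := by
    rw [← MonoidalCategory.tensorHom_def, ← id_tensorHom, ← id_tensorHom,
      tensorHom_comp_tensorHom, tensorHom_comp_tensorHom, e2, Category.comp_id, Category.id_comp]
  change (p ⊗ₘ (A.unary (h.unaryOp (f 0)) ⊗ₘ A.unary (h.unaryOp (f 1)))) ≫
    P.obj (fun _ : Fin 2 => ()) () ◁ tensorTwo (fun _ : Fin 2 => A.carrier t) ≫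
      ι (fun _ : Fin 2 => t) t (fun _ => 𝟙 t) ▷ _ ≫ A.act (fun _ => t) t = _
  rw [reassoc_of% e3, comp_whiskerRight_assoc, ← e]

variable [MonoidalClosed M]

/-- The components of a natural transformation are compatible with the actions of the auxiliary
operad. -/
noncomputable def ofFunctorFunctor (h : IsAux P D.toOperadData ι) :
    (C ⥤ OperadAlgebra P) ⥤ OperadAlgebra D where
  obj F := h.ofFunctor F
  map {F G} η :=
    ({ app := fun c => OperadAlgebra.Hom.app (η.app c) ()
       act := fun {n} c t => by
        apply ((h.isCoprod c t).whiskerRight _).hom_ext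
        intro f
        have e1 := h.ι_functorAct F f
        have e2 := h.ι_functorAct G f
        have hη : ∀ i, OperadAlgebra.Hom.app (F.map (f i)) () ≫ OperadAlgebra.Hom.app (η.app t) () =
            OperadAlgebra.Hom.app (η.app (c i)) () ≫ OperadAlgebra.Hom.app (G.map (f i)) () :=
          fun i => congrArg (fun κ => OperadAlgebra.Hom.app κ ()) (η.naturality (f i))
        have e3 := OperadAlgebra.Hom.act (η.app t) (fun _ : Fin n => ()) ()
        have e4 : (tensorMap fun i => OperadAlgebra.Hom.app (F.map (f i)) ()) ≫
            (tensorMap fun _ : Fin n => OperadAlgebra.Hom.app (η.app t) ()) =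
              (tensorMap fun i => OperadAlgebra.Hom.app (η.app (c i)) ()) ≫
                tensorMap fun i => OperadAlgebra.Hom.app (G.map (f i)) () := by
          rw [tensMap_comp, tensMap_comp]
          simp only [hη]
        change ι c t f ▷ _ ≫ h.functorAct F c t ≫ _ =
          ι c t f ▷ _ ≫ (D.obj c t ◁ tensorMap fun i => OperadAlgebra.Hom.app (η.app (c i)) ()) ≫
            h.functorAct G c t
        rw [reassoc_of% e1, e3, ← MonoidalCategory.whiskerLeft_comp_assoc, e4,
          MonoidalCategory.whiskerLeft_comp_assoc, ← e2, whisker_exchange_assoc] } :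
      OperadAlgebra.Hom (h.ofFunctor F) (h.ofFunctor G))

/-- An operation in the summand of `f` is obtained from the one in the summand of the identities by
precomposition with the unary operations of the `f i`, so the action is recovered. -/
theorem ofFunctor_toFunctor (h : IsAux P D.toOperadData ι) (A : OperadAlgebra D) :
    h.ofFunctor (h.toFunctor A) = A := by
  refine OperadAlgebra.eq_of_act rfl fun n c t => heq_of_eq ?_
  apply ((h.isCoprod c t).whiskerRight _).hom_ext
  intro f
  -- `f i = f i ≫ 𝟙 t`
  have e := h.tensorMap_unary_ι_act A f (fun _ : Fin n => 𝟙 t)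
  simp only [Category.comp_id] at e
  exact (h.ι_functorAct (h.toFunctor A) f).trans e

theorem toFunctor_ofFunctor (h : IsAux P D.toOperadData ι) (F : C ⥤ OperadAlgebra P) :
    h.toFunctor (h.ofFunctor F) = F := by
  have hobj : ∀ t, (h.toFunctor (h.ofFunctor F)).obj t = F.obj t := fun t => by
    refine OperadAlgebra.eq_of_act rfl fun n _ _ => heq_of_eq ?_
    refine (h.ι_functorAct F fun _ : Fin n => 𝟙 t).trans ?_
    have hid : OperadAlgebra.Hom.app (F.map (𝟙 t)) () = 𝟙 ((F.obj t).carrier ()) := by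
      rw [F.map_id]
      rfl
    simp only [hid, tensMap_id, MonoidalCategory.whiskerLeft_id, Category.id_comp]
  refine Functor.hext hobj fun s t f => ?_
  refine OperadAlgebra.hom_heq (hobj s) (hobj t) fun _ => heq_of_eq ?_
  have e1 : (h.unaryOp f ⊗ₘ (tensorOne fun _ => (F.obj s).carrier ()).inv) =
      (P.one () ⊗ₘ (tensorOne fun _ => (F.obj s).carrier ()).inv) ≫
        ι (fun _ : Fin 1 => s) t (fun _ => f) ▷ _ := by
    rw [← tensorHom_id, tensorHom_comp_tensorHom, Category.comp_id]
    rfl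
  have e2 := h.ι_functorAct F (fun _ : Fin 1 => f)
  have e3 : (tensorOne fun _ => (F.obj s).carrier ()).inv ≫
      (tensorMap fun _ : Fin 1 => OperadAlgebra.Hom.app (F.map f) ()) =
        OperadAlgebra.Hom.app (F.map f) () ≫ (tensorOne fun _ => (F.obj t).carrier ()).inv := by
    rw [Iso.inv_comp_eq, ← Category.assoc, Iso.eq_comp_inv]
    exact tensorOne_natural fun _ : Fin 1 => OperadAlgebra.Hom.app (F.map f) ()
  change (λ_ _).inv ≫ (h.unaryOp f ⊗ₘ (tensorOne fun _ => (F.obj s).carrier ()).inv) ≫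
    h.functorAct F (fun _ : Fin 1 => s) t = OperadAlgebra.Hom.app (F.map f) ()
  rw [e1, Category.assoc, e2, MonoidalCategory.tensorHom_def, Category.assoc,
    ← MonoidalCategory.whiskerLeft_comp_assoc, e3, ← whisker_exchange_assoc,
    (F.obj t).unit ()]
  simp

end IsAux

section Relations

variable {M : Type u} [Category.{v} M] [MonoidalCategory M] [SymmetricCategory M] [HasColimits M]
variable {C : Type v} [SmallCategory C] (perp : OrthogonalityRelation C)

/-- The orthogonal pairs of morphisms, as a family of sets that is empty except in arity two. -/
inductive OrthogonalPair : ∀ n : ℕ, (Fin n → C) → C → Type v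
  | mk {c : Fin 2 → C} {t : C} (f : ∀ i, c i ⟶ t) (hf : perp.perp (f 0) (f 1)) :
      OrthogonalPair 2 c t

variable {perp} [MonoidalClosed M] (P : BipointedOperad M)

/-- The relation between the two points of `P` in the summand of an orthogonal pair. -/
noncomputable def OrthogonalPair.relation : ∀ {n : ℕ} {c : Fin n → C} {t : C},
    OrthogonalPair perp n c t → ParallelPair ((auxOperad C P.operad).obj c t)
  | _, _, _, .mk f _ => ⟨𝟙_ M, point P.r₁ ≫ auxι P.operad.toOperadData f,
      point P.r₂ ≫ auxι P.operad.toOperadData f⟩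

/-- Equality of the composites out of the family of coproducts `R_⊥` may be checked on each
orthogonal pair. -/
theorem relMap_comp_eq_iff {Q : Operad C M} (φ : auxOperad C P.operad ⟶ Q) :
    relMap perp P.r₁ ≫ (forgetToSeq C M).map φ = relMap perp P.r₂ ≫ (forgetToSeq C M).map φ ↔
      ∀ {n : ℕ} {c : Fin n → C} {t : C} (s : OrthogonalPair perp n c t),
        (s.relation P).Coequalizes (Operad.Hom.app φ c t) := by
  have key : ∀ {c : Fin 2 → C} {t : C}
      (f : {f : ∀ i : Fin 2, c i ⟶ t // perp.perp (f 0) (f 1)})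
      (r : unitSeqTwo M ⟶ (forgetToSeq Unit M).obj P.operad),
      Sigma.ι (fun _ : {f : ∀ i : Fin 2, c i ⟶ t // perp.perp (f 0) (f 1)} => 𝟙_ M) f ≫
          (relMap perp r ≫ (forgetToSeq C M).map φ) 2 c t =
        (point r ≫ auxι P.operad.toOperadData f.1) ≫ Operad.Hom.app φ c t := by
    intro c t f r
    have e := Sigma.ι_desc
      (f := fun _ : {f : ∀ i : Fin 2, c i ⟶ t // perp.perp (f 0) (f 1)} => 𝟙_ M)
      (fun f => point r ≫ auxι P.operad.toOperadData f.1) f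
    exact (Category.assoc _ _ _).symm.trans (congrArg (fun x => x ≫ Operad.Hom.app φ c t) e)
  constructor
  · intro e n c t s
    obtain @⟨c, t, f, hf⟩ := s
    have e1 := congrFun (congrFun (congrFun e 2) c) t
    exact (key ⟨f, hf⟩ P.r₁).symm.trans ((congrArg _ e1).trans (key ⟨f, hf⟩ P.r₂))
  · intro e
    funext n c t
    match n with
    | 0 => exact initial.hom_ext _ _
    | 1 => exact initial.hom_ext _ _
    | n + 3 => exact initial.hom_ext _ _
    | 2 =>
      apply Sigma.hom_ext
      intro f
      exact (key f P.r₁).trans ((e (.mk f.1 f.2)).trans (key f P.r₂).symm)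

instance isIso_tensorTwo (X : Fin 2 → M) : IsIso (tensorTwo X) := by
  change IsIso (X 0 ◁ (ρ_ (X 1)).inv)
  exact MonoidalCategory.whiskerLeft_isIso _ _

/-- An algebra over the auxiliary operad satisfies the relations of the orthogonal pairs exactly
when the corresponding functor is a field theory. -/
theorem respects_relation_iff (A : OperadAlgebra (auxOperad C P.operad)) :
    (∀ {n : ℕ} {c : Fin n → C} {t : C} (s : OrthogonalPair perp n c t),
      A.Respects (s.relation P)) ↔
    IsFieldTheory perp P ((auxData_isAux P.operad).toFunctor (D := auxOperad C P.operad) A) := by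
  have key {c : Fin 2 → C} {t : C} (f : ∀ i, c i ⟶ t) (hf : perp.perp (f 0) (f 1)) :=
    (OperadAlgebra.respects_iff A ((OrthogonalPair.mk f hf).relation P)).trans
      ((cancel_epi (𝟙_ M ◁ tensorTwo fun i => A.carrier (c i))).symm.trans (Eq.congr
        ((auxData_isAux P.operad).binary_toFunctor (D := auxOperad C P.operad) A
          (point P.r₁) f).symm
        ((auxData_isAux P.operad).binary_toFunctor (D := auxOperad C P.operad) A
          (point P.r₂) f).symm))
  constructor
  · intro h c₁ c₂ t f₁ f₂ hf
    -- the pair `f₁, f₂` as a family indexed by `Fin 2`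
    exact (key (c := fun | 0 => c₁ | 1 => c₂) (fun | 0 => f₁ | 1 => f₂) hf).mp (h _)
  · intro h n c t s
    obtain ⟨f, hf⟩ := s
    exact (key f hf).mpr (h _ _ hf)

end Relations

/-! ### The operad of field theories and its algebras -/

section Quotients

variable {M : Type u} [Category.{v} M] [MonoidalCategory M] [SymmetricCategory M] [HasColimits M]
  [MonoidalClosed M]
variable {C : Type v} [SmallCategory C] {perp : OrthogonalityRelation C} {P : BipointedOperad M}

/-- The morphism `π` is a componentwise quotient by all consequences of the relations between the
two points of `P`. -/
def IsComponentwiseQuotient (perp : OrthogonalityRelation C) (P : BipointedOperad M)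
    {Q : Operad C M} (π : auxOperad C P.operad ⟶ Q) : Prop :=
  ∀ ⦃n : ℕ⦄ (c : Fin n → C) (t : C),
    IsJointCoequalizer (fun w : Word (OrthogonalPair perp) n c t =>
      w.pair (auxOperad C P.operad) fun s => s.relation P) (Operad.Hom.app π c t)

theorem IsComponentwiseQuotient.isFieldTheoryOperad {Q : Operad C M}
    {π : auxOperad C P.operad ⟶ Q} (hπ : IsComponentwiseQuotient perp P π) :
    IsFieldTheoryOperad perp P π where
  condition := (relMap_comp_eq_iff P π).mpr fun {_ c t} s => (hπ c t).condition (.rel s)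
  existsUnique_desc φ hφ :=
    existsUnique_operad_desc π (fun c t => hπ c t) φ ((relMap_comp_eq_iff P φ).mp hφ)

theorem exists_isComponentwiseQuotient (perp : OrthogonalityRelation C) (P : BipointedOperad M) :
    ∃ (Q : Operad C M) (π : auxOperad C P.operad ⟶ Q), IsComponentwiseQuotient perp P π :=
  exists_operad_quotient (auxOperad C P.operad) fun s : OrthogonalPair perp _ _ _ => s.relation P

/-- A universal property determines the operad up to isomorphism, so the componentwise description
of one quotient applies to all of them. -/
theorem IsFieldTheoryOperad.isComponentwiseQuotient {Q : Operad C M}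
    {π : auxOperad C P.operad ⟶ Q} (h : IsFieldTheoryOperad perp P π) :
    IsComponentwiseQuotient perp P π := by
  obtain ⟨Q₀, π₀, hπ₀⟩ := exists_isComponentwiseQuotient perp P
  have h₀ := hπ₀.isFieldTheoryOperad
  obtain ⟨a, ha, -⟩ := h₀.existsUnique_desc π h.condition
  obtain ⟨b, hb, -⟩ := h.existsUnique_desc π₀ h₀.condition
  have hab : a ≫ b = 𝟙 Q₀ := (h₀.existsUnique_desc π₀ h₀.condition).unique
    (by rw [← Category.assoc, ha, hb]) (Category.comp_id _)
  have hba : b ≫ a = 𝟙 Q := (h.existsUnique_desc π h.condition).unique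
    (by rw [← Category.assoc, hb, ha]) (Category.comp_id _)
  intro n c t
  have : IsIso (Operad.Hom.app a c t) :=
    ⟨Operad.Hom.app b c t, congrArg (fun x => Operad.Hom.app x c t) hab,
      congrArg (fun x => Operad.Hom.app x c t) hba⟩
  have := (hπ₀ c t).comp_iso (Operad.Hom.app a c t)
  rw [← ha]
  exact this

end Quotients

namespace OperadAlgebra

variable {M : Type u} [Category.{v} M] [MonoidalCategory M] [SymmetricCategory M]

theorem act_restrict {C : Type*} {O Q : Operad C M} (φ : O ⟶ Q) (A : OperadAlgebra Q) {X : M}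
    {n : ℕ} {c : Fin n → C} {t : C} (x : X ⟶ O.obj c t) :
    x ▷ _ ≫ (A.restrict φ).act c t = (x ≫ Operad.Hom.app φ c t) ▷ _ ≫ A.act c t := by
  rw [comp_whiskerRight, Category.assoc]
  rfl

theorem unary_restrict {C : Type*} {O Q : Operad C M} (φ : O ⟶ Q) (A : OperadAlgebra Q)
    {s t : C} (u : 𝟙_ M ⟶ O.obj (fun _ : Fin 1 => s) t) :
    (A.restrict φ).unary u = A.unary (u ≫ Operad.Hom.app φ _ t) := by
  have e := A.act_restrict φ u
  unfold unary
  rw [MonoidalCategory.tensorHom_def', MonoidalCategory.tensorHom_def', Category.assoc,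
    Category.assoc]
  exact congrArg (fun x => _ ≫ _ ≫ x) e

variable [MonoidalClosed M] {C : Type v} {O Q : Operad C M} {π : O ⟶ Q}
  {S : ∀ n : ℕ, (Fin n → C) → C → Type v}
  {r : ∀ {n : ℕ} {c : Fin n → C} {t : C}, S n c t → ParallelPair (O.obj c t)}
  (hπ : ∀ {n : ℕ} (c : Fin n → C) (t : C),
    IsJointCoequalizer (fun w : Word S n c t => w.pair O r) (Operad.Hom.app π c t))

/-- A morphism of algebras is also one between the extensions of these algebras. -/
noncomputable def extendMap {A B : OperadAlgebra O}
    (hA : ∀ {n : ℕ} {c : Fin n → C} {t : C} (s : S n c t), A.Respects (r s))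
    (hB : ∀ {n : ℕ} {c : Fin n → C} {t : C} (s : S n c t), B.Respects (r s)) (κ : A ⟶ B) :
    A.extend hπ hA ⟶ B.extend hπ hB :=
  ({ app := fun c => Hom.app κ c
     act := fun c t => by
      have := (hπ c t).epi
      have := epi_whiskerRight (Operad.Hom.app π c t) (tensor fun i => A.carrier (c i))
      refine (cancel_epi (Operad.Hom.app π c t ▷ (tensor fun i => A.carrier (c i)))).mp ?_
      refine (Category.assoc _ _ _).symm.trans
        ((congrArg (fun x => x ≫ Hom.app κ t) (A.app_extend_act hπ hA c t)).trans ?_)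
      have e := whisker_exchange_assoc (Operad.Hom.app π c t) (tensorMap fun i => Hom.app κ (c i))
        ((B.extend hπ hB).act c t)
      exact (Hom.act κ c t).trans ((congrArg _ (B.app_extend_act hπ hB c t).symm).trans e) } :
    Hom (A.extend hπ hA) (B.extend hπ hB))

theorem restrict_extend (A : OperadAlgebra O)
    (hA : ∀ {n : ℕ} {c : Fin n → C} {t : C} (s : S n c t), A.Respects (r s)) :
    (A.extend hπ hA).restrict π = A :=
  eq_of_act rfl fun _ c t => heq_of_eq (A.app_extend_act hπ hA c t)

theorem extend_eq_of_restrict_eq {A : OperadAlgebra O}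
    (hA : ∀ {n : ℕ} {c : Fin n → C} {t : C} (s : S n c t), A.Respects (r s))
    {B : OperadAlgebra Q} (h : B.restrict π = A) : A.extend hπ hA = B := by
  subst h
  refine eq_of_act rfl fun _ c t => heq_of_eq ?_
  have := ((hπ c t).whiskerRight (tensor fun i => B.carrier (c i))).epi
  exact (cancel_epi (Operad.Hom.app π c t ▷ tensor fun i => B.carrier (c i))).mp
    (app_extend_act hπ (B.restrict π) hA c t)

end OperadAlgebra

section Comparison

variable {M : Type u} [Category.{v} M] [MonoidalCategory M] [SymmetricCategory M] [HasColimits M]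
variable {C : Type v} [SmallCategory C] {perp : OrthogonalityRelation C} {P : BipointedOperad M}

theorem fieldTheory_hom_heq {F F' G G' : FT perp P} (hF : F = F') (hG : G = G') {f : F ⟶ G}
    {g : F' ⟶ G'} (h : ∀ c, HEq (OperadAlgebra.Hom.app (f.hom.app c) ())
      (OperadAlgebra.Hom.app (g.hom.app c) ())) : HEq f g := by
  subst hF hG
  refine heq_of_eq (ObjectProperty.hom_ext _ (NatTrans.ext (funext fun c => ?_)))
  exact OperadAlgebra.Hom.ext (funext fun _ => eq_of_heq (h c))

variable [MonoidalClosed M] {Q : Operad C M} {π : auxOperad C P.operad ⟶ Q}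

theorem respects_restrict (hπ : IsComponentwiseQuotient perp P π) (A : OperadAlgebra Q) {n : ℕ}
    {c : Fin n → C} {t : C} (s : OrthogonalPair perp n c t) :
    (A.restrict π).Respects (s.relation P) := by
  rw [OperadAlgebra.respects_iff, OperadAlgebra.act_restrict, OperadAlgebra.act_restrict]
  exact congrArg (fun x => x ▷ _ ≫ A.act c t) ((hπ c t).condition (.rel s))

/-- The field theory of an algebra over the operad of field theories. -/
noncomputable def fieldTheoryFunctor (hπ : IsComponentwiseQuotient perp P π) :
    OperadAlgebra Q ⥤ FT perp P :=
  ObjectProperty.lift _ (OperadAlgebra.restrictFunctor π ⋙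
      (auxData_isAux P.operad).toFunctorFunctor (D := auxOperad C P.operad))
    fun A => (respects_relation_iff P (A.restrict π)).mp fun s => respects_restrict hπ A s

theorem respects_ofFunctor (F : FT perp P) {n : ℕ} {c : Fin n → C} {t : C}
    (s : OrthogonalPair perp n c t) :
    ((auxData_isAux P.operad).ofFunctor (D := auxOperad C P.operad) F.obj).Respects
      (s.relation P) := by
  exact (respects_relation_iff P _).mpr ((congrArg (IsFieldTheory perp P)
    ((auxData_isAux P.operad).toFunctor_ofFunctor (D := auxOperad C P.operad) F.obj)).mpr
      F.property) s

/-- The algebra over the operad of field theories determined by a field theory. -/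
noncomputable def algebraFunctor (hπ : IsComponentwiseQuotient perp P π) :
    FT perp P ⥤ OperadAlgebra Q where
  obj F := ((auxData_isAux P.operad).ofFunctor (D := auxOperad C P.operad) F.obj).extend
    (fun c t => hπ c t) (respects_ofFunctor F)
  map {F G} η := OperadAlgebra.extendMap (fun c t => hπ c t) _ _
    (((auxData_isAux P.operad).ofFunctorFunctor (D := auxOperad C P.operad)).map η.hom)

theorem fieldTheoryFunctor_comp_algebraFunctor (hπ : IsComponentwiseQuotient perp P π) :
    fieldTheoryFunctor hπ ⋙ algebraFunctor hπ = 𝟭 (OperadAlgebra Q) := by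
  have hobj : ∀ A, (fieldTheoryFunctor hπ ⋙ algebraFunctor hπ).obj A = A := fun A =>
    OperadAlgebra.extend_eq_of_restrict_eq (fun c t => hπ c t)
      (respects_ofFunctor ((fieldTheoryFunctor hπ).obj A))
      ((auxData_isAux P.operad).ofFunctor_toFunctor (D := auxOperad C P.operad)
        (A.restrict π)).symm
  exact Functor.hext hobj fun A B _ =>
    OperadAlgebra.hom_heq (hobj A) (hobj B) fun _ => HEq.rfl

theorem algebraFunctor_comp_fieldTheoryFunctor (hπ : IsComponentwiseQuotient perp P π) :
    algebraFunctor hπ ⋙ fieldTheoryFunctor hπ = 𝟭 (FT perp P) := by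
  have hobj : ∀ F, (algebraFunctor hπ ⋙ fieldTheoryFunctor hπ).obj F = F := fun F =>
    ObjectProperty.FullSubcategory.ext
      ((congrArg ((auxData_isAux P.operad).toFunctor (D := auxOperad C P.operad))
        (OperadAlgebra.restrict_extend (fun c t => hπ c t) _ (respects_ofFunctor F))).trans
          ((auxData_isAux P.operad).toFunctor_ofFunctor (D := auxOperad C P.operad) F.obj))
  exact Functor.hext hobj fun F G _ =>
    fieldTheory_hom_heq (hobj F) (hobj G) fun _ => HEq.rfl

theorem fieldTheoryFunctor_isCanonical (hπ : IsComponentwiseQuotient perp P π) :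
    IsCanonical π (fieldTheoryFunctor hπ) := by
  -- the underlying objects agree definitionally, so each `eqToHom` is an identity
  refine ⟨fun _ _ => rfl, fun A t n => ?_, fun A c t f => ?_, fun κ c => ?_⟩
  · have e : (tensorMap fun _ : Fin n => 𝟙 (A.carrier t)) = 𝟙 _ := tensMap_id _ _
    refine (Category.comp_id _).trans ?_
    refine (A.act_restrict π (auxι P.operad.toOperadData fun _ : Fin n => 𝟙 t)).trans ?_
    rw [← tensorHom_id, ← e]
    rfl
  · refine (Category.comp_id _).trans (Eq.trans ?_ (Category.id_comp _).symm)
    refine (A.unary_restrict π (P.operad.one () ≫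
      auxι P.operad.toOperadData fun _ : Fin 1 => f)).trans ?_
    exact congrArg (A.unary (s := c) (t := t)) (Category.assoc _ _ _)
  · exact (Category.comp_id _).trans (Category.id_comp _).symm

end Comparison

end FieldTheoryOperads

theorem theorem3p5 {M : Type u} [Category.{v} M] [MonoidalCategory M] [SymmetricCategory M]
    [MonoidalClosed M] [HasLimits M] [HasColimits M] {C : Type v} [SmallCategory C]
    (perp : OrthogonalityRelation C) (P : BipointedOperad M) :
    (∃ (Q : Operad C M) (π : auxOperad C P.operad ⟶ Q), IsFieldTheoryOperad perp P π) ∧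
    ∀ (Q : Operad C M) (π : auxOperad C P.operad ⟶ Q), IsFieldTheoryOperad perp P π →
      ∃ (Φ : OperadAlgebra Q ⥤ FT perp P) (Ψ : FT perp P ⥤ OperadAlgebra Q),
        Φ ⋙ Ψ = 𝟭 (OperadAlgebra Q) ∧ Ψ ⋙ Φ = 𝟭 (FT perp P) ∧ IsCanonical π Φ := by
  refine ⟨?_, fun Q π h => ?_⟩
  · obtain ⟨Q, π, hπ⟩ := exists_isComponentwiseQuotient perp P
    exact ⟨Q, π, hπ.isFieldTheoryOperad⟩
  · have hπ := h.isComponentwiseQuotient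
    exact ⟨fieldTheoryFunctor hπ, algebraFunctor hπ, fieldTheoryFunctor_comp_algebraFunctor hπ,
      algebraFunctor_comp_fieldTheoryFunctor hπ, fieldTheoryFunctor_isCanonical hπ⟩
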